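/- **Notation.** Let $\mathbb H$ be the upper half plane, $q=e^{2\pi i\tau}$, $F(\mathbb H)$ the space of all functions $\mathbb H\to\mathbb C$, $\sigma_m(n)=\sum_{d\mid n}d^m$ for $m\in\mathbb Z$, and $\mathbb C(\tau)\subset F(\mathbb H)$ the space of rational functions without poles in $\mathbb H$. For an integral matrix $\mu=\begin{pmatrix}a&b\\c&d\end{pmatrix}$ with $\det\mu>0$ and $m\in\mathbb Z$ put $(f|_m\mu)(\tau)=(\det\mu)^{m/2}(c\tau+d)^{-m}f\!\left(\frac{a\tau+b}{c\tau+d}\right)$. Let $\mathfrak X\subset F(\mathbb H)$ be a linear subspace with $\mathfrak X|_m\mu\subset\mathfrak X$ for all integral $2\times 2$ matrices $\mu$ with $\det\mu>0$. The space $M_m(SL_2(\mathbb Z),\mathfrak X)$ consists of the holomorphic $f$ on $\mathbb H$ such that $f(\tau+1)=f(\tau)$; $f|_m\gamma-f\in\mathfrak X$ for all $\gamma\in SL_2(\mathbb Z)$; and for every $\gamma\in SL_2(\mathbb Z)$ there is a series $\sum_{l\in\mathbb Z}a_lq^l$, convergent on $\mathbb H$ and with $a_l=0$ for $l\ll0$,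 such that $f|_m\gamma-\sum_l a_lq^l\in\mathfrak X$. The subspace $C_m(SL_2(\mathbb Z),\mathfrak X)$ of Eichler cusp forms consists of those $f\in M_m(SL_2(\mathbb Z),\mathfrak X)$ for which, for every $\gamma$, such a series with $a_0=0$ exists. For $n\ge1$ let $\mathbb M_n=\{\mu\in \mathrm{Mat}_2(\mathbb Z):\det\mu=n\}$. For $k\ge1$ and a complete system $R$ of representatives of $SL_2(\mathbb Z)\backslash\mathbb M_n$ put $T_R(n)f=n^{-k/2-1}\sum_{\mu\in R}f|_{-k}\mu$. For $\tau\in\mathbb H$ let $G(s,\tau)=\sum_{(m,n)\in\mathbb Z^2\setminus\{(0,0)\}}(m\tau+n)^{-s}$ for $\operatorname{Re}s>2$, where powers are formed with $-\pi\le\arg z<\pi$. **Statement.** (A) Let $k\ge1$, let $\mathfrak X$ be as above with $m=-k$, and write $M=M_{-k}(SL_2(\mathbb Z),\mathfrak X)$. 1. For $n\ge1$ the operator $T_R(n)$ is well defined modulo $\mathfrak X$: if $f,g\in M+\mathfrak X$, $f-g\in\mathfrak X$, and $R,R'$ are two systems of representatives of $SL_2(\mathbb Z)\backslash\mathbb M_n$,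 then $T_R(n)f-T_{R'}(n)g\in\mathfrak X$. Moreover $(T_R(n)f)|_{-k}\gamma-T_R(n)f\in\mathfrak X$ for all $f\in M$, $\gamma\in SL_2(\mathbb Z)$ and all $R$. 2. The matrices $\begin{pmatrix}a&b\\0&d\end{pmatrix}$ with $ad=n$, $a\ge1$, $0\le b<d$ are a system of representatives of $SL_2(\mathbb Z)\backslash\mathbb M_n$. Write $T(n)$ for the linear operator formed with it. Then $T(n)$ maps $M$ to $M$ and $C_{-k}(SL_2(\mathbb Z),\mathfrak X)$ to itself, and for $f\in M$ $$(T(n)f)(\tau)=n^{-k-1}\sum_{\substack{ad=n,\ a\ge1\\0\le b<d}}d^{k}f\Bigl(\frac{a\tau+b}d\Bigr)=\frac1n\sum_{\substack{ad=n,\ a\ge1\\0\le b<d}}a^{-k}f\Bigl(\frac{a\tau+b}d\Bigr).$$ 3. If $f\in M$ and $f(\tau)=\sum_{l\ge0}\lambda(l)q^l$ on $\mathbb H$, then $(T(n)f)(\tau)=\sum_{l\ge0}\Bigl(\sum_{d\mid (n,l)}d^{-k-1}\lambda\bigl(\tfrac{nl}{d^2}\bigr)\Bigr)q^l$. 4.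 For $m,n\ge1$, on $M$: $T(n)T(m)=\sum_{d\mid(n,m)}d^{-k-1}T(nm/d^2)=T(m)T(n)$; in particular $T(n)T(m)=T(nm)$ if $(n,m)=1$. (B) For every $\tau\in\mathbb H$ the function $s\mapsto G(s,\tau)$ has a unique continuation to an entire function. Let $k\ge1$ and $G'_{-2k}(\tau)=\frac{\partial}{\partial s}G(s,\tau)\big|_{s=-2k}$. The space $\mathfrak X=\mathbb C(\tau)$ satisfies the stability condition above in weight $-2k$, $G'_{-2k}\in M_{-2k}(SL_2(\mathbb Z),\mathbb C(\tau))$, and for all $n\ge1$ $$T(n)G'_{-2k}=\sigma_{-2k-1}(n)\,G'_{-2k}.$$ Let $C_k=2\frac{(-1)^k(2k)!}{(2\pi)^{2k}}$ and $E'_{-2k}=\frac{2}{C_k\zeta(2k+1)}G'_{-2k}$. Then $E'_{-2k}(\tau)=1+\frac{2}{\zeta(2k+1)}\sum_{n\ge1}\sigma_{-2k-1}(n)q^n$. The associated $L$-function, that is, the Dirichlet series of the Fourier coefficients of $E'_{-2k}$ of positive index divided by the first one, satisfies $$L(E'_{-2k},s)=\sum_{n\ge1}\frac{\sigma_{-2k-1}(n)}{n^s}=\zeta(s)\,\zeta(s+2k+1)\qquad(\operatorname{Re}s>1).$$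 -/

import Mathlib

open UpperHalfPlane MatrixGroups
open scoped Manifold

noncomputable section

namespace HeckeIntegral

/-- The Möbius transform `(aτ + b) / (cτ + d)` of `τ ∈ ℍ` by an integral matrix. It is used only for
matrices of positive determinant, for which the quotient lies in `ℍ` (so that `ofComplex`, the
partial inverse of the inclusion `ℍ → ℂ`, merely recalls this fact). -/
def moebius (A : Matrix (Fin 2) (Fin 2) ℤ) (τ : ℍ) : ℍ :=
  ofComplex (((A 0 0 : ℂ) * τ + A 0 1) / ((A 1 0 : ℂ) * τ + A 1 1))

/-- The weight `m` slash operator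
`(f |_m A)(τ) = (det A)^(m/2) (cτ + d)^(-m) f ((aτ + b) / (cτ + d))`
for integral matrices `A` of positive determinant, as a linear map on the space `F(ℍ)` of all
functions `ℍ → ℂ`. The first factor is `1` on `SL₂(ℤ)`. -/
def slash (m : ℤ) (A : Matrix (Fin 2) (Fin 2) ℤ) : (ℍ → ℂ) →ₗ[ℂ] (ℍ → ℂ) where
  toFun f τ := (((A.det : ℝ) ^ ((m : ℝ) / 2) : ℝ) : ℂ) *
    ((A 1 0 : ℂ) * τ + A 1 1) ^ (-m) * f (moebius A τ)
  map_add' f g := by funext τ; simp only [Pi.add_apply]; ring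
  map_smul' c f := by funext τ; simp only [Pi.smul_apply, smul_eq_mul, RingHom.id_apply]; ring

/-- The space of period functions is stable under the slash action, of weight `m`, of all integral
matrices of positive determinant; in particular it is an `SL₂(ℤ)`-module. -/
def IsHeckeStable (m : ℤ) (X : Submodule ℂ (ℍ → ℂ)) : Prop :=
  ∀ A : Matrix (Fin 2) (Fin 2) ℤ, 0 < A.det → ∀ g ∈ X, slash m A g ∈ X

/-- `h` has, modulo `X`, the Fourier expansion `∑_{l ∈ ℤ} a_l q^l`, `q = exp(2πiτ)`, with only
finitely many nonzero terms of negative index. -/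
def HasFourierPart (X : Submodule ℂ (ℍ → ℂ)) (h : ℍ → ℂ) (a : ℤ → ℂ) : Prop :=
  (∃ N : ℤ, ∀ l < N, a l = 0) ∧
  ∃ g : ℍ → ℂ,
    (∀ τ : ℍ, HasSum (fun l : ℤ ↦ a l * Complex.exp (2 * Real.pi * Complex.I * l * τ)) (g τ)) ∧
    h - g ∈ X

lemma HasFourierPart.zero (X : Submodule ℂ (ℍ → ℂ)) : HasFourierPart X 0 0 :=
  ⟨⟨0, fun _ _ ↦ rfl⟩, 0, fun τ ↦ by simp, by simp⟩

lemma HasFourierPart.add {X : Submodule ℂ (ℍ → ℂ)} {h h' : ℍ → ℂ} {a a' : ℤ → ℂ}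
    (H : HasFourierPart X h a) (H' : HasFourierPart X h' a') :
    HasFourierPart X (h + h') (a + a') := by
  obtain ⟨⟨N, hN⟩, g, hg, hX⟩ := H
  obtain ⟨⟨N', hN'⟩, g', hg', hX'⟩ := H'
  refine ⟨⟨min N N', fun l hl ↦ ?_⟩, g + g', fun τ ↦ ?_, ?_⟩
  · simp [hN l (lt_of_lt_of_le hl (min_le_left _ _)),
      hN' l (lt_of_lt_of_le hl (min_le_right _ _))]
  · simpa [add_mul] using (hg τ).add (hg' τ)
  · have := X.add_mem hX hX'
    rwa [sub_add_sub_comm] at this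

lemma HasFourierPart.smul {X : Submodule ℂ (ℍ → ℂ)} {h : ℍ → ℂ} {a : ℤ → ℂ} (c : ℂ)
    (H : HasFourierPart X h a) : HasFourierPart X (c • h) (c • a) := by
  obtain ⟨⟨N, hN⟩, g, hg, hX⟩ := H
  refine ⟨⟨N, fun l hl ↦ by simp [hN l hl]⟩, c • g, fun τ ↦ ?_, ?_⟩
  · simpa [mul_assoc] using (hg τ).mul_left c
  · simpa [smul_sub] using X.smul_mem c hX

/-- `M_m(SL₂(ℤ), X)`: the space of periodic automorphic integrals of weight `m` for `SL₂(ℤ)` with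
period functions in `X`. -/
def autIntegrals (m : ℤ) (X : Submodule ℂ (ℍ → ℂ)) : Submodule ℂ (ℍ → ℂ) where
  carrier := {f | MDifferentiable 𝓘(ℂ) 𝓘(ℂ) f ∧
    (∀ τ : ℍ, f ((1 : ℝ) +ᵥ τ) = f τ) ∧
    (∀ γ : SL(2, ℤ), slash m γ f - f ∈ X) ∧
    ∀ γ : SL(2, ℤ), ∃ a : ℤ → ℂ, HasFourierPart X (slash m γ f) a}
  zero_mem' := ⟨mdifferentiable_const, fun _ ↦ rfl, fun γ ↦ by simp,
    fun γ ↦ ⟨0, by simpa using HasFourierPart.zero X⟩⟩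
  add_mem' := by
    rintro f g ⟨hf1, hf2, hf3, hf4⟩ ⟨hg1, hg2, hg3, hg4⟩
    refine ⟨hf1.add hg1, fun τ ↦ by simp [hf2, hg2], fun γ ↦ ?_, fun γ ↦ ?_⟩
    · have := X.add_mem (hf3 γ) (hg3 γ)
      rwa [sub_add_sub_comm, ← map_add] at this
    · obtain ⟨a, ha⟩ := hf4 γ
      obtain ⟨b, hb⟩ := hg4 γ
      exact ⟨a + b, by simpa using ha.add hb⟩
  smul_mem' := by
    rintro c f ⟨hf1, hf2, hf3, hf4⟩
    refine ⟨hf1.const_smul c, fun τ ↦ by simp [hf2], fun γ ↦ ?_, fun γ ↦ ?_⟩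
    · have := X.smul_mem c (hf3 γ)
      rwa [smul_sub, ← map_smul] at this
    · obtain ⟨a, ha⟩ := hf4 γ
      exact ⟨c • a, by simpa using ha.smul c⟩

/-- `C_m(SL₂(ℤ), X)`: the Eichler cusp forms, that is, the elements `f` of `M_m(SL₂(ℤ), X)` such that
every `f |_m γ` has, modulo `X`, a Fourier expansion without constant term. -/
def cuspIntegrals (m : ℤ) (X : Submodule ℂ (ℍ → ℂ)) : Submodule ℂ (ℍ → ℂ) where
  carrier := {f | f ∈ autIntegrals m X ∧
    ∀ γ : SL(2, ℤ), ∃ a : ℤ → ℂ, HasFourierPart X (slash m γ f) a ∧ a 0 = 0}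
  zero_mem' := ⟨zero_mem _, fun γ ↦ ⟨0, by simpa using HasFourierPart.zero X, rfl⟩⟩
  add_mem' := by
    rintro f g ⟨hf, hf'⟩ ⟨hg, hg'⟩
    refine ⟨add_mem hf hg, fun γ ↦ ?_⟩
    obtain ⟨a, ha, ha0⟩ := hf' γ
    obtain ⟨b, hb, hb0⟩ := hg' γ
    exact ⟨a + b, by simpa using ha.add hb, by simp [ha0, hb0]⟩
  smul_mem' := by
    rintro c f ⟨hf, hf'⟩
    refine ⟨Submodule.smul_mem _ c hf, fun γ ↦ ?_⟩
    obtain ⟨a, ha, ha0⟩ := hf' γ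
    exact ⟨c • a, by simpa using ha.smul c, by simp [ha0]⟩

/-- `R` is a complete system of representatives of the orbit space `SL₂(ℤ) \ M_n`, where `M_n` is
the set of integral `2 × 2` matrices of determinant `n`. -/
def IsRepSystem (n : ℕ) (R : Finset (Matrix (Fin 2) (Fin 2) ℤ)) : Prop :=
  (∀ ρ ∈ R, ρ.det = n) ∧
  ∀ μ : Matrix (Fin 2) (Fin 2) ℤ, μ.det = n →
    ∃! ρ, ρ ∈ R ∧ ∃ γ : SL(2, ℤ), μ = (γ : Matrix (Fin 2) (Fin 2) ℤ) * ρ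

/-- `f ↦ n^(-k/2-1) ∑_{μ ∈ R} f |_{-k} μ`. -/
def heckeSum (k n : ℕ) (R : Finset (Matrix (Fin 2) (Fin 2) ℤ)) : (ℍ → ℂ) →ₗ[ℂ] (ℍ → ℂ) :=
  (((n : ℝ) ^ (-(k : ℝ) / 2 - 1) : ℝ) : ℂ) • ∑ μ ∈ R, slash (-(k : ℤ)) μ

/-- The matrices with rows `(a, b)` and `(0, d)`, where `ad = n`, `a ≥ 1` and `0 ≤ b < d`. -/
def triangular (n : ℕ) : Finset (Matrix (Fin 2) (Fin 2) ℤ) :=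
  n.divisorsAntidiagonal.biUnion fun x ↦
    (Finset.range x.2).image fun b : ℕ ↦ !![(x.1 : ℤ), (b : ℤ); 0, (x.2 : ℤ)]

/-- The Hecke operator `T(n)` in weight `-k`, formed with the triangular representatives. -/
def heckeT (k n : ℕ) : (ℍ → ℂ) →ₗ[ℂ] (ℍ → ℂ) := heckeSum k n (triangular n)

/-- `f(τ) = ∑_{l ≥ 0} lam(l) q^l` on `ℍ`, `q = exp(2πiτ)`. -/
def HasQExpansion (f : ℍ → ℂ) (lam : ℕ → ℂ) : Prop :=
  ∀ τ : ℍ, HasSum (fun l : ℕ ↦ lam l * Complex.exp (2 * Real.pi * Complex.I * l * τ)) (f τ)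

/-- The divisor sum `σ_m(n) = ∑_{d ∣ n} d^m` for an integer `m`. -/
def sigma (m : ℤ) (n : ℕ) : ℂ := ∑ d ∈ n.divisors, (d : ℂ) ^ m

/-- `ℂ(τ)`: the rational functions (without poles on `ℍ`) as functions on `ℍ`. -/
def ratFunctions : Submodule ℂ (ℍ → ℂ) where
  carrier := {f | ∃ p q : Polynomial ℂ, ∀ τ : ℍ, q.eval (τ : ℂ) ≠ 0 ∧
    f τ = p.eval (τ : ℂ) / q.eval (τ : ℂ)}
  zero_mem' := ⟨0, 1, fun τ ↦ by simp⟩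
  add_mem' := by
    rintro f g ⟨p, q, h⟩ ⟨p', q', h'⟩
    refine ⟨p * q' + q * p', q * q', fun τ ↦ ?_⟩
    obtain ⟨h1, h2⟩ := h τ
    obtain ⟨h1', h2'⟩ := h' τ
    refine ⟨by simp [h1, h1'], ?_⟩
    simp only [Pi.add_apply, h2, h2', Polynomial.eval_add, Polynomial.eval_mul]
    rw [div_add_div _ _ h1 h1']
  smul_mem' := by
    rintro c f ⟨p, q, h⟩
    refine ⟨Polynomial.C c * p, q, fun τ ↦ ⟨(h τ).1, ?_⟩⟩
    simp [(h τ).2, mul_div_assoc]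

/-- The argument of `z ≠ 0` normalized by `-π ≤ arg z < π`. -/
def argP (z : ℂ) : ℝ := if z.arg = Real.pi then -Real.pi else z.arg

/-- The complex power `z ^ s` for `z ≠ 0`, with `-π ≤ arg z < π`. -/
def powP (z s : ℂ) : ℂ := Complex.exp (s * (Real.log ‖z‖ + argP z * Complex.I))

/-- `Φ` is the continuation to an entire function of the generalized Eisenstein series
`G(s, τ) = ∑_{(m, n) ≠ (0, 0)} (mτ + n)^(-s)`, `Re s > 2`. -/
def IsEisensteinContinuation (τ : ℍ) (Φ : ℂ → ℂ) : Prop :=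
  Differentiable ℂ Φ ∧ ∀ s : ℂ, 2 < s.re →
    HasSum (fun p : {p : ℤ × ℤ // p ≠ 0} ↦ powP ((p.1.1 : ℂ) * τ + p.1.2) (-s)) (Φ s)

open Classical in
/-- `G(s, τ)`, continued analytically to all `s`. -/
def genEisenstein (τ : ℍ) : ℂ → ℂ :=
  if h : ∃ Φ, IsEisensteinContinuation τ Φ then h.choose else 0

/-- The differential Eisenstein series `G'_m(τ) = ∂G(s, τ)/∂s` at `s = m`. -/
def diffEisenstein (m : ℤ) (τ : ℍ) : ℂ := deriv (genEisenstein τ) m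

/-- `C_k = 2 (-1)^k (2k)! / (2π)^(2k)`. -/
def constC (k : ℕ) : ℂ := 2 * ((-1) ^ k * (2 * k).factorial / (2 * Real.pi) ^ (2 * k))

/-- The normalized differential Eisenstein series `E'_{-2k} = 2 / (C_k ζ(2k+1)) G'_{-2k}`. -/
def normEisenstein (k : ℕ) (τ : ℍ) : ℂ :=
  2 / (constC k * riemannZeta (2 * k + 1)) * diffEisenstein (-(2 * k : ℤ)) τ

/-- The Fourier coefficients `1`, `2 σ_{-2k-1}(l) / ζ(2k+1)` (`l ≥ 1`). -/
def normCoeff (k l : ℕ) : ℂ :=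
  if l = 0 then 1 else 2 / riemannZeta (2 * k + 1) * sigma (-(2 * k : ℤ) - 1) l

end HeckeIntegral

end

noncomputable section

namespace HeckeIntegral

/-! Hecke operators. The slash operator is a right action, so `f|γA - f|A = (f|γ - f)|A`, and this
lies in `X` as soon as `f` is invariant modulo `X`, because `X` is stable under all integral
matrices of positive determinant. Hence a sum over left cosets is well defined modulo `X`. Right
multiplication by `γ` only permutes the cosets, so the sum is again invariant modulo `X`. That
invariance also reduces the Fourier condition at every `γ` to the one at `γ = 1`.

With the triangular representatives, `T(n)` involves only scalings and averages over translations.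
The Hecke relations and the action on Fourier coefficients therefore hold exactly, not just modulo
`X`: the first need only `f(τ+1) = f(τ)`, the second only the expansion (`heckeC_heckeC`,
`hasSum_heckeT`).

Eisenstein series. The normalization of the argument makes the terms at `(m,n)` and `-(m,n)` differ
by `exp(πis)`, so Lipschitz' formula gives `G(s,τ) = (1 + exp(πis)) (ζ(s) + (-2πi)^s / Γ(s) · ∑
σ_{s-1}(n) q^n)`. The first factor vanishes at `s = 1` and cancels the pole of `ζ`. At `s = -2k`
both `ζ` and `1/Γ` vanish, so the derivative retains only `ζ'(-2k)` and `(1/Γ)'(-2k)`; this is the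
expansion of `G'_{-2k}` (`diffEisenstein_eq`).

Period functions. After adding a multiple of `z^(2k+1)`, the series `∑ σ_{-2k-1}(n) q^n` is a
`(2k+1)`-fold primitive of a multiple of the modular form `E_{2k+2}`. By Bol's identity the
`(2k+1)`-st derivative intertwines the weights `-2k` and `2k+2`, so the periods of the corrected
series are polynomials; the added monomial has rational periods (`sigmaSeries_slash`).

Eigenvalues. The constant function `1` is an eigenfunction of `T(n)` with eigenvalue `σ_{-k-1}(n)`,
so the Hecke relations applied to it yield the relations among the `σ_{-k-1}(n)`. These give the
eigenvalue equation for `G'_{-2k}` coefficient by coefficient. The `L`-function factors because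
`σ_{-2k-1}` is the Dirichlet convolution of `1` and `n^(-2k-1)`. -/

lemma im_moebius_aux {A : Matrix (Fin 2) (Fin 2) ℤ} (τ : ℍ) :
    (((A 0 0 : ℂ) * τ + A 0 1) / ((A 1 0 : ℂ) * τ + A 1 1)).im =
      A.det * τ.im / Complex.normSq ((A 1 0 : ℂ) * τ + A 1 1) := by
  rw [Complex.div_im, ← sub_div, Matrix.det_fin_two]
  congr 1
  simp
  ring

lemma denom_ne_zero_of_det_pos {A : Matrix (Fin 2) (Fin 2) ℤ} (hA : 0 < A.det) (τ : ℍ) :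
    (A 1 0 : ℂ) * τ + A 1 1 ≠ 0 := by
  intro h
  have him := congrArg Complex.im h
  have hre := congrArg Complex.re h
  simp only [Complex.add_im, Complex.mul_im, Complex.intCast_re, Complex.intCast_im, coe_im,
    zero_mul, add_zero, Complex.zero_im, mul_eq_zero, Int.cast_eq_zero, τ.im_ne_zero,
    or_false] at him
  simp only [him, Int.cast_zero, zero_mul, zero_add, Complex.intCast_re, Complex.zero_re,
    Int.cast_eq_zero] at hre
  rw [Matrix.det_fin_two, him, hre] at hA
  simp at hA

lemma coe_moebius {A : Matrix (Fin 2) (Fin 2) ℤ} (hA : 0 < A.det) (τ : ℍ) :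
    (moebius A τ : ℂ) = ((A 0 0 : ℂ) * τ + A 0 1) / ((A 1 0 : ℂ) * τ + A 1 1) := by
  rw [moebius, ofComplex_apply_of_im_pos]
  rw [im_moebius_aux]
  have := Complex.normSq_pos.mpr (denom_ne_zero_of_det_pos hA τ)
  have h2 : (0 : ℝ) < A.det := by exact_mod_cast hA
  have := τ.im_pos
  positivity

lemma denom_mul {A B : Matrix (Fin 2) (Fin 2) ℤ} (hB : 0 < B.det) (τ : ℍ) :
    ((A * B) 1 0 : ℂ) * τ + (A * B) 1 1 =
      ((A 1 0 : ℂ) * moebius B τ + A 1 1) * ((B 1 0 : ℂ) * τ + B 1 1) := by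
  have := denom_ne_zero_of_det_pos hB τ
  rw [coe_moebius hB]
  simp only [Matrix.mul_apply, Fin.sum_univ_two]
  push_cast
  field_simp
  ring

lemma num_mul {A B : Matrix (Fin 2) (Fin 2) ℤ} (hB : 0 < B.det) (τ : ℍ) :
    ((A * B) 0 0 : ℂ) * τ + (A * B) 0 1 =
      ((A 0 0 : ℂ) * moebius B τ + A 0 1) * ((B 1 0 : ℂ) * τ + B 1 1) := by
  have := denom_ne_zero_of_det_pos hB τ
  rw [coe_moebius hB]
  simp only [Matrix.mul_apply, Fin.sum_univ_two]
  push_cast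
  field_simp
  ring

lemma det_mul_pos {A B : Matrix (Fin 2) (Fin 2) ℤ} (hA : 0 < A.det) (hB : 0 < B.det) :
    0 < (A * B).det := by
  rw [Matrix.det_mul]; positivity

lemma moebius_mul {A B : Matrix (Fin 2) (Fin 2) ℤ} (hA : 0 < A.det) (hB : 0 < B.det) (τ : ℍ) :
    moebius (A * B) τ = moebius A (moebius B τ) := by
  apply UpperHalfPlane.ext
  rw [coe_moebius (det_mul_pos hA hB), coe_moebius hA, denom_mul hB, num_mul hB,
    mul_div_mul_right _ _ (denom_ne_zero_of_det_pos hB τ)]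

lemma slash_apply (m : ℤ) (A : Matrix (Fin 2) (Fin 2) ℤ) (f : ℍ → ℂ) (τ : ℍ) :
    slash m A f τ = (((A.det : ℝ) ^ ((m : ℝ) / 2) : ℝ) : ℂ) *
      ((A 1 0 : ℂ) * τ + A 1 1) ^ (-m) * f (moebius A τ) := rfl

lemma slash_mul (m : ℤ) {A B : Matrix (Fin 2) (Fin 2) ℤ} (hA : 0 < A.det) (hB : 0 < B.det)
    (f : ℍ → ℂ) : slash m (A * B) f = slash m B (slash m A f) := by
  funext τ
  have hA' : (0 : ℝ) ≤ A.det := by exact_mod_cast hA.le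
  have hB' : (0 : ℝ) ≤ B.det := by exact_mod_cast hB.le
  simp only [slash_apply]
  rw [denom_mul hB, moebius_mul hA hB, mul_zpow, Matrix.det_mul, Int.cast_mul,
    Real.mul_rpow hA' hB']
  push_cast
  ring

lemma det_pos_SL (γ : SL(2, ℤ)) : 0 < (γ : Matrix (Fin 2) (Fin 2) ℤ).det := by
  rw [γ.det_coe]; exact one_pos

lemma slash_one (m : ℤ) (f : ℍ → ℂ) : slash m 1 f = f := by
  funext τ
  have : moebius 1 τ = τ := by
    apply UpperHalfPlane.ext
    rw [coe_moebius (by simp)]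
    simp
  simp [slash_apply, this]

/-! ### Coset sums modulo the period functions -/

/-- Functions that are invariant modulo `X` under the weight `m` action of `SL₂(ℤ)`. -/
def IsInvariantMod (m : ℤ) (X : Submodule ℂ (ℍ → ℂ)) (f : ℍ → ℂ) : Prop :=
  ∀ γ : SL(2, ℤ), slash m γ f - f ∈ X

lemma IsInvariantMod.of_mem_sup {m : ℤ} {X : Submodule ℂ (ℍ → ℂ)} (hX : IsHeckeStable m X)
    {f : ℍ → ℂ} (hf : f ∈ autIntegrals m X ⊔ X) : IsInvariantMod m X f := by
  obtain ⟨g, hg, x, hx, rfl⟩ := Submodule.mem_sup.mp hf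
  intro γ
  rw [map_add, add_sub_add_comm]
  exact X.add_mem (hg.2.2.1 γ) (X.sub_mem (hX _ (det_pos_SL γ) _ hx) hx)

lemma IsInvariantMod.slash_sub_mem {m : ℤ} {X : Submodule ℂ (ℍ → ℂ)} (hX : IsHeckeStable m X)
    {f : ℍ → ℂ} (hf : IsInvariantMod m X f) (γ : SL(2, ℤ)) {A : Matrix (Fin 2) (Fin 2) ℤ}
    (hA : 0 < A.det) : slash m ((γ : Matrix (Fin 2) (Fin 2) ℤ) * A) f - slash m A f ∈ X := by
  rw [slash_mul m (det_pos_SL γ) hA, ← map_sub]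
  exact hX A hA _ (hf γ)

lemma heckeSum_apply (k n : ℕ) (R : Finset (Matrix (Fin 2) (Fin 2) ℤ)) (f : ℍ → ℂ) :
    heckeSum k n R f = (((n : ℝ) ^ (-(k : ℝ) / 2 - 1) : ℝ) : ℂ) •
      ∑ μ ∈ R, slash (-(k : ℤ)) μ f := by
  simp [heckeSum]

lemma heckeSum_mem {k n : ℕ} (hn : 0 < n) {X : Submodule ℂ (ℍ → ℂ)}
    (hX : IsHeckeStable (-(k : ℤ)) X) {R : Finset (Matrix (Fin 2) (Fin 2) ℤ)}
    (hR : IsRepSystem n R) {f : ℍ → ℂ} (hf : f ∈ X) : heckeSum k n R f ∈ X := by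
  rw [heckeSum_apply]
  refine X.smul_mem _ (X.sum_mem fun μ hμ ↦ hX _ ?_ _ hf)
  rw [hR.1 μ hμ]; exact_mod_cast hn

lemma heckeSum_sub_heckeSum_mem_of_invariant {k n : ℕ} (hn : 0 < n) {X : Submodule ℂ (ℍ → ℂ)}
    (hX : IsHeckeStable (-(k : ℤ)) X) {R R' : Finset (Matrix (Fin 2) (Fin 2) ℤ)}
    (hR : IsRepSystem n R) (hR' : IsRepSystem n R') {f : ℍ → ℂ}
    (hf : IsInvariantMod (-(k : ℤ)) X f) : heckeSum k n R f - heckeSum k n R' f ∈ X := by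
  rw [heckeSum_apply, heckeSum_apply, ← smul_sub]
  refine X.smul_mem _ ?_
  -- `φ` sends a representative in `R` to the representative of the same coset in `R'`. It is a
  -- bijection, and corresponding terms differ by an element of `X`.
  choose φ hφ huniq using fun μ (hμ : μ ∈ R) ↦ hR'.2 μ (hR.1 μ hμ)
  have hsum : ∑ μ ∈ R'.attach, slash (-(k : ℤ)) μ.1 f =
      ∑ μ ∈ R.attach, slash (-(k : ℤ)) (φ μ.1 μ.2) f := by
    symm
    refine Finset.sum_bij (fun μ _ ↦ ⟨φ μ.1 μ.2, (hφ μ.1 μ.2).1⟩) (fun _ _ ↦ Finset.mem_attach _ _)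
      ?_ ?_ (fun _ _ ↦ rfl)
    · rintro ⟨μ, hμ⟩ - ⟨ν, hν⟩ - h
      obtain ⟨-, γ, hγ⟩ := hφ μ hμ
      obtain ⟨-, δ, hδ⟩ := hφ ν hν
      simp only [Subtype.mk.injEq] at h
      obtain ⟨ρ, -, hρ⟩ := hR.2 μ (hR.1 μ hμ)
      have h1 := hρ μ ⟨hμ, 1, by simp⟩
      have h2 := hρ ν ⟨hν, γ * δ⁻¹, by
        rw [hδ, ← h, ← mul_assoc, ← Matrix.SpecialLinearGroup.coe_mul, inv_mul_cancel_right]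
        exact hγ⟩
      simp [h1, h2]
    · rintro ⟨ρ, hρ⟩ -
      obtain ⟨μ, ⟨hμ, γ, hγ⟩, -⟩ := hR.2 ρ (hR'.1 ρ hρ)
      refine ⟨⟨μ, hμ⟩, Finset.mem_attach _ _, ?_⟩
      refine Subtype.ext (huniq μ hμ ρ ⟨hρ, γ⁻¹, ?_⟩).symm
      rw [hγ, ← mul_assoc, ← Matrix.SpecialLinearGroup.coe_mul, inv_mul_cancel]
      simp
  rw [← Finset.sum_attach R, ← Finset.sum_attach R', hsum, ← Finset.sum_sub_distrib]
  refine X.sum_mem fun μ _ ↦ ?_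
  obtain ⟨hmem, γ, hγ⟩ := hφ μ.1 μ.2
  have hdet : 0 < (φ μ.1 μ.2).det := by rw [hR'.1 _ hmem]; exact_mod_cast hn
  have := hf.slash_sub_mem hX γ hdet
  rwa [← hγ] at this

lemma heckeSum_sub_heckeSum_mem {k n : ℕ} (hn : 0 < n) {X : Submodule ℂ (ℍ → ℂ)}
    (hX : IsHeckeStable (-(k : ℤ)) X) {R R' : Finset (Matrix (Fin 2) (Fin 2) ℤ)}
    (hR : IsRepSystem n R) (hR' : IsRepSystem n R') {f g : ℍ → ℂ}
    (hf : IsInvariantMod (-(k : ℤ)) X f) (hfg : f - g ∈ X) :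
    heckeSum k n R f - heckeSum k n R' g ∈ X := by
  have h1 := heckeSum_sub_heckeSum_mem_of_invariant hn hX hR hR' hf
  have h2 := heckeSum_mem hn hX hR' hfg
  rw [map_sub] at h2
  simpa using X.add_mem h1 h2

/-- Right multiplication by `γ` commutes with the left action of `SL₂(ℤ)` and so permutes the
cosets. Acting by `γ` on a coset sum thus becomes a change of representatives. -/
lemma IsRepSystem.mul_right {n : ℕ} {R : Finset (Matrix (Fin 2) (Fin 2) ℤ)}
    (hR : IsRepSystem n R) (γ : SL(2, ℤ)) :
    IsRepSystem n (R.image (· * (γ : Matrix (Fin 2) (Fin 2) ℤ))) := by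
  have hγ : (γ : Matrix (Fin 2) (Fin 2) ℤ) * (γ⁻¹ : SL(2, ℤ)) = 1 := by
    rw [← Matrix.SpecialLinearGroup.coe_mul, mul_inv_cancel]; simp
  have hγ' : ((γ⁻¹ : SL(2, ℤ)) : Matrix (Fin 2) (Fin 2) ℤ) * γ = 1 := by
    rw [← Matrix.SpecialLinearGroup.coe_mul, inv_mul_cancel]; simp
  refine ⟨fun ρ hρ ↦ ?_, fun μ hμ ↦ ?_⟩
  · obtain ⟨σ, hσ, rfl⟩ := Finset.mem_image.mp hρ
    rw [Matrix.det_mul, hR.1 σ hσ, γ.det_coe, mul_one]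
  · obtain ⟨ρ, ⟨hρ, δ, hδ⟩, huniq⟩ := hR.2 (μ * (γ⁻¹ : SL(2, ℤ)))
      (by rw [Matrix.det_mul, hμ, Matrix.SpecialLinearGroup.det_coe, mul_one])
    refine ⟨ρ * γ, ⟨Finset.mem_image_of_mem _ hρ, δ, ?_⟩, ?_⟩
    · rw [← mul_assoc, ← hδ, mul_assoc, hγ', mul_one]
    · rintro ν ⟨hν, ε, hε⟩
      obtain ⟨σ, hσ, rfl⟩ := Finset.mem_image.mp hν
      rw [huniq σ ⟨hσ, ε, by rw [hε, mul_assoc, mul_assoc, hγ, mul_one]⟩]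

lemma slash_heckeSum {k n : ℕ} (hn : 0 < n) {R : Finset (Matrix (Fin 2) (Fin 2) ℤ)}
    (hR : ∀ ρ ∈ R, ρ.det = n) (γ : SL(2, ℤ)) (f : ℍ → ℂ) :
    slash (-(k : ℤ)) γ (heckeSum k n R f) =
      heckeSum k n (R.image (· * (γ : Matrix (Fin 2) (Fin 2) ℤ))) f := by
  have hγ : (γ : Matrix (Fin 2) (Fin 2) ℤ) * (γ⁻¹ : SL(2, ℤ)) = 1 := by
    rw [← Matrix.SpecialLinearGroup.coe_mul, mul_inv_cancel]; simp
  rw [heckeSum_apply, heckeSum_apply, map_smul, map_sum, Finset.sum_image]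
  · congr 1
    refine Finset.sum_congr rfl fun μ hμ ↦ (slash_mul _ ?_ (det_pos_SL γ) f).symm
    rw [hR μ hμ]; exact_mod_cast hn
  · intro μ _ ν _ h
    have := congrArg (· * ((γ⁻¹ : SL(2, ℤ)) : Matrix (Fin 2) (Fin 2) ℤ)) h
    simpa only [mul_assoc, hγ, mul_one] using this

lemma IsInvariantMod.heckeSum {k n : ℕ} (hn : 0 < n) {X : Submodule ℂ (ℍ → ℂ)}
    (hX : IsHeckeStable (-(k : ℤ)) X) {R : Finset (Matrix (Fin 2) (Fin 2) ℤ)}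
    (hR : IsRepSystem n R) {f : ℍ → ℂ} (hf : IsInvariantMod (-(k : ℤ)) X f) :
    IsInvariantMod (-(k : ℤ)) X (heckeSum k n R f) := by
  intro γ
  rw [slash_heckeSum hn hR.1]
  exact heckeSum_sub_heckeSum_mem_of_invariant hn hX (hR.mul_right γ) hR hf

/-! ### Triangular representatives and the explicit formulas -/

lemma mem_triangular {n : ℕ} (hn : 0 < n) {A : Matrix (Fin 2) (Fin 2) ℤ} :
    A ∈ triangular n ↔ A.det = n ∧ A 1 0 = 0 ∧ 0 < A 0 0 ∧ 0 ≤ A 0 1 ∧ A 0 1 < A 1 1 := by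
  simp only [triangular, Finset.mem_biUnion, Nat.mem_divisorsAntidiagonal, Finset.mem_image,
    Finset.mem_range, Prod.exists]
  constructor
  · rintro ⟨a, d, ⟨had, -⟩, b, hb, rfl⟩
    have ha : 0 < a := Nat.pos_of_ne_zero (by rintro rfl; omega)
    refine ⟨by simp [Matrix.det_fin_two, ← had], by simp, by simpa using ha, by simp, by simpa using hb⟩
  · rintro ⟨hdet, hc, ha, hb, hbd⟩
    obtain ⟨a, ha'⟩ := Int.eq_ofNat_of_zero_le ha.le
    obtain ⟨b, hb'⟩ := Int.eq_ofNat_of_zero_le hb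
    obtain ⟨d, hd'⟩ := Int.eq_ofNat_of_zero_le (hb.trans hbd.le)
    refine ⟨a, d, ⟨?_, hn.ne'⟩, b, ?_, ?_⟩
    · rw [Matrix.det_fin_two, hc, ha', hd'] at hdet
      rw [mul_zero, sub_zero] at hdet
      exact_mod_cast hdet
    · rw [hb', hd'] at hbd
      exact_mod_cast hbd
    · rw [Matrix.eta_fin_two A, hc, ha', hb', hd']

/-- The lower left zeros force `γ` to be upper triangular, positivity forces its diagonal to be `1`,
and a nonzero upper right entry would move `b` out of the range `0 ≤ b < d`. -/
lemma eq_of_triangular_of_eq_mul {n : ℕ} (hn : 0 < n) {A B : Matrix (Fin 2) (Fin 2) ℤ}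
    (hA : A ∈ triangular n) (hB : B ∈ triangular n) {γ : SL(2, ℤ)}
    (h : A = (γ : Matrix (Fin 2) (Fin 2) ℤ) * B) : A = B := by
  obtain ⟨-, hAc, hAa, hAb, hAbd⟩ := (mem_triangular hn).mp hA
  obtain ⟨-, hBc, hBa, hBb, hBbd⟩ := (mem_triangular hn).mp hB
  have hγ := Matrix.det_fin_two (γ : Matrix (Fin 2) (Fin 2) ℤ)
  rw [γ.det_coe] at hγ
  have h00 := congrFun₂ h 0 0
  have h01 := congrFun₂ h 0 1
  have h10 := congrFun₂ h 1 0
  have h11 := congrFun₂ h 1 1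
  generalize (γ : Matrix (Fin 2) (Fin 2) ℤ) = g at *
  simp only [Matrix.mul_apply, Fin.sum_univ_two, hBc, mul_zero, add_zero] at h00 h01 h10 h11
  rw [hAc, eq_comm, mul_eq_zero, or_iff_left hBa.ne'] at h10
  rw [h10] at hγ h11
  have hg00 : 0 < g 0 0 := by
    rw [h00] at hAa
    exact (pos_iff_pos_of_mul_pos hAa).mpr hBa
  have hg0 : g 0 0 = 1 := by
    rcases Int.eq_one_or_neg_one_of_mul_eq_one (show g 0 0 * g 1 1 = 1 by linarith) with h | h <;>
      omega
  have hg1 : g 1 1 = 1 := by rw [hg0] at hγ; linarith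
  rw [hg0, one_mul] at h00 h01
  rw [hg1, one_mul, zero_mul, zero_add] at h11
  have hg : g 0 1 = 0 := by
    have hpos : 0 < B 1 1 := hBb.trans_lt hBbd
    by_contra hne
    rcases lt_or_gt_of_ne hne with h | h <;> nlinarith
  rw [hg, zero_mul, add_zero] at h01
  rw [Matrix.eta_fin_two A, Matrix.eta_fin_two B, h00, h01, h11, hAc, hBc]

/-- Reduction theory: every matrix of determinant `n` is reached from a reduced one by the
generators of `SL₂(ℤ)`, and the property is preserved by left multiplication. Reduced matrices are
triangular since `ad = n` and `a > 0` give `d > 0`. -/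
lemma exists_mem_triangular {n : ℕ} (hn : 0 < n) (A : FixedDetMatrix (Fin 2) ℤ (n : ℤ)) :
    ∃ ρ ∈ triangular n, ∃ γ : SL(2, ℤ), A.1 = (γ : Matrix (Fin 2) (Fin 2) ℤ) * ρ := by
  have hsmul (B : FixedDetMatrix (Fin 2) ℤ (n : ℤ)) (δ : SL(2, ℤ))
      (hB : ∃ ρ ∈ triangular n, ∃ γ : SL(2, ℤ), B.1 = (γ : Matrix (Fin 2) (Fin 2) ℤ) * ρ) :
      ∃ ρ ∈ triangular n, ∃ γ : SL(2, ℤ), (δ • B).1 = (γ : Matrix (Fin 2) (Fin 2) ℤ) * ρ := by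
    obtain ⟨ρ, hρ, γ, hγ⟩ := hB
    exact ⟨ρ, hρ, δ * γ, by
      rw [FixedDetMatrices.smul_coe, hγ, Matrix.SpecialLinearGroup.coe_mul, mul_assoc]⟩
  refine FixedDetMatrices.induction_on (A := A) (C := fun B ↦ ∃ ρ ∈ triangular n,
    ∃ γ : SL(2, ℤ), B.1 = (γ : Matrix (Fin 2) (Fin 2) ℤ) * ρ) (by exact_mod_cast hn.ne') (fun B hc ha hb hbd ↦ ?_)
    (fun B hB ↦ hsmul B _ hB) (fun B hB ↦ hsmul B _ hB)
  refine ⟨B.1, (mem_triangular hn).mpr ⟨B.2, hc, ha, hb, ?_⟩, 1, by simp⟩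
  have hdet := B.2
  rw [Matrix.det_fin_two, hc, mul_zero, sub_zero] at hdet
  have hd : 0 < B.1 1 1 := (pos_iff_pos_of_mul_pos (by rw [hdet]; exact_mod_cast hn)).mp ha
  rwa [abs_of_nonneg hb, abs_of_pos hd] at hbd

lemma isRepSystem_triangular {n : ℕ} (hn : 0 < n) : IsRepSystem n (triangular n) := by
  refine ⟨fun ρ hρ ↦ ((mem_triangular hn).mp hρ).1, fun μ hμ ↦ ?_⟩
  obtain ⟨ρ, hρ, γ, hγ⟩ := exists_mem_triangular hn ⟨μ, hμ⟩
  refine ⟨ρ, ⟨hρ, γ, hγ⟩, ?_⟩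
  rintro σ ⟨hσ, δ, hδ⟩
  refine eq_of_triangular_of_eq_mul hn hσ hρ (γ := δ⁻¹ * γ) ?_
  rw [Matrix.SpecialLinearGroup.coe_mul, mul_assoc, ← hγ]
  change σ = _ * μ
  rw [hδ, ← mul_assoc, ← Matrix.SpecialLinearGroup.coe_mul, inv_mul_cancel]
  simp

lemma sum_triangular {M : Type*} [AddCommMonoid M] (n : ℕ)
    (F : Matrix (Fin 2) (Fin 2) ℤ → M) :
    ∑ μ ∈ triangular n, F μ = ∑ x ∈ n.divisorsAntidiagonal, ∑ b ∈ Finset.range x.2,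
      F !![(x.1 : ℤ), (b : ℤ); 0, (x.2 : ℤ)] := by
  rw [triangular, Finset.sum_biUnion]
  · refine Finset.sum_congr rfl fun x _ ↦ Finset.sum_image fun b _ c _ h ↦ ?_
    simpa using congrFun₂ h 0 1
  · intro x _ y _ hxy
    rw [Function.onFun, Finset.disjoint_left]
    rintro _ hx hy
    obtain ⟨b, -, rfl⟩ := Finset.mem_image.mp hx
    obtain ⟨c, -, h⟩ := Finset.mem_image.mp hy
    refine hxy (Prod.ext ?_ ?_)
    · simpa using (congrFun₂ h 0 0).symm
    · simpa using (congrFun₂ h 1 1).symm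

lemma slash_upper (k : ℕ) {n a b d : ℕ} (hn : 0 < n) (had : a * d = n) (f : ℍ → ℂ) (τ : ℍ) :
    (((n : ℝ) ^ (-(k : ℝ) / 2 - 1) : ℝ) : ℂ) *
      slash (-(k : ℤ)) !![(a : ℤ), (b : ℤ); 0, (d : ℤ)] f τ =
    (n : ℂ) ^ (-(k : ℤ) - 1) *
      ((d : ℂ) ^ k * f (ofComplex (((a : ℂ) * τ + (b : ℂ)) / (d : ℂ)))) := by
  have hn' : (0 : ℝ) < n := by exact_mod_cast hn
  have h1 : (n : ℝ) ^ (-(k : ℝ) / 2 - 1) * (n : ℝ) ^ (((-(k : ℤ) : ℤ) : ℝ) / 2) =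
      (n : ℝ) ^ (-(k : ℤ) - 1) := by
    rw [← Real.rpow_add hn', ← Real.rpow_intCast]
    congr 1
    push_cast
    ring
  have h2 : ((!![(a : ℤ), (b : ℤ); 0, (d : ℤ)] : Matrix (Fin 2) (Fin 2) ℤ).det : ℝ) = n := by
    simp [Matrix.det_fin_two, ← had]
  rw [slash_apply, h2]
  rw [← mul_assoc, ← mul_assoc, ← Complex.ofReal_mul, h1, moebius]
  simp [mul_assoc]

lemma heckeT_apply {k n : ℕ} (hn : 0 < n) (f : ℍ → ℂ) (τ : ℍ) :
    heckeT k n f τ =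
      (n : ℂ) ^ (-(k : ℤ) - 1) * ∑ x ∈ n.divisorsAntidiagonal, ∑ b ∈ Finset.range x.2,
        (x.2 : ℂ) ^ k * f (ofComplex (((x.1 : ℂ) * τ + (b : ℂ)) / (x.2 : ℂ))) := by
  rw [heckeT, heckeSum_apply, sum_triangular, Pi.smul_apply, Finset.sum_apply, smul_eq_mul,
    Finset.mul_sum, Finset.mul_sum]
  refine Finset.sum_congr rfl fun x hx ↦ ?_
  rw [Finset.sum_apply, Finset.mul_sum, Finset.mul_sum]
  exact Finset.sum_congr rfl fun b _ ↦
    slash_upper k hn (Nat.mem_divisorsAntidiagonal.mp hx).1 f τ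

lemma heckeT_apply' {k n : ℕ} (hn : 0 < n) (f : ℍ → ℂ) (τ : ℍ) :
    heckeT k n f τ =
      1 / (n : ℂ) * ∑ x ∈ n.divisorsAntidiagonal, ∑ b ∈ Finset.range x.2,
        (x.1 : ℂ) ^ (-(k : ℤ)) * f (ofComplex (((x.1 : ℂ) * τ + (b : ℂ)) / (x.2 : ℂ))) := by
  rw [heckeT_apply hn, Finset.mul_sum, Finset.mul_sum]
  refine Finset.sum_congr rfl fun x hx ↦ ?_
  rw [Finset.mul_sum, Finset.mul_sum]
  refine Finset.sum_congr rfl fun b _ ↦ ?_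
  obtain ⟨had, hn0⟩ := Nat.mem_divisorsAntidiagonal.mp hx
  have ha : (x.1 : ℂ) ≠ 0 := by rintro h; apply hn0; rw [← had, Nat.cast_eq_zero.mp h, zero_mul]
  have hd : (x.2 : ℂ) ≠ 0 := by rintro h; apply hn0; rw [← had, Nat.cast_eq_zero.mp h, mul_zero]
  rw [← mul_assoc, ← mul_assoc, ← had]
  congr 1
  push_cast
  rw [zpow_sub₀ (mul_ne_zero ha hd), zpow_neg, zpow_neg, zpow_natCast, zpow_natCast, mul_pow]
  field_simp

/-! ### Multiplicativity of the Hecke operators on periodic functions -/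

lemma sum_range_mul_add {M : Type*} [AddCommMonoid M] (d n : ℕ) (F : ℕ → M) :
    ∑ b ∈ Finset.range (d * n), F b =
      ∑ j ∈ Finset.range n, ∑ b ∈ Finset.range d, F (b + d * j) := by
  induction n with
  | zero => simp
  | succ n ih =>
    rw [mul_add_one, Finset.sum_range_add, ih, Finset.sum_range_succ]
    simp [add_comm]

lemma sum_range_mul_coprime {M : Type*} [AddCommMonoid M] {d a : ℕ} (hd : 0 < d)
    (had : a.Coprime d) {F : ℕ → M} (hF : Function.Periodic F d) :
    ∑ b ∈ Finset.range d, F (a * b) = ∑ b ∈ Finset.range d, F b := by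
  have hinj : Set.InjOn (fun b ↦ a * b % d) (Finset.range d) := by
    intro b hb c hc h
    have h' : b ≡ c [MOD d] := Nat.ModEq.cancel_left_of_coprime had.symm h
    rw [Finset.coe_range, Set.mem_Iio] at hb hc
    exact h'.eq_of_lt_of_lt hb hc
  have himage : (Finset.range d).image (fun b ↦ a * b % d) = Finset.range d := by
    refine Finset.eq_of_subset_of_card_le ?_ (Finset.card_image_of_injOn hinj).ge
    intro c hc
    obtain ⟨b, -, rfl⟩ := Finset.mem_image.mp hc
    exact Finset.mem_range.mpr (Nat.mod_lt _ hd)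
  calc ∑ b ∈ Finset.range d, F (a * b) = ∑ b ∈ Finset.range d, F (a * b % d) :=
        Finset.sum_congr rfl fun b _ ↦ (hF.map_mod_nat _).symm
    _ = ∑ b ∈ Finset.range d, F b := by
      conv_rhs => rw [← himage, Finset.sum_image hinj]

/-- `∑_{b mod d} F ((z + b) / d)` -/
def sumShift (d : ℕ) (F : ℂ → ℂ) (z : ℂ) : ℂ := ∑ b ∈ Finset.range d, F ((z + b) / d)

lemma sumShift_periodic {d : ℕ} (hd : 0 < d) {F : ℂ → ℂ} (hF : Function.Periodic F 1) :
    Function.Periodic (sumShift d F) 1 := by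
  intro z
  have hd' : (d : ℂ) ≠ 0 := by exact_mod_cast hd.ne'
  have h1 := Finset.sum_range_succ (fun b : ℕ ↦ F ((z + b) / d)) d
  have h2 := Finset.sum_range_succ' (fun b : ℕ ↦ F ((z + b) / d)) d
  have h3 : F ((z + d) / d) = F ((z + (0 : ℕ)) / d) := by
    rw [add_div, div_self hd', hF]; simp
  rw [h3] at h1
  have h4 := add_right_cancel (h1.symm.trans h2)
  rw [sumShift, sumShift, h4]
  refine Finset.sum_congr rfl fun b _ ↦ ?_
  congr 2
  push_cast
  ring

lemma sumShift_sumShift {d d' : ℕ} (hd : 0 < d) (hd' : 0 < d') (F : ℂ → ℂ) (z : ℂ) :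
    sumShift d (sumShift d' F) z = sumShift (d * d') F z := by
  have h1 : (d : ℂ) ≠ 0 := by exact_mod_cast hd.ne'
  have h2 : (d' : ℂ) ≠ 0 := by exact_mod_cast hd'.ne'
  simp only [sumShift]
  rw [sum_range_mul_add, Finset.sum_comm]
  refine Finset.sum_congr rfl fun j _ ↦ Finset.sum_congr rfl fun b _ ↦ ?_
  congr 1
  push_cast
  field_simp
  ring

/-- Since `ag · (z + b)/(dg) = (az + ab)/d`, the summand depends only on `b` modulo `d`. Each class
occurs `g` times, and multiplication by `a`, prime to `d`, permutes the classes. -/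
lemma sumShift_mul {a d g : ℕ} (hd : 0 < d) (hg : 0 < g) (had : a.Coprime d)
    {F : ℂ → ℂ} (hF : Function.Periodic F 1) (z : ℂ) :
    sumShift (d * g) (fun w ↦ F ((a * g : ℕ) * w)) z = g * sumShift d F (a * z) := by
  have h1 : (d : ℂ) ≠ 0 := by exact_mod_cast hd.ne'
  have h2 : (g : ℂ) ≠ 0 := by exact_mod_cast hg.ne'
  have hper : Function.Periodic (fun b : ℕ ↦ F ((a * z + b) / d)) d := by
    intro b
    simp only
    rw [Nat.cast_add, ← add_assoc, add_div _ (d : ℂ), div_self h1, hF]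
  have hz (b : ℕ) : ((a * g : ℕ) : ℂ) * ((z + b) / (d * g : ℕ)) = (a * z + (a * b : ℕ)) / d := by
    push_cast
    field_simp
  simp only [sumShift, hz]
  rw [sum_range_mul_add, Finset.sum_congr rfl (g := fun _ ↦ ∑ b ∈ Finset.range d,
    F ((a * z + b) / d)), Finset.sum_const, Finset.card_range, nsmul_eq_mul]
  intro j _
  rw [← sum_range_mul_coprime hd had hper]
  refine Finset.sum_congr rfl fun b _ ↦ ?_
  have := hper.nat_mul (a * j) (a * b)
  simp only [Nat.cast_id] at this
  rw [← this]
  congr 4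
  ring

/-- Bookkeeping for products of two triangular matrices with diagonals `(a, d)` and `(a', d')`: the
common factor `g = gcd(d, a')` is split off, leaving the diagonal `(aa'/g, dd'/g)` of determinant
`nm/g²`. -/
lemma sum_divisorsAntidiagonal_gcd {M : Type*} [AddCommMonoid M] {m n : ℕ} (hm : 0 < m)
    (hn : 0 < n) (Φ : ℕ → ℕ → ℕ → M) :
    ∑ x ∈ n.divisorsAntidiagonal, ∑ y ∈ m.divisorsAntidiagonal,
      Φ (x.2.gcd y.1) (x.1 * (y.1 / x.2.gcd y.1)) (x.2 / x.2.gcd y.1 * y.2) =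
    ∑ e ∈ (n.gcd m).divisors, ∑ p ∈ (n * m / e ^ 2).divisorsAntidiagonal, Φ e p.1 p.2 := by
  rw [← Finset.sum_product', Finset.sum_sigma']
  refine Finset.sum_nbij'
    (fun q ↦ ⟨q.1.2.gcd q.2.1, (q.1.1 * (q.2.1 / q.1.2.gcd q.2.1),
      q.1.2 / q.1.2.gcd q.2.1 * q.2.2)⟩)
    -- The inverse map: with `d = δg`, `a' = αg` and `δ`, `α` coprime, one has `A = aα` and `n/g =
    -- aδ`, so `a = gcd(A, n/g)` is recovered from `A` and `g`.
    (fun r ↦ ((r.2.1.gcd (n / r.1), n / r.1 / r.2.1.gcd (n / r.1) * r.1),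
      (r.2.1 / r.2.1.gcd (n / r.1) * r.1, m / r.1 / (r.2.1 / r.2.1.gcd (n / r.1))))) ?_ ?_ ?_ ?_ ?_
  · rintro ⟨⟨a, d⟩, ⟨a', d'⟩⟩ h
    simp only [Finset.mem_product, Nat.mem_divisorsAntidiagonal] at h
    obtain ⟨⟨h1, -⟩, h2, -⟩ := h
    have hg : 0 < d.gcd a' := Nat.gcd_pos_of_pos_left _ (Nat.pos_of_ne_zero (by
      rintro rfl; omega))
    obtain ⟨δ, α, hc, hd, ha'⟩ := Nat.exists_coprime d a'
    generalize d.gcd a' = g at *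
    subst hd ha' h1 h2
    simp only [Finset.mem_sigma, Nat.mem_divisors, Nat.mem_divisorsAntidiagonal]
    refine ⟨⟨Nat.dvd_gcd ⟨a * δ, by ring⟩ ⟨α * d', by ring⟩, ?_⟩, ?_, ?_⟩
    · exact (Nat.gcd_pos_of_pos_left _ hn).ne'
    · rw [Nat.mul_div_cancel _ hg, Nat.mul_div_cancel _ hg]
      symm
      apply Nat.div_eq_of_eq_mul_left (by positivity)
      ring
    · rw [show a * (δ * g) * (α * g * d') = a * δ * (α * d') * g ^ 2 by ring,
        Nat.mul_div_cancel _ (by positivity)]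
      intro h0
      have : a * (δ * g) * (α * g * d') = 0 := by
        rw [show a * (δ * g) * (α * g * d') = a * δ * (α * d') * g ^ 2 by ring, h0, zero_mul]
      have := Nat.mul_pos hn hm
      omega
  · rintro ⟨e, A, D⟩ h
    simp only [Finset.mem_sigma, Nat.mem_divisors, Nat.mem_divisorsAntidiagonal] at h
    obtain ⟨⟨he, -⟩, hAD, -⟩ := h
    obtain ⟨N, rfl⟩ := he.trans (Nat.gcd_dvd_left _ _)
    obtain ⟨K, rfl⟩ := he.trans (Nat.gcd_dvd_right _ _)
    have he0 : 0 < e := Nat.pos_of_mul_pos_right hn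
    have hN : 0 < N := Nat.pos_of_mul_pos_left hn
    have hα : 0 < A.gcd N := Nat.gcd_pos_of_pos_right _ hN
    rw [show e * N * (e * K) = N * K * e ^ 2 by ring, Nat.mul_div_cancel _ (by positivity)] at hAD
    simp only [Nat.mul_div_cancel_left _ he0, Finset.mem_product, Nat.mem_divisorsAntidiagonal]
    obtain ⟨β, γ, hc, hA, hN'⟩ := Nat.exists_coprime A N
    generalize A.gcd N = α at *
    subst hA hN'
    have hβ : β ∣ K := by
      refine hc.dvd_of_dvd_mul_left ⟨D, ?_⟩
      apply Nat.eq_of_mul_eq_mul_right hα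
      linarith
    rw [Nat.mul_div_cancel _ hα, Nat.mul_div_cancel _ hα]
    refine ⟨⟨by ring, hn.ne'⟩, ?_, hm.ne'⟩
    rw [mul_right_comm, Nat.mul_div_cancel' hβ, mul_comm]
  · rintro ⟨⟨a, d⟩, ⟨a', d'⟩⟩ h
    simp only [Finset.mem_product, Nat.mem_divisorsAntidiagonal] at h
    obtain ⟨⟨h1, -⟩, h2, -⟩ := h
    have hg : 0 < d.gcd a' := Nat.gcd_pos_of_pos_left _ (Nat.pos_of_ne_zero (by
      rintro rfl; omega))
    obtain ⟨δ, α, hc, hd, ha'⟩ := Nat.exists_coprime d a'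
    generalize d.gcd a' = g at *
    subst hd ha' h1 h2
    have ha : 0 < a := Nat.pos_of_mul_pos_right hn
    have hα : 0 < α := Nat.pos_of_mul_pos_right (Nat.pos_of_mul_pos_right hm)
    have e1 : a * (δ * g) / g = a * δ := by rw [← mul_assoc, Nat.mul_div_cancel _ hg]
    have e2 : α * g * d' / g = α * d' := by rw [mul_right_comm, Nat.mul_div_cancel _ hg]
    have e3 : (a * α).gcd (a * δ) = a := by rw [Nat.gcd_mul_left, hc.symm.gcd_eq_one, mul_one]
    simp only [Nat.mul_div_cancel _ hg, e1, e2, e3, Nat.mul_div_cancel_left _ ha,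
      Nat.mul_div_cancel_left _ hα]
  · rintro ⟨e, A, D⟩ h
    simp only [Finset.mem_sigma, Nat.mem_divisors, Nat.mem_divisorsAntidiagonal] at h
    obtain ⟨⟨he, -⟩, hAD, -⟩ := h
    obtain ⟨N, rfl⟩ := he.trans (Nat.gcd_dvd_left _ _)
    obtain ⟨K, rfl⟩ := he.trans (Nat.gcd_dvd_right _ _)
    have he0 : 0 < e := Nat.pos_of_mul_pos_right hn
    have hN : 0 < N := Nat.pos_of_mul_pos_left hn
    have hK : 0 < K := Nat.pos_of_mul_pos_left hm
    have hα : 0 < A.gcd N := Nat.gcd_pos_of_pos_right _ hN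
    rw [show e * N * (e * K) = N * K * e ^ 2 by ring, Nat.mul_div_cancel _ (by positivity)] at hAD
    simp only [Nat.mul_div_cancel_left _ he0]
    obtain ⟨β, γ, hc, hA, hN'⟩ := Nat.exists_coprime A N
    generalize A.gcd N = α at *
    subst hA hN'
    have hβ : β ∣ K := by
      refine hc.dvd_of_dvd_mul_left ⟨D, ?_⟩
      apply Nat.eq_of_mul_eq_mul_right hα
      linarith
    obtain ⟨δ, rfl⟩ := hβ
    have hβ0 : 0 < β := Nat.pos_of_mul_pos_right hK
    have hD : D = γ * δ := by
      apply Nat.eq_of_mul_eq_mul_left (Nat.mul_pos hβ0 hα)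
      rw [hAD]; ring
    subst hD
    have e1 : (γ * e).gcd (β * e) = e := by rw [Nat.gcd_mul_right, hc.symm.gcd_eq_one, one_mul]
    simp only [Nat.mul_div_cancel _ hα, Nat.mul_div_cancel_left _ hβ0, e1,
      Nat.mul_div_cancel _ he0, mul_comm α β]
  · intro q _
    rfl

/-- The Hecke operator of weight `-k` on functions of a complex variable. -/
def heckeC (k n : ℕ) (F : ℂ → ℂ) (z : ℂ) : ℂ :=
  1 / (n : ℂ) * ∑ x ∈ n.divisorsAntidiagonal, (x.1 : ℂ) ^ (-(k : ℤ)) * sumShift x.2 F (x.1 * z)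

lemma sumShift_sum {ι : Type*} (d : ℕ) (s : Finset ι) (F : ι → ℂ → ℂ) (z : ℂ) :
    sumShift d (fun w ↦ ∑ i ∈ s, F i w) z = ∑ i ∈ s, sumShift d (F i) z := by
  simp only [sumShift]; exact Finset.sum_comm

lemma sumShift_const_mul (d : ℕ) (c : ℂ) (F : ℂ → ℂ) (z : ℂ) :
    sumShift d (fun w ↦ c * F w) z = c * sumShift d F z := by
  simp only [sumShift, Finset.mul_sum]

lemma sumShift_comp_mul {a d : ℕ} (hd : 0 < d)
    {F : ℂ → ℂ} (hF : Function.Periodic F 1) (z : ℂ) :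
    sumShift d (fun w ↦ F (a * w)) z =
      d.gcd a * sumShift (d / d.gcd a) F ((a / d.gcd a : ℕ) * z) := by
  have hg : 0 < d.gcd a := Nat.gcd_pos_of_pos_left _ hd
  obtain ⟨δ, α, hc, hd', ha'⟩ := Nat.exists_coprime d a
  generalize d.gcd a = g at *
  subst hd' ha'
  rw [Nat.mul_div_cancel _ hg, Nat.mul_div_cancel _ hg]
  exact sumShift_mul (Nat.pos_of_mul_pos_right hd) hg hc.symm hF z

lemma heckeC_heckeC {k m n : ℕ} (hm : 0 < m) (hn : 0 < n) {F : ℂ → ℂ}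
    (hF : Function.Periodic F 1) (z : ℂ) :
    heckeC k n (heckeC k m F) z =
      ∑ d ∈ (n.gcd m).divisors, (d : ℂ) ^ (-(k : ℤ) - 1) * heckeC k (n * m / d ^ 2) F z := by
  -- The power `g^(1-k)` combines `g^(-k)`, from `a'^(-k)`, with the multiplicity `g` of
  -- `sumShift_comp_mul`. Replacing `1/(nm)` by the normalization of `T(nm/g²)` costs `g^(-2)`,
  -- which leaves `g^(-k-1)`.
  let Φ (g A D : ℕ) : ℂ := (1 / (n : ℂ) * (1 / (m : ℂ))) *
    ((g : ℂ) ^ (1 - (k : ℤ)) * ((A : ℂ) ^ (-(k : ℤ)) * sumShift D F (A * z)))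
  have hL : heckeC k n (heckeC k m F) z = ∑ x ∈ n.divisorsAntidiagonal,
      ∑ y ∈ m.divisorsAntidiagonal, Φ (x.2.gcd y.1) (x.1 * (y.1 / x.2.gcd y.1)) (x.2 / x.2.gcd y.1 * y.2) := by
    rw [heckeC, Finset.mul_sum]
    refine Finset.sum_congr rfl fun x hx ↦ ?_
    unfold heckeC
    rw [sumShift_const_mul, sumShift_sum, Finset.mul_sum, Finset.mul_sum, Finset.mul_sum]
    refine Finset.sum_congr rfl fun y hy ↦ ?_
    obtain ⟨hx1, -⟩ := Nat.mem_divisorsAntidiagonal.mp hx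
    obtain ⟨hy1, -⟩ := Nat.mem_divisorsAntidiagonal.mp hy
    have hx2 : 0 < x.2 := Nat.pos_of_ne_zero (by intro h; simp [h] at hx1; omega)
    have hy2 : 0 < y.2 := Nat.pos_of_ne_zero (by intro h; simp [h] at hy1; omega)
    rw [sumShift_const_mul, sumShift_comp_mul hx2 (sumShift_periodic hy2 hF)]
    have hg : 0 < x.2.gcd y.1 := Nat.gcd_pos_of_pos_left _ hx2
    have hg' : ((x.2.gcd y.1 : ℕ) : ℂ) ≠ 0 := by exact_mod_cast hg.ne'
    rw [sumShift_sumShift (Nat.div_pos (Nat.gcd_le_left _ hx2) hg) hy2]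
    have hy1' : (y.1 : ℂ) = x.2.gcd y.1 * (y.1 / x.2.gcd y.1 : ℕ) := by
      rw [← Nat.cast_mul, Nat.mul_div_cancel' (Nat.gcd_dvd_right _ _)]
    simp only [Φ]
    rw [hy1', mul_zpow, Nat.cast_mul, mul_zpow, sub_eq_add_neg, zpow_add₀ hg', zpow_one,
      ← mul_assoc ((y.1 / x.2.gcd y.1 : ℕ) : ℂ), mul_comm ((y.1 / x.2.gcd y.1 : ℕ) : ℂ) (x.1 : ℂ)]
    ring
  rw [hL, sum_divisorsAntidiagonal_gcd hm hn Φ]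
  simp only [Φ]
  refine Finset.sum_congr rfl fun e he ↦ ?_
  have he' := Nat.dvd_of_mem_divisors he
  obtain ⟨N, rfl⟩ := he'.trans (Nat.gcd_dvd_left _ _)
  obtain ⟨K, rfl⟩ := he'.trans (Nat.gcd_dvd_right _ _)
  have he0 : 0 < e := Nat.pos_of_mul_pos_right hn
  have hN : (N : ℂ) ≠ 0 := by exact_mod_cast (Nat.pos_of_mul_pos_left hn).ne'
  have hK : (K : ℂ) ≠ 0 := by exact_mod_cast (Nat.pos_of_mul_pos_left hm).ne'
  have he1 : (e : ℂ) ≠ 0 := by exact_mod_cast he0.ne'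
  rw [show e * N * (e * K) = N * K * e ^ 2 by ring, Nat.mul_div_cancel _ (by positivity)]
  rw [heckeC, Finset.mul_sum, Finset.mul_sum]
  refine Finset.sum_congr rfl fun p _ ↦ ?_
  rw [zpow_sub₀ he1, zpow_sub₀ he1, zpow_neg, zpow_neg, zpow_one]
  push_cast
  field_simp

lemma im_mul_add_div_pos {a d : ℕ} (ha : 0 < a) (hd : 0 < d) (b : ℕ) {z : ℂ} (hz : 0 < z.im) :
    0 < (((a : ℂ) * z + b) / d).im := by
  have : (((a : ℂ) * z + b) / d).im = a * z.im / d := by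
    rw [Complex.div_natCast_im]; simp
  rw [this]
  positivity

lemma heckeT_ofComplex {k n : ℕ} (hn : 0 < n) (f : ℍ → ℂ) {z : ℂ} (hz : 0 < z.im) :
    heckeT k n f (ofComplex z) = heckeC k n (f ∘ ofComplex) z := by
  rw [heckeT_apply' hn, heckeC]
  simp only [sumShift, Finset.mul_sum, Function.comp_apply, ofComplex_apply_of_im_pos hz]

lemma heckeC_congr {k n : ℕ} (hn : 0 < n) {F G : ℂ → ℂ} (h : ∀ z : ℂ, 0 < z.im → F z = G z)
    {z : ℂ} (hz : 0 < z.im) : heckeC k n F z = heckeC k n G z := by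
  simp only [heckeC, sumShift]
  congr 1
  refine Finset.sum_congr rfl fun x hx ↦ ?_
  obtain ⟨hx1, -⟩ := Nat.mem_divisorsAntidiagonal.mp hx
  congr 1
  refine Finset.sum_congr rfl fun b _ ↦ h _ (im_mul_add_div_pos ?_ ?_ b hz)
  · exact Nat.pos_of_ne_zero (by intro h; simp [h] at hx1; omega)
  · exact Nat.pos_of_ne_zero (by intro h; simp [h] at hx1; omega)

lemma periodic_comp_ofComplex {f : ℍ → ℂ} (hf : ∀ τ : ℍ, f ((1 : ℝ) +ᵥ τ) = f τ) :
    Function.Periodic (f ∘ ofComplex) 1 := by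
  intro z
  rcases lt_or_ge 0 z.im with hz | hz
  · have hz' : 0 < (z + 1).im := by simpa using hz
    simp only [Function.comp_apply]
    rw [ofComplex_apply_of_im_pos hz, ofComplex_apply_of_im_pos hz', ← hf ⟨z, hz⟩]
    congr 1
    apply UpperHalfPlane.ext
    simp [add_comm]
  · simp only [Function.comp_apply]
    -- Outside `ℍ` the map `ofComplex` is constant, so periodicity holds on all of `ℂ`.
    rw [ofComplex_apply_eq_of_im_nonpos (w' := z) (by simpa using hz) hz]

lemma heckeT_heckeT {k m n : ℕ} (hm : 0 < m) (hn : 0 < n) {f : ℍ → ℂ}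
    (hf : ∀ τ : ℍ, f ((1 : ℝ) +ᵥ τ) = f τ) :
    heckeT k n (heckeT k m f) =
      ∑ d ∈ (n.gcd m).divisors, (d : ℂ) ^ (-(k : ℤ) - 1) • heckeT k (n * m / d ^ 2) f := by
  funext τ
  have h1 := heckeT_ofComplex (k := k) hn (heckeT k m f) (z := τ) τ.im_pos
  rw [ofComplex_apply] at h1
  rw [h1, heckeC_congr hn (F := heckeT k m f ∘ ofComplex) (G := heckeC k m (f ∘ ofComplex))
    (fun z hz ↦ heckeT_ofComplex hm f hz) τ.im_pos,
    heckeC_heckeC hm hn (periodic_comp_ofComplex hf), Finset.sum_apply]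
  refine Finset.sum_congr rfl fun d hd ↦ ?_
  have hd' := Nat.dvd_of_mem_divisors hd
  have hpos : 0 < n * m / d ^ 2 := by
    have hdvd : d ^ 2 ∣ n * m := by
      rw [sq]; exact mul_dvd_mul (hd'.trans (Nat.gcd_dvd_left _ _)) (hd'.trans (Nat.gcd_dvd_right _ _))
    exact Nat.div_pos (Nat.le_of_dvd (by positivity) hdvd) (Nat.pos_of_dvd_of_pos hdvd (by positivity))
  rw [Pi.smul_apply, smul_eq_mul, ← heckeT_ofComplex hpos _ τ.im_pos, ofComplex_apply]

/-! ### Action on Fourier coefficients -/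

lemma sum_range_exp_two_pi {d : ℕ} (hd : 0 < d) (l : ℤ) :
    ∑ b ∈ Finset.range d, Complex.exp (2 * Real.pi * Complex.I * l * (b / d)) =
      if (d : ℤ) ∣ l then (d : ℂ) else 0 := by
  have hd' : (d : ℂ) ≠ 0 := by exact_mod_cast hd.ne'
  set ζ := Complex.exp (2 * Real.pi * Complex.I * l / d) with hζ
  have hpow (b : ℕ) : Complex.exp (2 * Real.pi * Complex.I * l * (b / d)) = ζ ^ b := by
    rw [hζ, ← Complex.exp_nat_mul]; congr 1; ring
  simp only [hpow]
  split_ifs with h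
  · obtain ⟨j, rfl⟩ := h
    have : ζ = 1 := by
      rw [hζ, Complex.exp_eq_one_iff]
      refine ⟨j, ?_⟩
      push_cast
      field_simp
    simp [this]
  · have hne : ζ ≠ 1 := by
      intro h1
      rw [hζ, Complex.exp_eq_one_iff] at h1
      obtain ⟨j, hj⟩ := h1
      apply h
      refine ⟨j, ?_⟩
      have hp := Complex.two_pi_I_ne_zero
      have : (l : ℂ) = d * j := by
        field_simp at hj
        linear_combination hj
      exact_mod_cast this
    have h1 : ζ ^ d = 1 := by
      rw [← hpow, Complex.exp_eq_one_iff]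
      refine ⟨l, ?_⟩
      field_simp
    have h2 := geom_sum_mul ζ d
    rw [h1, sub_self] at h2
    exact (mul_eq_zero.mp h2).resolve_right (sub_ne_zero.mpr hne)

/-- The Fourier coefficients of `T(n) f` in terms of those of `f`. -/
def heckeCoeff (k n : ℕ) (a : ℤ → ℂ) (l : ℤ) : ℂ :=
  ∑ x ∈ n.divisorsAntidiagonal,
    if (x.1 : ℤ) ∣ l then (x.1 : ℂ) ^ (-(k : ℤ) - 1) * a (x.2 * (l / x.1)) else 0

/-- Averaging over `b` modulo `d` kills every index not divisible by `d`, by orthogonality of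
characters. The surviving index `dj` then contributes to `q^(Aj)`. -/
lemma hasSum_sumShift {a : ℤ → ℂ} {F : ℂ → ℂ}
    (hF : ∀ z : ℂ, 0 < z.im →
      HasSum (fun l : ℤ ↦ a l * Complex.exp (2 * Real.pi * Complex.I * l * z)) (F z))
    {A d : ℕ} (hA : 0 < A) (hd : 0 < d) {z : ℂ} (hz : 0 < z.im) :
    HasSum (fun l : ℤ ↦ (if (A : ℤ) ∣ l then d * a (d * (l / A)) else 0) *
      Complex.exp (2 * Real.pi * Complex.I * l * z)) (sumShift d F (A * z)) := by
  have hd' : (d : ℂ) ≠ 0 := by exact_mod_cast hd.ne'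
  have hdZ : (d : ℤ) ≠ 0 := by exact_mod_cast hd.ne'
  have hAZ : (A : ℤ) ≠ 0 := by exact_mod_cast hA.ne'
  have h1 := hasSum_sum (s := Finset.range d) fun b _ ↦ hF _ (im_mul_add_div_pos hA hd b hz)
  have h2 : (fun l : ℤ ↦ ∑ b ∈ Finset.range d,
      a l * Complex.exp (2 * Real.pi * Complex.I * l * ((A * z + b) / d))) =
      fun l : ℤ ↦ if (d : ℤ) ∣ l then
        d * a l * Complex.exp (2 * Real.pi * Complex.I * l * (A * z / d)) else 0 := by
    funext l
    have h3 (b : ℕ) : a l * Complex.exp (2 * Real.pi * Complex.I * l * ((A * z + b) / d)) =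
        a l * Complex.exp (2 * Real.pi * Complex.I * l * (A * z / d)) *
          Complex.exp (2 * Real.pi * Complex.I * l * (b / d)) := by
      rw [mul_assoc (a l), ← Complex.exp_add]; congr 2; ring
    simp only [h3, ← Finset.mul_sum, sum_range_exp_two_pi hd]
    split_ifs <;> ring
  rw [h2] at h1
  have hinj : Function.Injective fun j : ℤ ↦ (d : ℤ) * j := mul_right_injective₀ hdZ
  rw [← hinj.hasSum_iff] at h1
  swap
  · intro l hl
    rw [if_neg]
    rintro ⟨j, rfl⟩
    exact hl ⟨j, rfl⟩
  have hinj' : Function.Injective fun j : ℤ ↦ (A : ℤ) * j := mul_right_injective₀ hAZ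
  rw [← hinj'.hasSum_iff]
  swap
  · intro l hl
    rw [if_neg, zero_mul]
    rintro ⟨j, rfl⟩
    exact hl ⟨j, rfl⟩
  convert! h1 using 1
  funext j
  simp only [Function.comp_apply, dvd_mul_right, if_true, Int.mul_ediv_cancel_left _ hAZ]
  congr 2
  push_cast
  field_simp

lemma hasSum_heckeT {k n : ℕ} (hn : 0 < n) {a : ℤ → ℂ} {f : ℍ → ℂ}
    (hf : ∀ τ : ℍ, HasSum (fun l : ℤ ↦ a l * Complex.exp (2 * Real.pi * Complex.I * l * τ)) (f τ))
    (τ : ℍ) : HasSum (fun l : ℤ ↦ heckeCoeff k n a l *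
      Complex.exp (2 * Real.pi * Complex.I * l * τ)) (heckeT k n f τ) := by
  have hF (z : ℂ) (hz : 0 < z.im) : HasSum (fun l : ℤ ↦ a l *
      Complex.exp (2 * Real.pi * Complex.I * l * z)) ((f ∘ ofComplex) z) := by
    rw [Function.comp_apply, ofComplex_apply_of_im_pos hz]; exact hf ⟨z, hz⟩
  have h1 := heckeT_ofComplex (k := k) hn f (z := τ) τ.im_pos
  rw [ofComplex_apply] at h1
  rw [h1, heckeC, Finset.mul_sum]
  simp only [heckeCoeff, Finset.sum_mul]
  refine hasSum_sum fun x hx ↦ ?_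
  obtain ⟨hx1, -⟩ := Nat.mem_divisorsAntidiagonal.mp hx
  have hA : 0 < x.1 := Nat.pos_of_ne_zero (by intro h; simp [h] at hx1; omega)
  have hd : 0 < x.2 := Nat.pos_of_ne_zero (by intro h; simp [h] at hx1; omega)
  have hA' : (x.1 : ℂ) ≠ 0 := by exact_mod_cast hA.ne'
  have hd' : (x.2 : ℂ) ≠ 0 := by exact_mod_cast hd.ne'
  convert! ((hasSum_sumShift hF hA hd τ.im_pos).mul_left ((x.1 : ℂ) ^ (-(k : ℤ)))).mul_left
    (1 / (n : ℂ)) using 1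
  funext l
  rw [← hx1]
  split_ifs
  · rw [zpow_sub₀ hA', zpow_one]
    push_cast
    field_simp
  · simp

lemma heckeCoeff_natCast {k n : ℕ} (hn : 0 < n) (a : ℤ → ℂ) (l : ℕ) :
    heckeCoeff k n a l =
      ∑ d ∈ (n.gcd l).divisors, (d : ℂ) ^ (-(k : ℤ) - 1) * a (n * l / d ^ 2 : ℕ) := by
  rw [heckeCoeff, Nat.sum_divisorsAntidiagonal (fun A D ↦
    if (A : ℤ) ∣ l then (A : ℂ) ^ (-(k : ℤ) - 1) * a (D * (l / A)) else 0), ← Finset.sum_filter]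
  refine Finset.sum_congr ?_ fun d hd ↦ ?_
  · ext d
    simp only [Finset.mem_filter, Nat.mem_divisors, Int.natCast_dvd_natCast, Nat.dvd_gcd_iff]
    have : n.gcd l ≠ 0 := (Nat.gcd_pos_of_pos_left _ hn).ne'
    have := hn.ne'
    tauto
  · have hd' := Nat.dvd_of_mem_divisors hd
    have hd0 : 0 < d := Nat.pos_of_mem_divisors hd
    obtain ⟨N, rfl⟩ := hd'.trans (Nat.gcd_dvd_left _ _)
    obtain ⟨K, rfl⟩ := hd'.trans (Nat.gcd_dvd_right _ _)
    rw [show d * N * (d * K) = N * K * d ^ 2 by ring, Nat.mul_div_cancel _ (by positivity),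
      Nat.mul_div_cancel_left _ hd0, Nat.cast_mul d, Int.mul_ediv_cancel_left _ (by positivity)]
    push_cast
    rfl

lemma hasQExpansion_heckeT {k n : ℕ} (hn : 0 < n) {f : ℍ → ℂ} {lam : ℕ → ℂ}
    (hf : HasQExpansion f lam) : HasQExpansion (heckeT k n f) (fun l ↦
      ∑ d ∈ (n.gcd l).divisors, (d : ℂ) ^ (-(k : ℤ) - 1) * lam (n * l / d ^ 2)) := by
  have hinj : Function.Injective (Nat.cast : ℕ → ℤ) := Nat.cast_injective
  let a : ℤ → ℂ := fun l ↦ if 0 ≤ l then lam l.toNat else 0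
  have ha : ∀ τ : ℍ, HasSum (fun l : ℤ ↦ a l *
      Complex.exp (2 * Real.pi * Complex.I * l * τ)) (f τ) := by
    intro τ
    rw [← hinj.hasSum_iff]
    · convert! hf τ using 1
    · intro l hl
      have : ¬ 0 ≤ l := fun h ↦ hl ⟨l.toNat, Int.toNat_of_nonneg h⟩
      simp [a, this]
  intro τ
  have := hasSum_heckeT (k := k) hn ha τ
  rw [← hinj.hasSum_iff] at this
  · convert! this using 1
    funext l
    rw [Function.comp_apply, heckeCoeff_natCast hn]
    have haN (j : ℕ) : a (j : ℤ) = lam j := by simp [a]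
    simp only [haN, Int.cast_natCast]
  · intro l hl
    have hl : l < 0 := by
      by_contra h
      exact hl ⟨l.toNat, Int.toNat_of_nonneg (not_lt.mp h)⟩
    rw [heckeCoeff, Finset.sum_eq_zero, zero_mul]
    intro x hx
    obtain ⟨hx1, -⟩ := Nat.mem_divisorsAntidiagonal.mp hx
    have hA : 0 < x.1 := Nat.pos_of_ne_zero (by intro h; simp [h] at hx1; omega)
    have hd : 0 < x.2 := Nat.pos_of_ne_zero (by intro h; simp [h] at hx1; omega)
    split_ifs
    · have h1 : l / (x.1 : ℤ) < 0 := Int.ediv_neg_of_neg_of_pos hl (by exact_mod_cast hA)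
      have h2 : ¬ (0 : ℤ) ≤ x.2 * (l / x.1) :=
        not_le.mpr (mul_neg_of_pos_of_neg (by exact_mod_cast hd) h1)
      simp [a, h2]
    · rfl

/-- The coefficient at `l = Aj` involves `a` at `dj`. Replacing `N` by `min N 0` makes
multiplication by `d ≥ 1` move the bound and the negative index `j` downwards, never upwards. -/
lemma heckeCoeff_eq_zero {k n : ℕ} {a : ℤ → ℂ} {N : ℤ} (hN : ∀ l < N, a l = 0)
    {l : ℤ} (hl : l < n * min N 0) : heckeCoeff k n a l = 0 := by
  refine Finset.sum_eq_zero fun x hx ↦ ?_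
  obtain ⟨hx1, hn⟩ := Nat.mem_divisorsAntidiagonal.mp hx
  have hA : 0 < (x.1 : ℤ) := by
    exact_mod_cast Nat.pos_of_ne_zero (by intro h; simp [h] at hx1; omega)
  have hd : 0 < (x.2 : ℤ) := by
    exact_mod_cast Nat.pos_of_ne_zero (by intro h; simp [h] at hx1; omega)
  split_ifs with h
  · obtain ⟨j, rfl⟩ := h
    rw [Int.mul_ediv_cancel_left _ hA.ne', hN, mul_zero]
    have h0 : min N 0 ≤ 0 := min_le_right _ _
    have h1 : j < x.2 * min N 0 := by
      rw [← hx1, Nat.cast_mul, mul_assoc] at hl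
      exact lt_of_mul_lt_mul_left hl hA.le
    have h2 : x.2 * min N 0 ≤ min N 0 := by nlinarith
    have h3 : (x.2 : ℤ) * j ≤ j := by nlinarith
    exact (h3.trans_lt h1).trans_le (h2.trans (min_le_left _ _))
  · rfl

lemma heckeCoeff_zero {k n : ℕ} {a : ℤ → ℂ} (ha : a 0 = 0) : heckeCoeff k n a 0 = 0 := by
  simp [heckeCoeff, ha]

/-! ### Stability of the automorphic integrals and of the cusp forms -/

lemma HasFourierPart.heckeT {k n : ℕ} (hn : 0 < n) {X : Submodule ℂ (ℍ → ℂ)}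
    (hX : IsHeckeStable (-(k : ℤ)) X) {f : ℍ → ℂ} {a : ℤ → ℂ} (hf : HasFourierPart X f a) :
    HasFourierPart X (heckeT k n f) (heckeCoeff k n a) := by
  obtain ⟨⟨N, hN⟩, g, hg, hfg⟩ := hf
  refine ⟨⟨n * min N 0, fun l hl ↦ heckeCoeff_eq_zero hN hl⟩, HeckeIntegral.heckeT k n g,
    hasSum_heckeT hn hg, ?_⟩
  rw [← map_sub]
  exact heckeSum_mem hn hX (isRepSystem_triangular hn) hfg

lemma HasFourierPart.congr {X : Submodule ℂ (ℍ → ℂ)} {f f' : ℍ → ℂ} {a : ℤ → ℂ}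
    (hf : HasFourierPart X f a) (h : f' - f ∈ X) : HasFourierPart X f' a := by
  obtain ⟨hN, g, hg, hfg⟩ := hf
  exact ⟨hN, g, hg, by simpa using X.add_mem h hfg⟩

lemma differentiableOn_heckeC {k n : ℕ} {F : ℂ → ℂ}
    (hF : DifferentiableOn ℂ F {z | 0 < z.im}) :
    DifferentiableOn ℂ (heckeC k n F) {z | 0 < z.im} := by
  unfold heckeC
  simp only [sumShift]
  refine DifferentiableOn.const_mul (DifferentiableOn.fun_sum fun x hx ↦
    DifferentiableOn.const_mul (DifferentiableOn.fun_sum fun b _ ↦ ?_) _) _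
  obtain ⟨hx1, hn⟩ := Nat.mem_divisorsAntidiagonal.mp hx
  refine hF.comp (by fun_prop) fun z hz ↦ im_mul_add_div_pos ?_ ?_ b hz
  · exact Nat.pos_of_ne_zero (by intro h; simp [h] at hx1; omega)
  · exact Nat.pos_of_ne_zero (by intro h; simp [h] at hx1; omega)

lemma mdifferentiable_heckeT {k n : ℕ} (hn : 0 < n) {f : ℍ → ℂ}
    (hf : MDifferentiable 𝓘(ℂ) 𝓘(ℂ) f) : MDifferentiable 𝓘(ℂ) 𝓘(ℂ) (heckeT k n f) := by
  rw [UpperHalfPlane.mdifferentiable_iff] at hf ⊢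
  exact (differentiableOn_heckeC hf).congr fun z hz ↦ heckeT_ofComplex hn f hz

lemma heckeC_periodic {k n : ℕ} {F : ℂ → ℂ} (hF : Function.Periodic F 1) :
    Function.Periodic (heckeC k n F) 1 := by
  intro z
  rw [heckeC, heckeC]
  congr 1
  refine Finset.sum_congr rfl fun x hx ↦ ?_
  obtain ⟨hx1, hn⟩ := Nat.mem_divisorsAntidiagonal.mp hx
  have hd : 0 < x.2 := Nat.pos_of_ne_zero (by intro h; simp [h] at hx1; omega)
  have := (sumShift_periodic hd hF).nat_mul x.1 (x.1 * z)
  rw [mul_add, this]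

lemma heckeT_vadd {k n : ℕ} (hn : 0 < n) {f : ℍ → ℂ} (hf : ∀ τ : ℍ, f ((1 : ℝ) +ᵥ τ) = f τ)
    (τ : ℍ) : heckeT k n f ((1 : ℝ) +ᵥ τ) = heckeT k n f τ := by
  have h (τ : ℍ) : heckeT k n f τ = heckeC k n (f ∘ ofComplex) τ := by
    rw [← heckeT_ofComplex hn f τ.im_pos, ofComplex_apply]
  rw [h, h, coe_vadd, add_comm, Complex.ofReal_one]
  exact heckeC_periodic (periodic_comp_ofComplex hf) _

lemma isInvariantMod_heckeT {k n : ℕ} (hn : 0 < n) {X : Submodule ℂ (ℍ → ℂ)}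
    (hX : IsHeckeStable (-(k : ℤ)) X) {f : ℍ → ℂ} (hf : f ∈ autIntegrals (-(k : ℤ)) X) :
    IsInvariantMod (-(k : ℤ)) X (heckeT k n f) :=
  IsInvariantMod.heckeSum hn hX (isRepSystem_triangular hn) hf.2.2.1

lemma heckeT_mem_autIntegrals {k n : ℕ} (hn : 0 < n) {X : Submodule ℂ (ℍ → ℂ)}
    (hX : IsHeckeStable (-(k : ℤ)) X) {f : ℍ → ℂ} (hf : f ∈ autIntegrals (-(k : ℤ)) X) :
    heckeT k n f ∈ autIntegrals (-(k : ℤ)) X := by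
  refine ⟨mdifferentiable_heckeT hn hf.1, heckeT_vadd hn hf.2.1, isInvariantMod_heckeT hn hX hf,
    fun γ ↦ ?_⟩
  -- The expansion at `γ = 1` serves for every `γ`, since `T(n) f` is invariant modulo `X`.
  obtain ⟨a, ha⟩ := hf.2.2.2 1
  rw [Matrix.SpecialLinearGroup.coe_one, slash_one] at ha
  exact ⟨_, (ha.heckeT hn hX).congr (isInvariantMod_heckeT hn hX hf γ)⟩

lemma heckeT_mem_cuspIntegrals {k n : ℕ} (hn : 0 < n) {X : Submodule ℂ (ℍ → ℂ)}
    (hX : IsHeckeStable (-(k : ℤ)) X) {f : ℍ → ℂ} (hf : f ∈ cuspIntegrals (-(k : ℤ)) X) :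
    heckeT k n f ∈ cuspIntegrals (-(k : ℤ)) X := by
  refine ⟨heckeT_mem_autIntegrals hn hX hf.1, fun γ ↦ ?_⟩
  obtain ⟨a, ha, ha0⟩ := hf.2 1
  rw [Matrix.SpecialLinearGroup.coe_one, slash_one] at ha
  exact ⟨_, (ha.heckeT hn hX).congr (isInvariantMod_heckeT hn hX hf.1 γ), heckeCoeff_zero ha0⟩

/-! ### Lipschitz' formula by Poisson summation -/

section Lipschitz

open Complex MeasureTheory Set Filter Topology

lemma integrableOn_rpow_mul_exp_neg_mul {a b : ℝ} (ha : -1 < a) (hb : 0 < b) :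
    IntegrableOn (fun t : ℝ ↦ t ^ a * Real.exp (-b * t)) (Ioi 0) := by
  simpa using integrableOn_rpow_mul_exp_neg_mul_rpow ha one_pos hb

lemma norm_cpow_mul_exp_neg {a r : ℂ} {t : ℝ} (ht : 0 < t) :
    ‖(t : ℂ) ^ a * cexp (-(r * t))‖ = t ^ a.re * Real.exp (-r.re * t) := by
  rw [norm_mul, norm_cpow_eq_rpow_re_of_pos ht, norm_exp]
  simp

lemma aestronglyMeasurable_cpow_mul_exp_neg (a r : ℂ) :
    AEStronglyMeasurable (fun t : ℝ ↦ (t : ℂ) ^ a * cexp (-(r * t)))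
      (volume.restrict (Ioi 0)) := by
  refine ContinuousOn.aestronglyMeasurable (fun t ht ↦ ?_) measurableSet_Ioi
  refine ContinuousAt.continuousWithinAt (ContinuousAt.mul ?_ (by fun_prop))
  exact continuousAt_ofReal_cpow_const _ _ (Or.inr (ne_of_gt ht))

lemma hasDerivAt_integral_cpow_mul_exp_neg {a : ℂ} (ha : 0 < a.re) {r₀ : ℂ} (hr : 0 < r₀.re) :
    HasDerivAt (fun r : ℂ ↦ ∫ t : ℝ in Ioi 0, (t : ℂ) ^ (a - 1) * cexp (-(r * t)))
      (∫ t : ℝ in Ioi 0, -((t : ℂ) ^ a * cexp (-(r₀ * t)))) r₀ := by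
  -- On this neighbourhood `exp(-t Re r₀ / 2)` dominates the exponential uniformly in `r`.
  have hs : {r : ℂ | r₀.re / 2 < r.re} ∈ 𝓝 r₀ :=
    (isOpen_lt continuous_const Complex.continuous_re).mem_nhds (by simp [hr])
  refine (hasDerivAt_integral_of_dominated_loc_of_deriv_le (μ := volume.restrict (Ioi 0))
    (F := fun r (t : ℝ) ↦ (t : ℂ) ^ (a - 1) * cexp (-(r * t)))
    (F' := fun r (t : ℝ) ↦ -((t : ℂ) ^ a * cexp (-(r * t))))
    (bound := fun t ↦ t ^ a.re * Real.exp (-(r₀.re / 2) * t)) hs ?_ ?_ ?_ ?_ ?_ ?_).2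
  · exact Eventually.of_forall fun r ↦ aestronglyMeasurable_cpow_mul_exp_neg _ r
  · refine (integrable_norm_iff (aestronglyMeasurable_cpow_mul_exp_neg _ _)).mp ?_
    refine (integrableOn_rpow_mul_exp_neg_mul (a := (a - 1).re) (by simpa using ha) hr).congr_fun
      (fun t ht ↦ (norm_cpow_mul_exp_neg ht).symm) measurableSet_Ioi
  · exact (aestronglyMeasurable_cpow_mul_exp_neg _ _).neg
  · refine (ae_restrict_iff' measurableSet_Ioi).mpr (Eventually.of_forall fun t ht r hr ↦ ?_)
    rw [norm_neg, norm_cpow_mul_exp_neg ht]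
    have ht' : 0 < t := ht
    have hr' : r₀.re / 2 < r.re := hr
    gcongr
  · exact integrableOn_rpow_mul_exp_neg_mul (by linarith) (by linarith)
  · refine (ae_restrict_iff' measurableSet_Ioi).mpr (Eventually.of_forall fun t ht r _ ↦ ?_)
    have ht' : (t : ℂ) ≠ 0 := by exact_mod_cast (ne_of_gt ht)
    have h1 : HasDerivAt (fun r : ℂ ↦ -(r * t)) (-(1 * t)) r :=
      ((hasDerivAt_id r).mul_const _).neg
    refine (h1.cexp.const_mul ((t : ℂ) ^ (a - 1))).congr_deriv ?_
    rw [cpow_sub _ _ ht', cpow_one]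
    field_simp

/-- Both sides are holomorphic in `r` on the right half plane and agree for real `r > 0` by Euler's
integral; the identity theorem, applied at `r = 1`, does the rest. -/
lemma integral_cpow_mul_exp_neg_mul_Ioi_of_re_pos {a r : ℂ} (ha : 0 < a.re) (hr : 0 < r.re) :
    ∫ t : ℝ in Ioi 0, (t : ℂ) ^ (a - 1) * cexp (-(r * t)) = r ^ (-a) * Gamma a := by
  have hopen : IsOpen {r : ℂ | 0 < r.re} := isOpen_lt continuous_const Complex.continuous_re
  have hL : AnalyticOnNhd ℂ (fun r : ℂ ↦ ∫ t : ℝ in Ioi 0, (t : ℂ) ^ (a - 1) * cexp (-(r * t)))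
      {r : ℂ | 0 < r.re} := by
    refine DifferentiableOn.analyticOnNhd (fun r hr ↦ ?_) hopen
    exact (hasDerivAt_integral_cpow_mul_exp_neg ha hr).differentiableAt.differentiableWithinAt
  have hR : AnalyticOnNhd ℂ (fun r : ℂ ↦ r ^ (-a) * Gamma a) {r : ℂ | 0 < r.re} := by
    refine DifferentiableOn.analyticOnNhd (fun r hr ↦ ?_) hopen
    refine DifferentiableAt.differentiableWithinAt (DifferentiableAt.mul_const ?_ _)
    exact differentiableAt_id.cpow_const (Or.inl hr)
  have hpre : IsPreconnected {r : ℂ | 0 < r.re} := (convex_halfSpace_re_gt 0).isPreconnected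
  refine hL.eqOn_of_preconnected_of_frequently_eq hR hpre (z₀ := 1) (by simp) ?_ hr
  have htend : Tendsto (fun x : ℝ ↦ (x : ℂ)) (𝓝[≠] 1) (𝓝[≠] 1) := by
    refine tendsto_nhdsWithin_iff.mpr ⟨?_, ?_⟩
    · exact (continuous_ofReal.tendsto' 1 1 (by simp)).mono_left nhdsWithin_le_nhds
    · filter_upwards [self_mem_nhdsWithin] with x hx
      simpa using hx
  refine htend.frequently (Eventually.frequently ?_)
  filter_upwards [nhdsWithin_le_nhds (lt_mem_nhds (zero_lt_one : (0 : ℝ) < 1))] with x hx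
  rw [integral_cpow_mul_exp_neg_mul_Ioi ha hx, one_div, ← ofReal_inv, cpow_neg, ofReal_inv,
    inv_cpow]
  rw [arg_ofReal_of_nonneg hx.le]
  exact Real.pi_pos.ne

/-- The function `t ↦ t^(s-1) exp(2πitτ)` on `(0, ∞)`, extended by zero. -/
def lipschitzAux (s τ : ℂ) (t : ℝ) : ℂ :=
  ((max t 0 : ℝ) : ℂ) ^ (s - 1) * cexp (2 * Real.pi * Complex.I * τ * t)

lemma lipschitzAux_of_nonpos {s : ℂ} (hs : 1 < s.re) (τ : ℂ) {t : ℝ} (ht : t ≤ 0) :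
    lipschitzAux s τ t = 0 := by
  have : s - 1 ≠ 0 := by
    intro h
    have := congrArg Complex.re h
    simp at this
    linarith
  rw [lipschitzAux, max_eq_right ht, ofReal_zero, zero_cpow this, zero_mul]

lemma lipschitzAux_of_nonneg (s τ : ℂ) {t : ℝ} (ht : 0 ≤ t) :
    lipschitzAux s τ t = (t : ℂ) ^ (s - 1) * cexp (-(-(2 * Real.pi * Complex.I * τ) * t)) := by
  rw [lipschitzAux, max_eq_left ht]
  simp

lemma continuous_lipschitzAux {s : ℂ} (hs : 1 < s.re) (τ : ℂ) :
    Continuous (lipschitzAux s τ) := by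
  unfold lipschitzAux
  refine Continuous.mul ?_ (by fun_prop)
  exact (continuous_ofReal_cpow_const (y := s - 1) (by simpa using hs)).comp
    (continuous_id.max continuous_const)

lemma lipschitzAux_isBigO {s : ℂ} (hs : 1 < s.re) {τ : ℂ} (hτ : 0 < τ.im) (b : ℝ) :
    (lipschitzAux s τ) =O[cocompact ℝ] (|·| ^ (-b)) := by
  rw [cocompact_eq_atBot_atTop, Asymptotics.isBigO_sup]
  constructor
  · refine Asymptotics.IsBigO.of_bound 0 ?_
    filter_upwards [eventually_le_atBot 0] with t ht
    simp [lipschitzAux_of_nonpos hs τ ht]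
  · have h1 := isLittleO_exp_neg_mul_rpow_atTop (a := 2 * Real.pi * τ.im) (by positivity)
      (-b - (s.re - 1))
    have h2 := (Asymptotics.isBigO_refl (fun t : ℝ ↦ t ^ (s.re - 1)) atTop).mul h1.isBigO
    refine Asymptotics.IsBigO.trans (Asymptotics.IsBigO.of_bound 1 ?_) (h2.congr' ?_ ?_)
      (g := fun t : ℝ ↦ t ^ (s.re - 1) * Real.exp (-(2 * Real.pi * τ.im) * t))
    · filter_upwards [eventually_gt_atTop 0] with t ht
      rw [lipschitzAux_of_nonneg s τ ht.le, norm_cpow_mul_exp_neg ht, one_mul, Real.norm_eq_abs]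
      refine le_trans (le_of_eq ?_) (le_abs_self _)
      simp
    · exact EventuallyEq.rfl
    · filter_upwards [eventually_gt_atTop 0] with t ht
      rw [← Real.rpow_add ht, abs_of_pos ht]
      congr 1
      ring

open FourierTransform in
-- Euler's integral with `r = -2πi(τ - ξ)`, whose real part is `2π Im τ > 0`.
lemma fourier_lipschitzAux {s : ℂ} (hs : 1 < s.re) {τ : ℂ} (hτ : 0 < τ.im) (ξ : ℝ) :
    𝓕 (lipschitzAux s τ) ξ = (-(2 * Real.pi * Complex.I * (τ - ξ))) ^ (-s) * Gamma s := by
  rw [Real.fourier_real_eq_integral_exp_smul,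
    ← integral_cpow_mul_exp_neg_mul_Ioi_of_re_pos (by linarith) (by
      simp; positivity)]
  rw [← integral_indicator measurableSet_Ioi]
  congr 1
  funext t
  rw [indicator_apply]
  split_ifs with ht
  · rw [lipschitzAux_of_nonneg s τ (le_of_lt ht), smul_eq_mul, mul_left_comm, ← Complex.exp_add]
    congr 2
    push_cast
    ring
  · rw [lipschitzAux_of_nonpos hs τ (not_lt.mp ht), smul_zero]

/-- The arguments `-π/2` of `-2πi` and `arg z ∈ (0, π]` add up within `(-π, π]`, so the principal
logarithms add. -/
lemma neg_two_pi_I_mul_cpow {z : ℂ} (hz : 0 < z.im) (w : ℂ) :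
    (-(2 * Real.pi * Complex.I * z)) ^ w = (-(2 * Real.pi * Complex.I)) ^ w * z ^ w := by
  have hz0 : z ≠ 0 := by rintro rfl; simp at hz
  have hc : (-(2 * Real.pi * Complex.I) : ℂ) ≠ 0 := neg_ne_zero.mpr two_pi_I_ne_zero
  have harg : arg (-(2 * Real.pi * Complex.I)) = -(Real.pi / 2) := by
    have : (-(2 * Real.pi * Complex.I) : ℂ) = ((2 * Real.pi : ℝ) : ℂ) * (-Complex.I) := by push_cast; ring
    rw [this, arg_real_mul _ (by positivity), arg_neg_I]
  have h1 : 0 < arg z := by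
    refine lt_of_le_of_ne (arg_nonneg_iff.mpr hz.le) fun h ↦ ?_
    have := (arg_eq_zero_iff.mp h.symm).2
    exact hz.ne' this
  have h2 := arg_le_pi z
  have : (-(2 * Real.pi * Complex.I * z)) = (-(2 * Real.pi * Complex.I)) * z := by ring
  rw [this, cpow_def_of_ne_zero (mul_ne_zero hc hz0), cpow_def_of_ne_zero hc,
    cpow_def_of_ne_zero hz0, ← Complex.exp_add, Complex.log_mul hc hz0, add_mul]
  rw [harg]
  constructor <;> linarith [Real.pi_pos]

/-- **Lipschitz' formula** for complex exponents. -/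
theorem tsum_add_cpow_neg {s : ℂ} (hs : 1 < s.re) {τ : ℂ} (hτ : 0 < τ.im)
    (hsum : Summable fun n : ℤ ↦ (τ + n) ^ (-s)) :
    ∑' n : ℤ, (τ + n) ^ (-s) = (-(2 * Real.pi * Complex.I)) ^ s / Gamma s *
      ∑' l : ℕ+, (l : ℂ) ^ (s - 1) * cexp (2 * Real.pi * Complex.I * τ) ^ (l : ℕ) := by
  have hc : (-(2 * Real.pi * Complex.I) : ℂ) ≠ 0 := neg_ne_zero.mpr two_pi_I_ne_zero
  have hG : Gamma s ≠ 0 := Gamma_ne_zero_of_re_pos (by linarith)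
  have hfou (n : ℤ) : FourierTransform.fourier (lipschitzAux s τ) ((-n : ℤ) : ℝ) =
      (-(2 * Real.pi * Complex.I)) ^ (-s) * Gamma s * (τ + n) ^ (-s) := by
    rw [fourier_lipschitzAux hs hτ, neg_two_pi_I_mul_cpow (by simpa using hτ)]
    push_cast
    rw [sub_neg_eq_add]
    ring
  have hsum' : Summable fun n : ℤ ↦ FourierTransform.fourier (lipschitzAux s τ) (n : ℝ) := by
    rw [← (Equiv.neg ℤ).summable_iff]
    refine (hsum.mul_left ((-(2 * Real.pi * Complex.I)) ^ (-s) * Gamma s)).congr fun n ↦ ?_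
    exact (hfou n).symm
  -- Poisson summation at `x = 0`. The transform at frequency `-n` is a constant times `(τ +
  -- n)^(-s)`, which is why the transform side is reindexed by `n ↦ -n`.
  have hP := Real.tsum_eq_tsum_fourier_of_rpow_decay_of_summable (continuous_lipschitzAux hs τ)
    one_lt_two (lipschitzAux_isBigO hs hτ 2) hsum' 0
  have hR : ∑' n : ℤ, FourierTransform.fourier (lipschitzAux s τ) (n : ℝ) *
      fourier n ((0 : ℝ) : UnitAddCircle) =
      (-(2 * Real.pi * Complex.I)) ^ (-s) * Gamma s * ∑' n : ℤ, (τ + n) ^ (-s) := by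
    rw [← tsum_mul_left, ← (Equiv.neg ℤ).tsum_eq]
    refine tsum_congr fun n ↦ ?_
    rw [← hfou]
    simp
  have hLft : ∑' n : ℤ, lipschitzAux s τ (0 + n) =
      ∑' l : ℕ+, (l : ℂ) ^ (s - 1) * cexp (2 * Real.pi * Complex.I * τ) ^ (l : ℕ) := by
    have hinj : Function.Injective (fun l : ℕ+ ↦ ((l : ℕ) : ℤ)) := fun a b h ↦
      PNat.coe_injective (Nat.cast_injective (R := ℤ) h)
    rw [← hinj.tsum_eq]
    · refine tsum_congr fun l ↦ ?_
      rw [zero_add, lipschitzAux_of_nonneg s τ (by simp), ← Complex.exp_nat_mul]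
      congr 2
      push_cast
      ring
    · intro n hn
      have hpos : 0 < n := by
        by_contra h
        refine hn (lipschitzAux_of_nonpos hs τ ?_)
        rw [zero_add]
        exact_mod_cast not_lt.mp h
      exact ⟨⟨n.toNat, by omega⟩, by simp [hpos.le]⟩
  rw [hLft, hR] at hP
  rw [hP, cpow_neg]
  have := cpow_ne_zero_iff_of_exponent_ne_zero (x := (-(2 * Real.pi * Complex.I) : ℂ)) (y := s)
    (by rintro rfl; simp at hs; linarith)
  field_simp [this.mpr hc]

end Lipschitz

/-! ### Lambert series with a complex exponent -/

section DivisorSeries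

open Complex

/-- The divisor sum `∑_{d ∣ n} d^(s-1)` with complex exponent. -/
def divisorSum (s : ℂ) (n : ℕ) : ℂ := ∑ d ∈ n.divisors, (d : ℂ) ^ (s - 1)

lemma norm_natCast_cpow_sub_one_le {s : ℂ} {K d : ℕ} (hs : s.re ≤ K + 1) (hd : 0 < d) :
    ‖(d : ℂ) ^ (s - 1)‖ ≤ (d : ℝ) ^ K := by
  rw [norm_natCast_cpow_of_pos hd, ← Real.rpow_natCast]
  refine Real.rpow_le_rpow_of_exponent_le (by exact_mod_cast hd) ?_
  simp
  linarith

/-- A crude bound, but uniform on the half plane `Re s ≤ K + 1`. It provides the majorant that makes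
the Lambert series entire in `s`. -/
lemma norm_divisorSum_le {s : ℂ} {K : ℕ} (hs : s.re ≤ K + 1) (n : ℕ) :
    ‖divisorSum s n‖ ≤ (n : ℝ) ^ (K + 1) := by
  calc ‖divisorSum s n‖ ≤ ∑ d ∈ n.divisors, (n : ℝ) ^ K := by
        refine norm_sum_le_of_le _ fun d hd ↦ ?_
        refine (norm_natCast_cpow_sub_one_le hs (Nat.pos_of_mem_divisors hd)).trans ?_
        gcongr
        exact Nat.divisor_le hd
    _ ≤ (n : ℝ) ^ (K + 1) := by
        rw [Finset.sum_const, nsmul_eq_mul, pow_succ']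
        gcongr
        exact_mod_cast Nat.card_divisors_le_self n

lemma summable_divisorSum_bound (K : ℕ) {q : ℂ} (hq : ‖q‖ < 1) :
    Summable fun n : ℕ ↦ (n : ℝ) ^ (K + 1) * ‖q‖ ^ n :=
  summable_pow_mul_geometric_of_norm_lt_one (K + 1) (by simpa using hq)

lemma norm_divisorSum_mul_pow_le {s : ℂ} {K : ℕ} (hs : s.re ≤ K + 1) (q : ℂ) (n : ℕ) :
    ‖divisorSum s n * q ^ n‖ ≤ (n : ℝ) ^ (K + 1) * ‖q‖ ^ n := by
  rw [norm_mul, norm_pow]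
  gcongr
  exact norm_divisorSum_le hs n

lemma summable_divisorSum (s : ℂ) {q : ℂ} (hq : ‖q‖ < 1) :
    Summable fun n : ℕ ↦ divisorSum s n * q ^ n := by
  obtain ⟨K, hK⟩ := exists_nat_ge s.re
  exact Summable.of_norm_bounded (summable_divisorSum_bound K hq) fun n ↦
    norm_divisorSum_mul_pow_le (by linarith) q n

/-- The Lambert series `∑ (∑_{d ∣ n} d^(s-1)) q^n`. -/
def divisorSeries (s q : ℂ) : ℂ := ∑' n : ℕ, divisorSum s n * q ^ n

lemma differentiable_divisorSeries {q : ℂ} (hq : ‖q‖ < 1) :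
    Differentiable ℂ fun s ↦ divisorSeries s q := by
  intro s
  obtain ⟨K, hK⟩ := exists_nat_ge s.re
  have hopen : IsOpen {w : ℂ | w.re < K + 1} := isOpen_lt Complex.continuous_re continuous_const
  refine (differentiableOn_tsum_of_summable_norm (summable_divisorSum_bound K hq) (fun n ↦ ?_)
    hopen fun n w hw ↦ norm_divisorSum_mul_pow_le (le_of_lt hw) q n).differentiableAt
      (hopen.mem_nhds (by simp; linarith))
  refine DifferentiableOn.mul_const (DifferentiableOn.fun_sum fun d hd ↦ ?_) _
  have : (d : ℂ) ≠ 0 := by exact_mod_cast (Nat.pos_of_mem_divisors hd).ne'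
  exact fun w _ ↦ (DifferentiableAt.const_cpow (by fun_prop) (Or.inl this)).differentiableWithinAt

lemma summable_prod_cpow_mul_pow (s : ℂ) {q : ℂ} (hq : ‖q‖ < 1) :
    Summable fun c : ℕ+ × ℕ+ ↦ (c.2 : ℂ) ^ (s - 1) * q ^ (c.1 * c.2 : ℕ) := by
  obtain ⟨K, hK⟩ := exists_nat_ge s.re
  have h := (summable_prod_mul_pow (𝕜 := ℝ) K (r := ‖q‖) (by simpa using hq))
  refine Summable.of_norm_bounded h fun c ↦ ?_
  rw [norm_mul, norm_pow]
  gcongr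
  exact norm_natCast_cpow_sub_one_le (by linarith) c.2.pos

/-- The absolutely convergent double series is regrouped according to the product `n = dc`. -/
lemma tsum_prod_cpow_eq_divisorSeries (s : ℂ) {q : ℂ} (hq : ‖q‖ < 1) :
    ∑' d : ℕ+, ∑' c : ℕ+, (c : ℂ) ^ (s - 1) * q ^ (d * c : ℕ) = divisorSeries s q := by
  have hs := summable_prod_cpow_mul_pow s hq
  have hσ := (sigmaAntidiagonalEquivProd.summable_iff).mpr hs
  simp only [Function.comp_def] at hσ
  rw [← hs.tsum_prod (f := fun c : ℕ+ × ℕ+ ↦ (c.2 : ℂ) ^ (s - 1) * q ^ (c.1 * c.2 : ℕ)),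
    ← sigmaAntidiagonalEquivProd.tsum_eq, divisorSeries,
    ← tsum_zero_pnat_eq_tsum_nat (summable_divisorSum s hq),
    hσ.tsum_sigma]
  simp only [divisorSum, Nat.divisors_zero, Finset.sum_empty, zero_mul, zero_add]
  refine tsum_congr fun n ↦ ?_
  rw [tsum_fintype, Finset.sum_mul]
  change ∑ x : Nat.divisorsAntidiagonal n,
    (fun x : ℕ × ℕ ↦ (x.2 : ℂ) ^ (s - 1) * q ^ (x.1 * x.2)) x.1 = _
  rw [Finset.univ_eq_attach, (n : ℕ).divisorsAntidiagonal.sum_attach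
    (fun x : ℕ × ℕ ↦ (x.2 : ℂ) ^ (s - 1) * q ^ (x.1 * x.2)),
    Nat.sum_divisorsAntidiagonal' fun x y ↦ (y : ℂ) ^ (s - 1) * q ^ (x * y)]
  refine Finset.sum_congr rfl fun i hi ↦ ?_
  rw [Nat.div_mul_cancel (Nat.dvd_of_mem_divisors hi)]

end DivisorSeries

/-! ### Complex powers with `-π ≤ arg z < π` -/

section Powers

open Complex

lemma powP_eq_cpow {z : ℂ} (hz : z ≠ 0) (harg : z.arg ≠ Real.pi) (w : ℂ) : powP z w = z ^ w := by
  rw [powP, argP, if_neg harg, cpow_def_of_ne_zero hz, mul_comm, Complex.log]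

lemma powP_eq_cpow_of_im_pos {z : ℂ} (hz : 0 < z.im) (w : ℂ) : powP z w = z ^ w := by
  refine powP_eq_cpow (by rintro rfl; simp at hz) (fun h ↦ ?_) w
  exact hz.ne' (arg_eq_pi_iff.mp h).2

lemma argP_neg_of_im_pos {z : ℂ} (hz : 0 < z.im) : argP (-z) = argP z - Real.pi := by
  have h1 : z.arg ≠ Real.pi := fun h ↦ hz.ne' (arg_eq_pi_iff.mp h).2
  have h2 : (-z).arg ≠ Real.pi := fun h ↦ by
    have := (arg_eq_pi_iff.mp h).2
    simp at this
    exact hz.ne' this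
  rw [argP, argP, if_neg h1, if_neg h2, arg_neg_eq_arg_sub_pi_of_im_pos hz]

/-- Here the normalization matters: negative reals get the argument `-π`, so the pairs `±n` with `m
= 0` obey the same rule as the pairs `±(mτ + n)` with `m > 0`. -/
lemma argP_neg_ofReal {x : ℝ} (hx : 0 < x) : argP (-(x : ℂ)) = argP x - Real.pi := by
  have h1 : (x : ℂ).arg = 0 := arg_ofReal_of_nonneg hx.le
  have h2 : (-(x : ℂ)).arg = Real.pi := by
    rw [← ofReal_neg]; exact arg_ofReal_of_neg (by linarith)
  rw [argP, argP, if_pos h2, h1, if_neg Real.pi_pos.ne, zero_sub]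

lemma powP_neg {z : ℂ} (hz : argP (-z) = argP z - Real.pi) (s : ℂ) :
    powP (-z) (-s) = cexp (Real.pi * Complex.I * s) * powP z (-s) := by
  rw [powP, powP, hz, norm_neg, ← Complex.exp_add]
  congr 1
  push_cast
  ring

lemma abs_argP_le (z : ℂ) : |argP z| ≤ Real.pi := by
  rw [argP]
  split_ifs
  · rw [abs_neg, abs_of_pos Real.pi_pos]
  · exact abs_arg_le_pi z

lemma norm_powP_le {z : ℂ} (hz : z ≠ 0) (s : ℂ) :
    ‖powP z (-s)‖ ≤ Real.exp (Real.pi * |s.im|) * ‖z‖ ^ (-s.re) := by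
  have hz' : 0 < ‖z‖ := norm_pos_iff.mpr hz
  rw [powP, norm_exp, Real.rpow_def_of_pos hz', ← Real.exp_add]
  refine Real.exp_le_exp.mpr ?_
  have h1 : s.im * argP z ≤ Real.pi * |s.im| := by
    refine (le_abs_self _).trans ?_
    rw [abs_mul, mul_comm]
    gcongr
    exact abs_argP_le z
  have h2 : (-s * ((Real.log ‖z‖ : ℂ) + argP z * Complex.I)).re =
      -(s.re * Real.log ‖z‖) + s.im * argP z := by
    simp
    ring
  rw [h2]
  linarith

end Powers

/-! ### Fourier expansion and continuation of `G(s, τ)` -/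

section Continuation

open Complex

lemma summable_powP_linear (τ : ℍ) {s : ℂ} (hs : 2 < s.re) :
    Summable fun p : ℤ × ℤ ↦ if p = 0 then 0 else powP ((p.1 : ℂ) * τ + p.2) (-s) := by
  have h1 := (EisensteinSeries.summable_one_div_norm_rpow hs).mul_left
    (Real.exp (Real.pi * |s.im|) * EisensteinSeries.r τ ^ (-s.re))
  rw [← (finTwoArrowEquiv ℤ).summable_iff]
  refine Summable.of_norm_bounded h1 fun x ↦ ?_
  simp only [Function.comp_apply, finTwoArrowEquiv_apply]
  split_ifs with hx
  · rw [norm_zero]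
    have := (EisensteinSeries.r_pos τ).le
    positivity
  · have hne : (x 0 : ℂ) * τ + x 1 ≠ 0 := by
      have hx' : (fun i ↦ (x i : ℝ)) ≠ 0 := by
        intro h
        apply hx
        have h0 := congrFun h 0
        have h1 := congrFun h 1
        simp only [Pi.zero_apply, Int.cast_eq_zero] at h0 h1
        simp [h0, h1]
      have := UpperHalfPlane.linear_ne_zero τ hx'
      simpa using this
    refine (norm_powP_le hne s).trans ?_
    rw [mul_assoc]
    gcongr
    exact EisensteinSeries.summand_bound τ (by linarith) x

lemma tsum_int_of_neg {f : ℤ → ℂ} (hf : Summable f) {c : ℂ}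
    (h : ∀ n : ℕ+, f (-n) = c * f n) : ∑' n, f n = f 0 + (1 + c) * ∑' n : ℕ+, f n := by
  rw [tsum_int_eq_zero_add_tsum_pnat hf]
  simp only [h, tsum_mul_left]
  ring

/-- The factor `1 + exp(πis)` in the Fourier expansion of `G(s, τ)`. -/
def oneAddExp (s : ℂ) : ℂ := 1 + cexp (Real.pi * Complex.I * s)

lemma differentiable_oneAddExp : Differentiable ℂ oneAddExp := by
  unfold oneAddExp
  fun_prop

lemma oneAddExp_one : oneAddExp 1 = 0 := by
  simp [oneAddExp]

/-- The Fourier expansion of the Eisenstein series of complex weight. -/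
lemma tsum_powP_linear (τ : ℍ) {s : ℂ} (hs : 2 < s.re) :
    ∑' p : ℤ × ℤ, (if p = 0 then 0 else powP ((p.1 : ℂ) * τ + p.2) (-s)) =
      oneAddExp s * (riemannZeta s + (-(2 * Real.pi * Complex.I)) ^ s / Gamma s *
        divisorSeries s (cexp (2 * Real.pi * Complex.I * τ))) := by
  have hsum := summable_powP_linear τ hs
  set F : ℤ × ℤ → ℂ := fun p ↦ if p = 0 then 0 else powP ((p.1 : ℂ) * τ + p.2) (-s) with hF
  have hq : ‖cexp (2 * Real.pi * Complex.I * τ)‖ < 1 := norm_exp_two_pi_I_lt_one τ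
  have him (m : ℕ+) (n : ℤ) : 0 < ((m : ℂ) * τ + n).im := by
    have := τ.im_pos
    simpa using this
  have hFm (m : ℕ+) (n : ℤ) : F (m, n) = ((m : ℂ) * τ + n) ^ (-s) := by
    have : ((m : ℤ), n) ≠ 0 := by simp
    simp only [hF, if_neg this]
    rw [← powP_eq_cpow_of_im_pos (him m n)]
    push_cast
    rfl
  have hFneg (m : ℕ+) (n : ℤ) :
      F (-m, -n) = cexp (Real.pi * Complex.I * s) * F (m, n) := by
    have h1 : ((m : ℤ), n) ≠ 0 := by simp
    have h2 : (-(m : ℤ), -n) ≠ 0 := by simp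
    simp only [hF, if_neg h1, if_neg h2]
    rw [← powP_neg]
    · congr 1
      push_cast
      ring
    · exact argP_neg_of_im_pos (by simpa using him m n)
  have hF0neg (n : ℕ+) : F (0, -n) = cexp (Real.pi * Complex.I * s) * F (0, n) := by
    have h1 : ((0 : ℤ), (n : ℤ)) ≠ 0 := by simp
    have h2 : ((0 : ℤ), -(n : ℤ)) ≠ 0 := by simp
    simp only [hF, if_neg h1, if_neg h2]
    rw [← powP_neg]
    · congr 1
      push_cast
      ring
    · have := argP_neg_ofReal (x := (n : ℝ)) (by exact_mod_cast n.pos)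
      simpa using this
  have hF0 (n : ℕ+) : F (0, n) = 1 / ((n : ℕ) : ℂ) ^ s := by
    have h1 : ((0 : ℤ), (n : ℤ)) ≠ 0 := by simp
    simp only [hF, if_neg h1]
    rw [powP_eq_cpow, cpow_neg, one_div]
    · simp
    · simp
    · have : arg ((n : ℕ) : ℂ) = 0 := natCast_arg
      simp only [Int.cast_zero, zero_mul, zero_add, Int.cast_natCast, this]
      exact Real.pi_pos.ne
  have hrow0 : ∑' n : ℤ, F (0, n) = oneAddExp s * riemannZeta s := by
    have hs0 : Summable fun n : ℤ ↦ F (0, n) := hsum.prod_factor 0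
    have hs1 : 1 < s.re := by linarith
    rw [tsum_int_of_neg hs0 hF0neg, zeta_eq_tsum_one_div_nat_cpow hs1,
      ← tsum_zero_pnat_eq_tsum_nat (Complex.summable_one_div_nat_cpow.mpr hs1)]
    have hs' : s ≠ 0 := by rintro rfl; simp at hs1; linarith
    have h00 : F (0, 0) = 0 := by simp [hF]
    simp only [hF0, h00, oneAddExp, Nat.cast_zero, zero_cpow hs', div_zero, zero_add]
  have hrow (m : ℕ+) : ∑' n : ℤ, F (m, n) = (-(2 * Real.pi * Complex.I)) ^ s / Gamma s *
      ∑' l : ℕ+, (l : ℂ) ^ (s - 1) * cexp (2 * Real.pi * Complex.I * τ) ^ (m * l : ℕ) := by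
    have hs0 : Summable fun n : ℤ ↦ F (m, n) := hsum.prod_factor _
    simp only [hFm] at hs0 ⊢
    rw [tsum_add_cpow_neg (by linarith) (by simpa using him m 0) hs0]
    congr 1
    refine tsum_congr fun l ↦ ?_
    rw [pow_mul, ← Complex.exp_nat_mul _ (m : ℕ)]
    congr 3
    ring
  have hrowneg (m : ℕ+) : ∑' n : ℤ, F (-m, n) =
      cexp (Real.pi * Complex.I * s) * ∑' n : ℤ, F (m, n) := by
    rw [← (Equiv.neg ℤ).tsum_eq, ← tsum_mul_left]
    exact tsum_congr fun n ↦ hFneg m n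
  -- Summation by rows: `m = 0` yields the zeta value, each `m > 0` is a Lipschitz sum at `mτ`, and
  -- the row `-m` is `exp(πis)` times the row `m`.
  rw [hsum.tsum_prod, tsum_int_of_neg hsum.prod hrowneg, hrow0]
  simp only [hrow]
  rw [tsum_mul_left, tsum_prod_cpow_eq_divisorSeries s hq, oneAddExp]
  ring

/-- The explicit continuation of `G(s, τ)`. -/
def eisensteinContinuation (τ : ℍ) (s : ℂ) : ℂ :=
  dslope oneAddExp 1 s * riemannZeta₁ s +
    oneAddExp s * ((-(2 * Real.pi * Complex.I)) ^ s * (Gamma s)⁻¹ *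
      divisorSeries s (cexp (2 * Real.pi * Complex.I * τ)))

/-- `riemannZeta₁` is the entire function `(s - 1) ζ(s)`, and the `dslope` divides `1 + exp(πis)` by
`s - 1` across its zero at `s = 1`. The definition thus remains meaningful at the pole of `ζ`. -/
lemma eisensteinContinuation_of_ne_one (τ : ℍ) {s : ℂ} (hs : s ≠ 1) :
    eisensteinContinuation τ s =
      oneAddExp s * (riemannZeta s + (-(2 * Real.pi * Complex.I)) ^ s * (Gamma s)⁻¹ *
        divisorSeries s (cexp (2 * Real.pi * Complex.I * τ))) := by
  rw [eisensteinContinuation, dslope_of_ne _ hs, slope_def_field, oneAddExp_one,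
    riemannZeta_eq_inv_sub_mul hs]
  ring

lemma differentiable_eisensteinContinuation (τ : ℍ) :
    Differentiable ℂ (eisensteinContinuation τ) := by
  have hq : ‖cexp (2 * Real.pi * Complex.I * τ)‖ < 1 := norm_exp_two_pi_I_lt_one τ
  have hc : (-(2 * Real.pi * Complex.I) : ℂ) ≠ 0 := neg_ne_zero.mpr two_pi_I_ne_zero
  have h1 : Differentiable ℂ (dslope oneAddExp 1) := by
    rw [← differentiableOn_univ, Complex.differentiableOn_dslope Filter.univ_mem]
    exact differentiable_oneAddExp.differentiableOn
  have h2 : Differentiable ℂ fun s : ℂ ↦ (-(2 * Real.pi * Complex.I) : ℂ) ^ s := fun s ↦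
    DifferentiableAt.const_cpow (by fun_prop) (Or.inl hc)
  exact (h1.mul differentiable_riemannZeta₁).add (differentiable_oneAddExp.mul
    ((h2.mul differentiable_one_div_Gamma).mul (differentiable_divisorSeries hq)))

lemma isEisensteinContinuation_eisensteinContinuation (τ : ℍ) :
    IsEisensteinContinuation τ (eisensteinContinuation τ) := by
  refine ⟨differentiable_eisensteinContinuation τ, fun s hs ↦ ?_⟩
  have hs1 : s ≠ 1 := by rintro rfl; simp at hs
  have h1 := (summable_powP_linear τ hs).hasSum
  rw [tsum_powP_linear τ hs, div_eq_mul_inv, ← eisensteinContinuation_of_ne_one τ hs1] at h1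
  have hinj : Function.Injective (Subtype.val : {p : ℤ × ℤ // p ≠ 0} → ℤ × ℤ) :=
    Subtype.val_injective
  rw [← hinj.hasSum_iff] at h1
  · convert! h1 using 1
    funext p
    simp [p.2]
  · intro p hp
    rw [if_pos]
    by_contra h
    exact hp ⟨⟨p, h⟩, rfl⟩

lemma IsEisensteinContinuation.unique {τ : ℍ} {Φ Ψ : ℂ → ℂ} (hΦ : IsEisensteinContinuation τ Φ)
    (hΨ : IsEisensteinContinuation τ Ψ) : Φ = Ψ := by
  refine AnalyticOnNhd.eq_of_eventuallyEq (z₀ := 3)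
    (analyticOnNhd_univ_iff_differentiable.mpr hΦ.1)
    (analyticOnNhd_univ_iff_differentiable.mpr hΨ.1) ?_
  have : {s : ℂ | 2 < s.re} ∈ nhds (3 : ℂ) :=
    (isOpen_lt continuous_const Complex.continuous_re).mem_nhds (by norm_num)
  filter_upwards [this] with s hs
  exact (hΦ.2 s hs).unique (hΨ.2 s hs)

lemma existsUnique_eisensteinContinuation (τ : ℍ) :
    ∃! Φ : ℂ → ℂ, IsEisensteinContinuation τ Φ :=
  ⟨_, isEisensteinContinuation_eisensteinContinuation τ,
    fun _ h ↦ h.unique (isEisensteinContinuation_eisensteinContinuation τ)⟩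

lemma genEisenstein_eq (τ : ℍ) : genEisenstein τ = eisensteinContinuation τ := by
  have h : ∃ Φ, IsEisensteinContinuation τ Φ :=
    ⟨_, isEisensteinContinuation_eisensteinContinuation τ⟩
  rw [genEisenstein, dif_pos h]
  exact h.choose_spec.unique (isEisensteinContinuation_eisensteinContinuation τ)

end Continuation

/-! ### The derivative at `s = -2k` -/

section Derivative

open Complex

/-- Differentiate `ζ(1-s) = 2 (2π)^(-s) Γ(s) cos(πs/2) ζ(s)` at `s = 2k+1`. The cosine vanishes
there, so only the term containing its derivative survives. -/
lemma hasDerivAt_riemannZeta_neg_two_mul_nat {k : ℕ} (hk : 0 < k) :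
    HasDerivAt riemannZeta ((-1) ^ k * (2 * k).factorial / (2 * (2 * Real.pi) ^ (2 * k)) *
      riemannZeta (2 * k + 1)) (-(2 * k : ℂ)) := by
  set s₀ : ℂ := 2 * k + 1 with hs₀
  have hne1 : s₀ ≠ 1 := by
    rw [hs₀, ne_eq, add_eq_right]
    exact_mod_cast (by omega : 2 * k ≠ 0)
  have hpi : (2 * Real.pi : ℂ) ≠ 0 := by exact_mod_cast Real.two_pi_pos.ne'
  have hpole (n : ℕ) : s₀ ≠ -n := by
    intro h
    have : ((2 * k + 1 + n : ℕ) : ℂ) = 0 := by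
      push_cast
      rw [hs₀] at h
      rw [h]; ring
    exact absurd this (Nat.cast_ne_zero.mpr (by omega))
  have hcos : Complex.cos (Real.pi * s₀ / 2) = 0 := by
    rw [Complex.cos_eq_zero_iff]
    exact ⟨k, by rw [hs₀]; push_cast; ring⟩
  have hsin : Complex.sin (Real.pi * s₀ / 2) = (-1) ^ k := by
    have : (Real.pi * s₀ / 2 : ℂ) = Real.pi / 2 + k * Real.pi := by rw [hs₀]; ring
    rw [this, Complex.sin_antiperiodic.add_nat_mul_eq, Complex.sin_pi_div_two, mul_one]
  have hpow : DifferentiableAt ℂ (fun s : ℂ ↦ (2 * Real.pi : ℂ) ^ (-s)) s₀ :=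
    DifferentiableAt.const_cpow (by fun_prop) (Or.inl hpi)
  have hzeta : DifferentiableAt ℂ riemannZeta s₀ := differentiableAt_riemannZeta hne1
  have hgamma : DifferentiableAt ℂ Gamma s₀ := differentiableAt_Gamma s₀ hpole
  have hc : HasDerivAt (fun s : ℂ ↦ Complex.cos (Real.pi * s / 2))
      (-Complex.sin (Real.pi * s₀ / 2) * (Real.pi / 2)) s₀ := by
    have h1 : HasDerivAt (fun s : ℂ ↦ (Real.pi * s / 2 : ℂ)) (Real.pi / 2) s₀ := by
      simpa using ((hasDerivAt_id s₀).const_mul (Real.pi : ℂ)).div_const 2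
    exact h1.ccos
  have hprod := ((((hpow.const_mul 2).mul hgamma).hasDerivAt.mul hc).mul hzeta.hasDerivAt)
  have hfe : (fun s : ℂ ↦ riemannZeta (1 - s)) =ᶠ[nhds s₀]
      fun s ↦ 2 * (2 * Real.pi : ℂ) ^ (-s) * Gamma s * Complex.cos (Real.pi * s / 2) *
        riemannZeta s := by
    have hopen : {s : ℂ | 1 < s.re} ∈ nhds s₀ := by
      refine (isOpen_lt continuous_const Complex.continuous_re).mem_nhds ?_
      simp [hs₀, hk]
    filter_upwards [hopen] with s hs
    refine riemannZeta_one_sub (fun n h ↦ ?_) (by rintro rfl; simp at hs)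
    rw [h] at hs
    simp at hs
    have : (0 : ℝ) ≤ n := Nat.cast_nonneg n
    linarith
  have h1 := hprod.congr_of_eventuallyEq hfe
  have h2 : HasDerivAt (fun s : ℂ ↦ 1 - s) (-1) (-(2 * k : ℂ)) := by
    simpa using (hasDerivAt_id (-(2 * k : ℂ))).const_sub 1
  have h3 : (1 : ℂ) - (-(2 * k)) = s₀ := by rw [hs₀]; ring
  rw [← h3] at h1
  have h4 := h1.comp _ h2
  simp only [Function.comp_def, sub_sub_cancel] at h4
  refine h4.congr_deriv ?_
  rw [h3]
  simp only [Pi.mul_apply, hcos, hsin]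
  have hG : Gamma s₀ = (2 * k).factorial := by
    rw [hs₀]
    exact_mod_cast Complex.Gamma_nat_eq_factorial (2 * k)
  have hp : (2 * Real.pi : ℂ) ^ (-s₀) =
      ((2 * Real.pi : ℂ) ^ (2 * k) * (2 * Real.pi : ℂ))⁻¹ := by
    rw [cpow_neg, hs₀, cpow_add _ _ hpi, cpow_one]
    rw [show (2 * k : ℂ) = ((2 * k : ℕ) : ℂ) by push_cast; rfl, cpow_natCast]
  rw [hG, hp]
  have hpi' : (Real.pi : ℂ) ≠ 0 := by exact_mod_cast Real.pi_pos.ne'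
  field_simp
  ring

/-- Induction through `1/Γ(s) = s/Γ(s+1)`. At `0` the product rule leaves `1/Γ(1) = 1`; at `-(n+1)`
the value `1/Γ(-n) = 0` leaves `-(n+1)` times the previous derivative. -/
lemma hasDerivAt_one_div_Gamma_neg_nat (n : ℕ) :
    HasDerivAt (fun s : ℂ ↦ (Gamma s)⁻¹) ((-1) ^ n * n.factorial) (-(n : ℂ)) := by
  induction n with
  | zero =>
    have h1 : (fun s : ℂ ↦ (Gamma s)⁻¹) = fun s ↦ s * (Gamma (s + 1))⁻¹ := by
      funext s
      exact one_div_Gamma_eq_self_mul_one_div_Gamma_add_one s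
    rw [h1]
    have h2 : DifferentiableAt ℂ (fun s : ℂ ↦ (Gamma (s + 1))⁻¹) (-((0 : ℕ) : ℂ)) :=
      (differentiable_one_div_Gamma.comp (f := fun s : ℂ ↦ s + 1) (by fun_prop)) _
    have h3 := (hasDerivAt_id (-((0 : ℕ) : ℂ))).mul h2.hasDerivAt
    refine h3.congr_deriv ?_
    simp
  | succ n ih =>
    have h1 : (fun s : ℂ ↦ (Gamma s)⁻¹) = fun s ↦ s * (Gamma (s + 1))⁻¹ := by
      funext s
      exact one_div_Gamma_eq_self_mul_one_div_Gamma_add_one s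
    rw [h1]
    have hpt : -(((n + 1 : ℕ)) : ℂ) + 1 = -(n : ℂ) := by push_cast; ring
    rw [← hpt] at ih
    have h2 := (hasDerivAt_id (-((n + 1 : ℕ) : ℂ))).mul (ih.comp_add_const _ 1)
    refine h2.congr_deriv ?_
    have h0 : Gamma (-((n + 1 : ℕ) : ℂ) + 1) = 0 := by
      rw [hpt]; exact Complex.Gamma_neg_nat_eq_zero n
    rw [h0, Nat.factorial_succ]
    simp
    ring

lemma divisorSum_neg (k n : ℕ) : divisorSum (-(2 * k : ℂ)) n = sigma (-(2 * k : ℤ) - 1) n := by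
  rw [divisorSum, sigma]
  refine Finset.sum_congr rfl fun d _ ↦ ?_
  rw [← cpow_intCast]
  push_cast
  rfl

/-- The Fourier expansion of the differential Eisenstein series. -/
lemma diffEisenstein_eq {k : ℕ} (hk : 0 < k) (τ : ℍ) :
    diffEisenstein (-(2 * k : ℤ)) τ = constC k / 2 * riemannZeta (2 * k + 1) +
      constC k * ∑' n : ℕ, sigma (-(2 * k : ℤ) - 1) n *
        cexp (2 * Real.pi * Complex.I * τ) ^ n := by
  have hq : ‖cexp (2 * Real.pi * Complex.I * τ)‖ < 1 := norm_exp_two_pi_I_lt_one τ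
  have hc : (-(2 * Real.pi * Complex.I) : ℂ) ≠ 0 := neg_ne_zero.mpr two_pi_I_ne_zero
  have hpi : (Real.pi : ℂ) ≠ 0 := by exact_mod_cast Real.pi_pos.ne'
  set s₀ : ℂ := -(2 * k : ℂ) with hs₀
  have hne : s₀ ≠ 1 := by
    intro h
    have : ((2 * k + 1 : ℕ) : ℂ) = 0 := by push_cast; rw [hs₀] at h; linear_combination -h
    exact absurd this (Nat.cast_ne_zero.mpr (by omega))
  have hcast : ((-(2 * k : ℤ) : ℤ) : ℂ) = s₀ := by push_cast; rfl
  rw [diffEisenstein, genEisenstein_eq, hcast]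
  have heq : eisensteinContinuation τ =ᶠ[nhds s₀] fun s ↦
      oneAddExp s * (riemannZeta s + (-(2 * Real.pi * Complex.I)) ^ s * (Gamma s)⁻¹ *
        divisorSeries s (cexp (2 * Real.pi * Complex.I * τ))) := by
    filter_upwards [isOpen_ne.mem_nhds hne] with s hs
    exact eisensteinContinuation_of_ne_one τ hs
  have hG := hasDerivAt_one_div_Gamma_neg_nat (2 * k)
  have hs₀' : -((2 * k : ℕ) : ℂ) = s₀ := by push_cast; rfl
  rw [hs₀'] at hG
  have hpow : DifferentiableAt ℂ (fun s : ℂ ↦ (-(2 * Real.pi * Complex.I) : ℂ) ^ s) s₀ :=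
    DifferentiableAt.const_cpow (by fun_prop) (Or.inl hc)
  have h1 := ((hpow.hasDerivAt.mul hG).mul (differentiable_divisorSeries hq s₀).hasDerivAt)
  have h2 := (differentiable_oneAddExp s₀).hasDerivAt.mul
    ((hasDerivAt_riemannZeta_neg_two_mul_nat hk).add h1)
  have h3 := (h2.congr_of_eventuallyEq heq).deriv
  rw [h3]
  -- The conventional values `Γ(-2k) = 0` and `0⁻¹ = 0` agree with the zero of the entire function
  -- `1/Γ`. As `ζ(-2k) = 0` too, every product rule term without `ζ'` or `(1/Γ)'` drops out.
  have hG0 : Gamma s₀ = 0 := by rw [← hs₀']; exact Complex.Gamma_neg_nat_eq_zero _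
  have hz0 : riemannZeta s₀ = 0 := by
    obtain ⟨j, rfl⟩ := Nat.exists_eq_add_of_lt hk
    have := riemannZeta_neg_two_mul_nat_add_one j
    rw [hs₀]
    convert this using 2
    push_cast
    ring
  have hE : oneAddExp s₀ = 2 := by
    have : cexp (Real.pi * Complex.I * s₀) = 1 := by
      rw [Complex.exp_eq_one_iff]
      exact ⟨-k, by rw [hs₀]; push_cast; ring⟩
    rw [oneAddExp, this]; norm_num
  have hP : (-(2 * Real.pi * Complex.I) : ℂ) ^ s₀ = (-1) ^ k / (2 * Real.pi) ^ (2 * k) := by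
    rw [← hcast, cpow_intCast, zpow_neg]
    have : (-(2 * Real.pi * Complex.I) : ℂ) ^ (2 * (k : ℤ)) = (-1) ^ k * (2 * Real.pi) ^ (2 * k) := by
      have h : (2 * (k : ℤ)) = ((2 * k : ℕ) : ℤ) := by push_cast; rfl
      rw [h, zpow_natCast, pow_mul, pow_mul, ← mul_pow]
      congr 1
      ring_nf
      rw [Complex.I_sq]
      ring
    rw [this, mul_inv, div_eq_mul_inv, ← inv_pow]
    norm_num
  have hL : divisorSeries s₀ (cexp (2 * Real.pi * Complex.I * τ)) =
      ∑' n : ℕ, sigma (-(2 * k : ℤ) - 1) n * cexp (2 * Real.pi * Complex.I * τ) ^ n :=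
    tsum_congr fun n ↦ by rw [hs₀, divisorSum_neg]
  simp only [Pi.add_apply, Pi.mul_apply, hG0, hz0, hE, hP, hL, inv_zero, constC]
  rw [pow_mul (-1 : ℂ) 2 k]
  norm_num
  field_simp

end Derivative

/-! ### Bol's identity -/

section Bol

lemma isOpen_im_pos : IsOpen {z : ℂ | 0 < z.im} :=
  isOpen_lt continuous_const Complex.continuous_im

lemma isPreconnected_im_pos : IsPreconnected {z : ℂ | 0 < z.im} :=
  (convex_halfSpace_im_gt 0).isPreconnected

lemma eventuallyEq_of_forall_im_pos {f g : ℂ → ℂ} (h : ∀ z : ℂ, 0 < z.im → f z = g z) {z : ℂ}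
    (hz : 0 < z.im) : f =ᶠ[nhds z] g := by
  filter_upwards [isOpen_im_pos.mem_nhds hz] with w hw
  exact h w hw

/-- `F 0, F 1, F 2, …` are the successive derivatives of `F 0` on the upper half plane. -/
def IsDerivChain (F : ℕ → ℂ → ℂ) : Prop :=
  ∀ j (z : ℂ), 0 < z.im → HasDerivAt (F j) (F (j + 1) z) z

lemma IsDerivChain.iteratedDeriv_eq {F : ℕ → ℂ → ℂ} (hF : IsDerivChain F) (j : ℕ) {z : ℂ}
    (hz : 0 < z.im) : iteratedDeriv j (F 0) z = F j z := by
  induction j generalizing z with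
  | zero => simp
  | succ j ih =>
    rw [iteratedDeriv_succ, ← (hF j z hz).deriv]
    exact (eventuallyEq_of_forall_im_pos (fun w hw ↦ ih hw) hz).deriv_eq

lemma isDerivChain_iteratedDeriv {f : ℂ → ℂ} (hf : DifferentiableOn ℂ f {z | 0 < z.im}) :
    IsDerivChain fun j ↦ iteratedDeriv j f := by
  have h (j : ℕ) : DifferentiableOn ℂ (iteratedDeriv j f) {z | 0 < z.im} := by
    induction j with
    | zero => simpa using hf
    | succ j ih => rw [iteratedDeriv_succ]; exact ih.deriv isOpen_im_pos
  intro j z hz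
  change HasDerivAt (iteratedDeriv j f) (iteratedDeriv (j + 1) f z) z
  rw [iteratedDeriv_succ]
  exact ((h j).differentiableAt (isOpen_im_pos.mem_nhds hz)).hasDerivAt

lemma IsDerivChain.add {F G : ℕ → ℂ → ℂ} (hF : IsDerivChain F) (hG : IsDerivChain G) :
    IsDerivChain fun j ↦ F j + G j :=
  fun j z hz ↦ (hF j z hz).add (hG j z hz)

lemma IsDerivChain.sub {F G : ℕ → ℂ → ℂ} (hF : IsDerivChain F) (hG : IsDerivChain G) :
    IsDerivChain fun j ↦ F j - G j :=
  fun j z hz ↦ (hF j z hz).sub (hG j z hz)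

lemma isDerivChain_monomial (c : ℂ) (m : ℕ) :
    IsDerivChain fun j z ↦ c * (m.descFactorial j * z ^ (m - j)) := by
  intro j z _
  refine (((hasDerivAt_pow (m - j) z).const_mul (m.descFactorial j : ℂ)).const_mul c).congr_deriv ?_
  beta_reduce
  rw [Nat.descFactorial_succ, Nat.sub_sub]
  push_cast
  ring

lemma iteratedDeriv_linear_mul {g : ℂ → ℂ} (hg : DifferentiableOn ℂ g {z | 0 < z.im}) (c d : ℂ)
    (j : ℕ) {z : ℂ} (hz : 0 < z.im) :
    iteratedDeriv (j + 1) (fun w ↦ (c * w + d) * g w) z =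
      (c * z + d) * iteratedDeriv (j + 1) g z + (j + 1) * c * iteratedDeriv j g z := by
  have hch := isDerivChain_iteratedDeriv hg
  have hlin (z : ℂ) : HasDerivAt (fun w ↦ c * w + d) c z := by
    simpa using ((hasDerivAt_id z).const_mul c).add_const d
  induction j generalizing z with
  | zero =>
    rw [zero_add, iteratedDeriv_one]
    have := (hlin z).mul (hch 0 z hz)
    simp only [iteratedDeriv_zero] at this
    refine this.deriv.trans ?_
    simp
    ring
  | succ j ih =>
    rw [iteratedDeriv_succ, (eventuallyEq_of_forall_im_pos (fun w hw ↦ ih hw) hz).deriv_eq]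
    have := ((hlin z).mul (hch (j + 1) z hz)).add
      ((hch j z hz).const_mul (((j : ℂ) + 1) * c))
    refine this.deriv.trans ?_
    push_cast
    ring

/-- **Bol's identity**. -/
lemma iteratedDeriv_bol {f : ℂ → ℂ} (hf : DifferentiableOn ℂ f {z | 0 < z.im}) {a b c d : ℂ}
    (hdet : a * d - b * c = 1) (hne : ∀ z : ℂ, 0 < z.im → c * z + d ≠ 0)
    (hM : ∀ z : ℂ, 0 < z.im → 0 < ((a * z + b) / (c * z + d)).im) (n : ℕ) {z : ℂ}
    (hz : 0 < z.im) :
    iteratedDeriv (n + 1) (fun w ↦ (c * w + d) ^ n * f ((a * w + b) / (c * w + d))) z =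
      ((c * z + d) ^ (n + 2))⁻¹ * iteratedDeriv (n + 1) f ((a * z + b) / (c * z + d)) := by
  have hch := isDerivChain_iteratedDeriv hf
  have hmob (z : ℂ) (hz : 0 < z.im) :
      HasDerivAt (fun w ↦ (a * w + b) / (c * w + d)) (((c * z + d) ^ 2)⁻¹) z := by
    have h1 : HasDerivAt (fun w ↦ a * w + b) a z := by
      simpa using ((hasDerivAt_id z).const_mul a).add_const b
    have h2 : HasDerivAt (fun w ↦ c * w + d) c z := by
      simpa using ((hasDerivAt_id z).const_mul c).add_const d
    refine (h1.div h2 (hne z hz)).congr_deriv ?_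
    have := hne z hz
    field_simp
    linear_combination hdet
  have hcomp (j : ℕ) (z : ℂ) (hz : 0 < z.im) :
      HasDerivAt (fun w ↦ iteratedDeriv j f ((a * w + b) / (c * w + d)))
        (iteratedDeriv (j + 1) f ((a * z + b) / (c * z + d)) * ((c * z + d) ^ 2)⁻¹) z :=
    HasDerivAt.comp (h₂ := iteratedDeriv j f) z (hch j _ (hM z hz)) (hmob z hz)
  have hdiff (n : ℕ) : DifferentiableOn ℂ
      (fun w ↦ (c * w + d) ^ n * f ((a * w + b) / (c * w + d))) {z | 0 < z.im} := by
    intro z hz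
    have := hcomp 0 z hz
    simp only [iteratedDeriv_zero] at this
    exact ((by fun_prop : DifferentiableAt ℂ (fun w ↦ (c * w + d) ^ n) z).mul
      this.differentiableAt).differentiableWithinAt
  induction n generalizing z with
  | zero =>
    have := hcomp 0 z hz
    simp only [iteratedDeriv_zero] at this
    simp only [pow_zero, one_mul, zero_add, iteratedDeriv_one]
    rw [this.deriv, zero_add, iteratedDeriv_one, mul_comm]
  | succ n ih =>
    have hne' := hne z hz
    have heq : (fun w ↦ (c * w + d) ^ (n + 1) * f ((a * w + b) / (c * w + d))) =
        fun w ↦ (c * w + d) * ((c * w + d) ^ n * f ((a * w + b) / (c * w + d))) := by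
      funext w; ring
    -- One linear factor is split off. Its Leibniz term `(n+2) c` times the induction hypothesis
    -- cancels the term that arises from differentiating `(cz+d)^(-n-2)`.
    rw [heq, iteratedDeriv_linear_mul (hdiff n) c d (n + 1) hz, ih hz, iteratedDeriv_succ,
      (eventuallyEq_of_forall_im_pos (fun w hw ↦ ih hw) hz).deriv_eq]
    have h2 : HasDerivAt (fun w ↦ c * w + d) c z := by
      simpa using ((hasDerivAt_id z).const_mul c).add_const d
    have h3 := (((h2.pow (n + 2)).inv (pow_ne_zero _ hne')).mul (hcomp (n + 1) z hz)).deriv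
    rw [show (fun w ↦ ((c * w + d) ^ (n + 2))⁻¹ *
      iteratedDeriv (n + 1) f ((a * w + b) / (c * w + d))) = ((fun w ↦ c * w + d) ^ (n + 2))⁻¹ *
      fun w ↦ iteratedDeriv (n + 1) f ((a * w + b) / (c * w + d)) from rfl, h3]
    simp only [Pi.inv_apply, Pi.pow_apply]
    push_cast
    field_simp
    ring

lemma exists_polynomial_derivative_eq (P : Polynomial ℂ) :
    ∃ Q : Polynomial ℂ, Q.derivative = P := by
  induction P using Polynomial.induction_on' with
  | add p q hp hq =>
    obtain ⟨p', rfl⟩ := hp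
    obtain ⟨q', rfl⟩ := hq
    exact ⟨p' + q', Polynomial.derivative_add⟩
  | monomial n a =>
    refine ⟨Polynomial.monomial (n + 1) (a / (n + 1)), ?_⟩
    rw [Polynomial.derivative_monomial, Nat.add_sub_cancel]
    congr 1
    have : (n : ℂ) + 1 ≠ 0 := by exact_mod_cast n.succ_ne_zero
    push_cast
    field_simp

/-- By induction `h'` is a polynomial on `ℍ`. Subtracting a polynomial primitive leaves a function
with zero derivative, constant by connectedness. -/
lemma exists_polynomial_of_iteratedDeriv_eq_zero (N : ℕ) {h : ℂ → ℂ}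
    (hd : DifferentiableOn ℂ h {z | 0 < z.im})
    (h0 : ∀ z : ℂ, 0 < z.im → iteratedDeriv N h z = 0) :
    ∃ P : Polynomial ℂ, ∀ z : ℂ, 0 < z.im → h z = P.eval z := by
  induction N generalizing h with
  | zero => exact ⟨0, fun z hz ↦ by simpa using h0 z hz⟩
  | succ N ih =>
    obtain ⟨P, hP⟩ := ih (hd.deriv isOpen_im_pos) (fun z hz ↦ by
      rw [← iteratedDeriv_succ']; exact h0 z hz)
    obtain ⟨Q, rfl⟩ := exists_polynomial_derivative_eq P
    obtain ⟨c, hc⟩ := isOpen_im_pos.exists_is_const_of_deriv_eq_zero isPreconnected_im_pos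
      (f := fun z ↦ h z - Q.eval z) (hd.sub Q.differentiable.differentiableOn) (fun z hz ↦ by
        refine ((hd.differentiableAt (isOpen_im_pos.mem_nhds hz)).hasDerivAt.sub
          (Q.hasDerivAt z)).deriv.trans ?_
        rw [hP z hz, sub_self, Pi.zero_apply])
    refine ⟨Q + Polynomial.C c, fun z hz ↦ ?_⟩
    rw [Polynomial.eval_add, Polynomial.eval_C, ← hc z hz]
    ring

end Bol

/-! ### Termwise differentiation of `q`-series -/

section QSeries

open Complex

/-- `∑ c(n) exp(2πinz)` -/
def qSeries (c : ℕ → ℂ) (z : ℂ) : ℂ := ∑' n : ℕ, c n * cexp (2 * Real.pi * Complex.I * n * z)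

lemma norm_cexp_two_pi_I_nat_le {ε : ℝ} (n : ℕ) {z : ℂ} (hz : ε ≤ z.im) :
    ‖cexp (2 * Real.pi * Complex.I * n * z)‖ ≤ Real.exp (-(2 * Real.pi * ε)) ^ n := by
  rw [norm_exp, ← Real.exp_nat_mul]
  refine Real.exp_le_exp.mpr ?_
  have : (2 * Real.pi * Complex.I * n * z).re = -(n * (2 * Real.pi * z.im)) := by
    simp
    ring
  rw [this, mul_neg, neg_le_neg_iff]
  have := Real.pi_pos
  gcongr

lemma summable_qSeries_bound (C : ℝ) (K : ℕ) {ε : ℝ} (hε : 0 < ε) :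
    Summable fun n : ℕ ↦ C * (n : ℝ) ^ K * Real.exp (-(2 * Real.pi * ε)) ^ n := by
  have h : ‖Real.exp (-(2 * Real.pi * ε))‖ < 1 := by
    rw [Real.norm_eq_abs, Real.abs_exp, Real.exp_lt_one_iff]
    have := Real.pi_pos
    simp only [Left.neg_neg_iff]
    positivity
  simpa [mul_assoc] using (summable_pow_mul_geometric_of_norm_lt_one K h).mul_left C

lemma norm_qSeries_term_le {c : ℕ → ℂ} {C : ℝ} {K : ℕ} (hc : ∀ n, ‖c n‖ ≤ C * (n : ℝ) ^ K)
    {ε : ℝ} (n : ℕ) {z : ℂ} (hz : ε ≤ z.im) :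
    ‖c n * cexp (2 * Real.pi * Complex.I * n * z)‖ ≤
      C * (n : ℝ) ^ K * Real.exp (-(2 * Real.pi * ε)) ^ n := by
  rw [norm_mul]
  exact mul_le_mul (hc n) (norm_cexp_two_pi_I_nat_le n hz) (norm_nonneg _)
    ((norm_nonneg _).trans (hc n))

lemma summable_qSeries {c : ℕ → ℂ} {C : ℝ} {K : ℕ} (hc : ∀ n, ‖c n‖ ≤ C * (n : ℝ) ^ K)
    {z : ℂ} (hz : 0 < z.im) :
    Summable fun n : ℕ ↦ c n * cexp (2 * Real.pi * Complex.I * n * z) :=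
  Summable.of_norm_bounded (summable_qSeries_bound C K hz) fun n ↦ norm_qSeries_term_le hc n le_rfl

lemma hasDerivAt_qSeries {c : ℕ → ℂ} {C : ℝ} {K : ℕ} (hc : ∀ n, ‖c n‖ ≤ C * (n : ℝ) ^ K)
    {z : ℂ} (hz : 0 < z.im) :
    HasDerivAt (qSeries c) (qSeries (fun n ↦ (2 * Real.pi * Complex.I * n) * c n) z) z := by
  have hopen : IsOpen {w : ℂ | z.im / 2 < w.im} :=
    isOpen_lt continuous_const Complex.continuous_im
  have hzmem : z ∈ {w : ℂ | z.im / 2 < w.im} := by simp [hz]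
  have hterm (n : ℕ) (w : ℂ) : HasDerivAt (fun w ↦ c n * cexp (2 * Real.pi * Complex.I * n * w))
      ((2 * Real.pi * Complex.I * n) * c n * cexp (2 * Real.pi * Complex.I * n * w)) w := by
    have h1 : HasDerivAt (fun w : ℂ ↦ 2 * Real.pi * Complex.I * n * w)
        (2 * Real.pi * Complex.I * n) w := by
      simpa using (hasDerivAt_id w).const_mul (2 * Real.pi * Complex.I * n : ℂ)
    refine (h1.cexp.const_mul (c n)).congr_deriv ?_
    ring
  have hdiff (n : ℕ) : DifferentiableOn ℂ (fun w ↦ c n * cexp (2 * Real.pi * Complex.I * n * w))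
      {w : ℂ | z.im / 2 < w.im} := fun w _ ↦ (hterm n w).differentiableAt.differentiableWithinAt
  have hle (n : ℕ) (w : ℂ) (hw : w ∈ {w : ℂ | z.im / 2 < w.im}) :=
    norm_qSeries_term_le hc n (le_of_lt hw)
  have hsum := summable_qSeries_bound C K (half_pos hz)
  have h1 := differentiableOn_tsum_of_summable_norm hsum hdiff hopen hle
  have h2 := hasSum_deriv_of_summable_norm hsum hdiff hopen hle hzmem
  have h3 := (h1.differentiableAt (hopen.mem_nhds hzmem)).hasDerivAt
  rw [← h2.tsum_eq] at h3
  refine h3.congr_deriv ?_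
  exact tsum_congr fun n ↦ (hterm n z).deriv

lemma isDerivChain_qSeries {c : ℕ → ℂ} {C : ℝ} {K : ℕ} (hc : ∀ n, ‖c n‖ ≤ C * (n : ℝ) ^ K) :
    IsDerivChain fun j ↦ qSeries fun n ↦ (2 * Real.pi * Complex.I * n) ^ j * c n := by
  intro j z hz
  -- Each differentiation raises the polynomial growth of the coefficients by one degree, so the
  -- convergence argument applies at every stage.
  have hc' (n : ℕ) : ‖(2 * Real.pi * Complex.I * n) ^ j * c n‖ ≤
      ((2 * Real.pi) ^ j * C) * (n : ℝ) ^ (K + j) := by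
    rw [norm_mul, norm_pow]
    have : ‖(2 * Real.pi * Complex.I * n : ℂ)‖ = 2 * Real.pi * n := by
      simp [abs_of_pos Real.pi_pos]
    rw [this, mul_pow]
    calc (2 * Real.pi) ^ j * (n : ℝ) ^ j * ‖c n‖
        ≤ (2 * Real.pi) ^ j * (n : ℝ) ^ j * (C * (n : ℝ) ^ K) := by
          have := Real.pi_pos
          gcongr
          exact hc n
      _ = _ := by ring
  refine (hasDerivAt_qSeries hc' hz).congr_deriv ?_
  congr 1
  funext n
  ring

lemma norm_sigma_neg_le (k n : ℕ) : ‖sigma (-(2 * k : ℤ) - 1) n‖ ≤ 1 * (n : ℝ) ^ 1 := by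
  have := norm_divisorSum_le (s := -(2 * k : ℂ)) (K := 0) (by
    simp
    have : (0 : ℝ) ≤ k := Nat.cast_nonneg k
    linarith) n
  rw [divisorSum_neg] at this
  simpa using this

end QSeries

/-! ### Stability of the rational functions -/

section RatFunctions

lemma polynomial_mem_ratFunctions (p : Polynomial ℂ) :
    (fun τ : ℍ ↦ p.eval (τ : ℂ)) ∈ ratFunctions :=
  ⟨p, 1, fun τ ↦ by simp⟩

lemma mul_mem_ratFunctions {f g : ℍ → ℂ} (hf : f ∈ ratFunctions) (hg : g ∈ ratFunctions) :
    f * g ∈ ratFunctions := by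
  obtain ⟨p, q, h⟩ := hf
  obtain ⟨p', q', h'⟩ := hg
  refine ⟨p * p', q * q', fun τ ↦ ⟨?_, ?_⟩⟩
  · simpa using ⟨(h τ).1, (h' τ).1⟩
  · simp [(h τ).2, (h' τ).2, div_mul_div_comm]

lemma inv_mem_ratFunctions {f : ℍ → ℂ} (hf : f ∈ ratFunctions) (h0 : ∀ τ, f τ ≠ 0) :
    f⁻¹ ∈ ratFunctions := by
  obtain ⟨p, q, h⟩ := hf
  refine ⟨q, p, fun τ ↦ ⟨fun hp ↦ h0 τ ?_, ?_⟩⟩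
  · rw [(h τ).2, hp, zero_div]
  · rw [Pi.inv_apply, (h τ).2, inv_div]

lemma pow_mem_ratFunctions {f : ℍ → ℂ} (hf : f ∈ ratFunctions) (n : ℕ) : f ^ n ∈ ratFunctions := by
  induction n with
  | zero => exact ⟨1, 1, fun τ ↦ by simp⟩
  | succ n ih => rw [pow_succ]; exact mul_mem_ratFunctions ih hf

lemma zpow_mem_ratFunctions {f : ℍ → ℂ} (hf : f ∈ ratFunctions) (h0 : ∀ τ, f τ ≠ 0) (n : ℤ) :
    f ^ n ∈ ratFunctions := by
  obtain ⟨n, rfl | rfl⟩ := n.eq_nat_or_neg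
  · simpa using pow_mem_ratFunctions hf n
  · rw [zpow_neg, zpow_natCast]
    exact inv_mem_ratFunctions (pow_mem_ratFunctions hf n) fun τ ↦ pow_ne_zero _ (h0 τ)

lemma eval_comp_mem_ratFunctions (p : Polynomial ℂ) {f : ℍ → ℂ} (hf : f ∈ ratFunctions) :
    (fun τ ↦ p.eval (f τ)) ∈ ratFunctions := by
  induction p using Polynomial.induction_on' with
  | add p q hp hq => simpa using! ratFunctions.add_mem hp hq
  | monomial n a => simpa using! ratFunctions.smul_mem a (pow_mem_ratFunctions hf n)

lemma linear_mem_ratFunctions (a b : ℂ) : (fun τ : ℍ ↦ a * (τ : ℂ) + b) ∈ ratFunctions := by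
  convert polynomial_mem_ratFunctions (Polynomial.C a * Polynomial.X + Polynomial.C b) using 2
  simp

lemma coe_moebius_mem_ratFunctions {A : Matrix (Fin 2) (Fin 2) ℤ} (hA : 0 < A.det) :
    (fun τ : ℍ ↦ (moebius A τ : ℂ)) ∈ ratFunctions := by
  have := mul_mem_ratFunctions (linear_mem_ratFunctions (A 0 0) (A 0 1))
    (inv_mem_ratFunctions (linear_mem_ratFunctions (A 1 0) (A 1 1))
      (denom_ne_zero_of_det_pos hA))
  convert this using 1
  funext τ
  rw [coe_moebius hA, div_eq_mul_inv]
  rfl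

lemma isHeckeStable_ratFunctions (m : ℤ) : IsHeckeStable m ratFunctions := by
  intro A hA f hf
  obtain ⟨p, q, h⟩ := hf
  have h1 := coe_moebius_mem_ratFunctions hA
  have h2 : (fun τ ↦ f (moebius A τ)) ∈ ratFunctions := by
    have := mul_mem_ratFunctions (eval_comp_mem_ratFunctions p h1)
      (inv_mem_ratFunctions (eval_comp_mem_ratFunctions q h1) fun τ ↦ (h _).1)
    convert this using 1
    funext τ
    rw [(h _).2, div_eq_mul_inv]
    rfl
  have h3 := zpow_mem_ratFunctions (linear_mem_ratFunctions (A 1 0) (A 1 1))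
    (denom_ne_zero_of_det_pos hA) (-m)
  have := ratFunctions.smul_mem (((A.det : ℝ) ^ ((m : ℝ) / 2) : ℝ) : ℂ)
    (mul_mem_ratFunctions h3 h2)
  convert this using 1
  funext τ
  rw [slash_apply, mul_assoc]
  rfl

end RatFunctions

/-! ### Polynomial periods -/

section Period

/-- By Bol's identity the `(n+1)`-st derivative of the period is the defect of `F (n+1)` in weight
`n + 2`, which `htrans` makes zero. -/
lemma exists_polynomial_period {F : ℕ → ℂ → ℂ} (hF : IsDerivChain F) (n : ℕ) {a b c d : ℂ}
    (hdet : a * d - b * c = 1) (hne : ∀ z : ℂ, 0 < z.im → c * z + d ≠ 0)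
    (hM : ∀ z : ℂ, 0 < z.im → 0 < ((a * z + b) / (c * z + d)).im)
    (htrans : ∀ z : ℂ, 0 < z.im →
      F (n + 1) ((a * z + b) / (c * z + d)) = (c * z + d) ^ (n + 2) * F (n + 1) z) :
    ∃ P : Polynomial ℂ, ∀ z : ℂ, 0 < z.im →
      (c * z + d) ^ n * F 0 ((a * z + b) / (c * z + d)) - F 0 z = P.eval z := by
  have hd : DifferentiableOn ℂ (F 0) {z | 0 < z.im} := fun z hz ↦
    (hF 0 z hz).differentiableAt.differentiableWithinAt
  have hd' : DifferentiableOn ℂ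
      (fun w ↦ (c * w + d) ^ n * F 0 ((a * w + b) / (c * w + d))) {z | 0 < z.im} := by
    refine DifferentiableOn.mul (by fun_prop) (hd.comp (DifferentiableOn.div (by fun_prop)
      (by fun_prop) fun z hz ↦ hne z hz) fun z hz ↦ hM z hz)
  refine exists_polynomial_of_iteratedDeriv_eq_zero (n + 1) (hd'.sub hd) fun z hz ↦ ?_
  have := ((isDerivChain_iteratedDeriv hd').sub (isDerivChain_iteratedDeriv hd)).iteratedDeriv_eq
    (n + 1) hz
  simp only [iteratedDeriv_zero] at this
  refine this.trans ?_
  rw [Pi.sub_apply, iteratedDeriv_bol hd hdet hne hM n hz, hF.iteratedDeriv_eq _ hz,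
    hF.iteratedDeriv_eq _ (hM z hz), htrans z hz,
    inv_mul_cancel_left₀ (pow_ne_zero _ (hne z hz)), sub_self]

end Period

/-! ### The Eisenstein series of weight `2k + 2` -/

section Eisenstein

open ArithmeticFunction in
lemma pow_mul_sigma_neg (N : ℕ) (n : ℕ) :
    (n : ℂ) ^ N * sigma (-(N : ℤ)) n = (ArithmeticFunction.sigma N n : ℂ) := by
  rw [sigma, ArithmeticFunction.sigma_apply, Finset.mul_sum, ← Nat.sum_div_divisors]
  push_cast
  refine Finset.sum_congr rfl fun d hd ↦ ?_
  have hn : n ≠ 0 := (Nat.mem_divisors.mp hd).2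
  have hd0 : d ≠ 0 := fun h ↦ hn (by simpa [h] using (Nat.mem_divisors.mp hd).1)
  have hd' : (d : ℂ) ≠ 0 := by exact_mod_cast hd0
  have hn' : (n : ℂ) ≠ 0 := by exact_mod_cast hn
  rw [Nat.cast_div (Nat.mem_divisors.mp hd).1 hd', zpow_neg, zpow_natCast, div_pow]
  field_simp

lemma sigma_zero (m : ℤ) : sigma m 0 = 0 := by simp [sigma]

/-- Because `n^(2k+1) σ_{-2k-1}(n) = σ_{2k+1}(n)`, the series is the `(2k+1)`-st derivative of `∑
σ_{-2k-1}(n) q^n` up to a power of `2πi`. Only `A ≠ 0` is needed later, not its value. -/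
lemma exists_eisenstein_eq {k : ℕ} (hk : 0 < k) : ∃ A : ℂ, A ≠ 0 ∧
    ∃ E : ModularForm 𝒮ℒ ((2 * k + 2 : ℕ) : ℤ), ∀ τ : ℍ,
      E τ = 1 + A * qSeries (fun n ↦ (n : ℂ) ^ (2 * k + 1) * sigma (-(2 * k : ℤ) - 1) n) τ := by
  have hk3 : 3 ≤ 2 * k + 2 := by omega
  refine ⟨(riemannZeta (2 * k + 2 : ℕ))⁻¹ * (-2 * Real.pi * Complex.I) ^ (2 * k + 2) /
    (2 * k + 2 - 1).factorial, ?_, ModularForm.E hk3, fun τ ↦ ?_⟩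
  · have h1 : riemannZeta (2 * k + 2 : ℕ) ≠ 0 :=
      riemannZeta_ne_zero_of_one_lt_re (by
        rw [Complex.natCast_re]
        exact_mod_cast (by omega : 1 < 2 * k + 2))
    have h2 : (Real.pi : ℂ) ≠ 0 := by exact_mod_cast Real.pi_ne_zero
    have h3 : ((2 * k + 2 - 1).factorial : ℂ) ≠ 0 := by exact_mod_cast Nat.factorial_ne_zero _
    refine div_ne_zero (mul_ne_zero (inv_ne_zero h1) (pow_ne_zero _ ?_)) h3
    simp [h2]
  · rw [EisensteinSeries.q_expansion_riemannZeta hk3 ⟨k + 1, by ring⟩]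
    congr 2
    have hbound : Summable fun n : ℕ ↦ (n : ℂ) ^ (2 * k + 1) * sigma (-(2 * k : ℤ) - 1) n *
        Complex.exp (2 * Real.pi * Complex.I * n * τ) := by
      refine summable_qSeries (C := 1) (K := 2 * k + 2) (fun n ↦ ?_) τ.im_pos
      rw [norm_mul, norm_pow, Complex.norm_natCast]
      calc (n : ℝ) ^ (2 * k + 1) * ‖sigma (-(2 * k : ℤ) - 1) n‖
          ≤ (n : ℝ) ^ (2 * k + 1) * (1 * (n : ℝ) ^ 1) := by
            gcongr
            exact norm_sigma_neg_le k n
        _ = _ := by ring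
    rw [qSeries, ← tsum_zero_pnat_eq_tsum_nat hbound]
    simp only [sigma_zero, mul_zero, zero_mul, zero_add]
    refine tsum_congr fun n ↦ ?_
    rw [zpow_natCast, ← Complex.exp_nat_mul]
    have h5 := pow_mul_sigma_neg (2 * k + 1) n
    rw [show (-((2 * k + 1 : ℕ) : ℤ)) = -(2 * k : ℤ) - 1 by push_cast; ring] at h5
    rw [h5, show 2 * k + 2 - 1 = 2 * k + 1 from rfl]
    congr 2
    ring

lemma modularForm_moebius {k : ℤ} (E : ModularForm 𝒮ℒ k) (γ : SL(2, ℤ)) (τ : ℍ) :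
    E (moebius γ τ) = ((γ 1 0 : ℂ) * τ + γ 1 1) ^ k * E τ := by
  have : SlashInvariantFormClass (ModularForm 𝒮ℒ k) (CongruenceSubgroup.Gamma 1) k :=
    CongruenceSubgroup.Gamma_one_coe_eq_SL ▸ inferInstance
  have h := SlashInvariantForm.slash_action_eqn_SL'' E (CongruenceSubgroup.mem_Gamma_one γ) τ
  have h2 : γ • τ = moebius γ τ := by
    apply UpperHalfPlane.ext
    rw [coe_moebius (det_pos_SL γ), coe_specialLinearGroup_apply]
    simp
  rw [← h2, h]
  simp [denom]

end Eisenstein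

/-! ### Periods of the series `∑ σ_{-2k-1}(n) q^n` -/

section EichlerIntegral

/-- The non-constant part of the Fourier expansion of `G'_{-2k}`. -/
def sigmaSeries (k : ℕ) : ℂ → ℂ := qSeries (sigma (-(2 * k : ℤ) - 1))

/-- A multiple of `z^{2k+1}` turns `sigmaSeries k` into an iterated primitive of a multiple of the
holomorphic Eisenstein series of weight `2k + 2`. -/
lemma exists_isDerivChain_sigmaSeries {k : ℕ} (hk : 0 < k) : ∃ (c₀ : ℂ) (F : ℕ → ℂ → ℂ),
    IsDerivChain F ∧ (∀ z, F 0 z = sigmaSeries k z + c₀ * z ^ (2 * k + 1)) ∧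
    ∀ (γ : SL(2, ℤ)) (τ : ℍ),
      F (2 * k + 1) (moebius γ τ) = ((γ 1 0 : ℂ) * τ + γ 1 1) ^ (2 * k + 2) * F (2 * k + 1) τ := by
  obtain ⟨A, hA, E, hE⟩ := exists_eisenstein_eq hk
  set c : ℕ → ℂ := sigma (-(2 * k : ℤ) - 1)
  set u : ℂ := 2 * Real.pi * Complex.I
  have hfac : ((2 * k + 1).factorial : ℂ) ≠ 0 := by exact_mod_cast Nat.factorial_ne_zero _
  -- The constant is chosen so that the `(2k+1)`-st derivative of the monomial is `u^(2k+1)/A`,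
  -- which supplies the missing constant term of `E`: the total derivative is `u^(2k+1)/A · E`.
  refine ⟨u ^ (2 * k + 1) * A⁻¹ / (2 * k + 1).factorial, fun j ↦
    qSeries (fun n ↦ (u * n) ^ j * c n) + fun z ↦ u ^ (2 * k + 1) * A⁻¹ / (2 * k + 1).factorial *
      ((2 * k + 1).descFactorial j * z ^ (2 * k + 1 - j)),
    (isDerivChain_qSeries (norm_sigma_neg_le k)).add (isDerivChain_monomial _ _), fun z ↦ ?_, ?_⟩
  · simp [sigmaSeries, c]
  · have key (τ : ℍ) : (qSeries (fun n ↦ (u * n) ^ (2 * k + 1) * c n) + fun z ↦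
        u ^ (2 * k + 1) * A⁻¹ / (2 * k + 1).factorial * ((2 * k + 1).descFactorial (2 * k + 1) *
          z ^ (2 * k + 1 - (2 * k + 1)))) τ = u ^ (2 * k + 1) * A⁻¹ * E τ := by
      rw [hE, Pi.add_apply, Nat.descFactorial_self, Nat.sub_self, pow_zero]
      have : qSeries (fun n ↦ (u * n) ^ (2 * k + 1) * c n) τ =
          u ^ (2 * k + 1) * qSeries (fun n ↦ (n : ℂ) ^ (2 * k + 1) * c n) τ := by
        rw [qSeries, qSeries, ← tsum_mul_left]
        exact tsum_congr fun n ↦ by ring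
      rw [this]
      field_simp
      ring
    intro γ τ
    beta_reduce
    rw [key, key, modularForm_moebius, zpow_natCast]
    ring

/-- The corrected series has polynomial periods. The period of `z^(2k+1)` itself in weight `-2k` has
the pole `-d/c` when `c ≠ 0`, which is why rational functions are admitted. -/
lemma sigmaSeries_slash {k : ℕ} (hk : 0 < k) (γ : SL(2, ℤ)) :
    (fun τ : ℍ ↦ ((γ 1 0 : ℂ) * τ + γ 1 1) ^ (2 * k) * sigmaSeries k (moebius γ τ) -
      sigmaSeries k τ) ∈ ratFunctions := by
  obtain ⟨c₀, F, hF, hF0, htrans⟩ := exists_isDerivChain_sigmaSeries hk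
  have hγ := det_pos_SL γ
  have hcoe (z : ℂ) (hz : 0 < z.im) := coe_moebius hγ ⟨z, hz⟩
  obtain ⟨P, hP⟩ := exists_polynomial_period hF (2 * k)
    (a := γ 0 0) (b := γ 0 1) (c := γ 1 0) (d := γ 1 1)
    (by have := γ.det_coe; rw [Matrix.det_fin_two] at this; exact_mod_cast this)
    (fun z hz ↦ denom_ne_zero_of_det_pos hγ ⟨z, hz⟩)
    (fun z hz ↦ by
      have := (moebius γ ⟨z, hz⟩).im_pos
      rwa [← coe_im, hcoe z hz] at this)
    (fun z hz ↦ by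
      have := htrans γ ⟨z, hz⟩
      rwa [hcoe z hz] at this)
  have h1 := polynomial_mem_ratFunctions P
  have h2 := ratFunctions.smul_mem c₀
    (polynomial_mem_ratFunctions (Polynomial.X ^ (2 * k + 1)))
  have h3 := ratFunctions.smul_mem c₀ (mul_mem_ratFunctions
    (pow_mem_ratFunctions (linear_mem_ratFunctions (γ 1 0) (γ 1 1)) (2 * k))
    (pow_mem_ratFunctions (coe_moebius_mem_ratFunctions hγ) (2 * k + 1)))
  convert ratFunctions.sub_mem (ratFunctions.add_mem h1 h2) h3 using 1
  funext τ
  have := hP τ τ.im_pos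
  rw [← coe_moebius hγ, hF0, hF0] at this
  simp only [Pi.sub_apply, Pi.add_apply, Pi.smul_apply, Pi.mul_apply, Pi.pow_apply, smul_eq_mul,
    Polynomial.eval_pow, Polynomial.eval_X]
  linear_combination this

end EichlerIntegral

/-! ### `G'_{-2k}` as an automorphic integral -/

section Membership

lemma exists_hasFourierPart_of_hasQExpansion (X : Submodule ℂ (ℍ → ℂ)) {f : ℍ → ℂ} {lam : ℕ → ℂ}
    (hf : HasQExpansion f lam) : ∃ a, HasFourierPart X f a := by
  refine ⟨fun l ↦ if 0 ≤ l then lam l.toNat else 0, ⟨0, fun l hl ↦ if_neg (by omega)⟩, f,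
    fun τ ↦ ?_, by simp⟩
  have hinj : Function.Injective (Nat.cast : ℕ → ℤ) := Nat.cast_injective
  refine (hinj.hasSum_iff fun l hl ↦ ?_).mp (by simpa [Function.comp_def] using hf τ)
  beta_reduce
  rw [if_neg (fun h ↦ hl ⟨l.toNat, Int.toNat_of_nonneg h⟩), zero_mul]

lemma mem_autIntegrals_of_hasQExpansion {m : ℤ} {X : Submodule ℂ (ℍ → ℂ)} {f : ℍ → ℂ}
    {lam : ℕ → ℂ} (hf : HasQExpansion f lam) (hd : MDifferentiable 𝓘(ℂ) 𝓘(ℂ) f)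
    (hX : IsInvariantMod m X f) : f ∈ autIntegrals m X := by
  refine ⟨hd, fun τ ↦ ?_, hX, fun γ ↦ ?_⟩
  · refine (hf _).unique ?_
    convert hf τ using 3 with l
    rw [coe_vadd, Complex.ofReal_one, mul_add, mul_one, add_comm, Complex.exp_add,
      mul_comm _ (l : ℂ), Complex.exp_nat_mul_two_pi_mul_I]
    simp
  · obtain ⟨a, ha⟩ := exists_hasFourierPart_of_hasQExpansion X hf
    exact ⟨a, ha.congr (hX γ)⟩

/-- The Fourier coefficients of `G'_{-2k}`. -/
def diffCoeff (k l : ℕ) : ℂ :=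
  if l = 0 then constC k / 2 * riemannZeta (2 * k + 1)
  else constC k * sigma (-(2 * k : ℤ) - 1) l

lemma diffEisenstein_eq_sigmaSeries {k : ℕ} (hk : 0 < k) (τ : ℍ) :
    diffEisenstein (-(2 * k : ℤ)) τ =
      constC k / 2 * riemannZeta (2 * k + 1) + constC k * sigmaSeries k τ := by
  rw [diffEisenstein_eq hk, sigmaSeries, qSeries]
  congr 2
  refine tsum_congr fun n ↦ ?_
  rw [← Complex.exp_nat_mul]
  congr 2
  ring

lemma hasQExpansion_diffEisenstein {k : ℕ} (hk : 0 < k) :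
    HasQExpansion (diffEisenstein (-(2 * k : ℤ))) (diffCoeff k) := by
  intro τ
  rw [diffEisenstein_eq_sigmaSeries hk]
  have h1 := (summable_qSeries (norm_sigma_neg_le k) τ.im_pos).hasSum.mul_left (constC k)
  have h2 := hasSum_ite_eq (0 : ℕ) (constC k / 2 * riemannZeta (2 * k + 1))
  refine (h2.add h1).congr_fun fun l ↦ ?_
  rcases eq_or_ne l 0 with rfl | hl
  · simp [diffCoeff, sigma_zero]
  · simp [diffCoeff, hl, mul_assoc]

lemma mdifferentiable_diffEisenstein {k : ℕ} (hk : 0 < k) :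
    MDifferentiable 𝓘(ℂ) 𝓘(ℂ) (diffEisenstein (-(2 * k : ℤ))) := by
  rw [UpperHalfPlane.mdifferentiable_iff]
  have hd : DifferentiableOn ℂ (sigmaSeries k) {z | 0 < z.im} := fun z hz ↦
    (hasDerivAt_qSeries (norm_sigma_neg_le k) hz).differentiableAt.differentiableWithinAt
  refine ((hd.const_mul (constC k)).const_add (constC k / 2 * riemannZeta (2 * k + 1))).congr
    fun z hz ↦ ?_
  rw [Function.comp_apply, diffEisenstein_eq_sigmaSeries hk, ofComplex_apply_of_im_pos hz]

lemma isInvariantMod_diffEisenstein {k : ℕ} (hk : 0 < k) :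
    IsInvariantMod (-(2 * k : ℤ)) ratFunctions (diffEisenstein (-(2 * k : ℤ))) := by
  intro γ
  have h1 := ratFunctions.smul_mem (constC k) (sigmaSeries_slash hk γ)
  -- The constant term of `G'_{-2k}` has as period a multiple of `(cτ+d)^(2k) - 1`.
  have h2 := ratFunctions.smul_mem (constC k / 2 * riemannZeta (2 * k + 1))
    (ratFunctions.sub_mem
      (pow_mem_ratFunctions (linear_mem_ratFunctions (γ 1 0) (γ 1 1)) (2 * k))
      (polynomial_mem_ratFunctions 1))
  convert ratFunctions.add_mem h1 h2 using 1
  funext τ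
  simp only [Pi.sub_apply, Pi.add_apply, Pi.smul_apply, Pi.pow_apply, smul_eq_mul,
    Polynomial.eval_one, slash_apply, diffEisenstein_eq_sigmaSeries hk, γ.det_coe]
  rw [neg_neg, show (2 * k : ℤ) = (2 * k : ℕ) by push_cast; rfl, zpow_natCast]
  simp only [Int.cast_one, Real.one_rpow, Complex.ofReal_one]
  ring

lemma diffEisenstein_mem_autIntegrals {k : ℕ} (hk : 0 < k) :
    diffEisenstein (-(2 * k : ℤ)) ∈ autIntegrals (-(2 * k : ℤ)) ratFunctions :=
  mem_autIntegrals_of_hasQExpansion (hasQExpansion_diffEisenstein hk)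
    (mdifferentiable_diffEisenstein hk) (isInvariantMod_diffEisenstein hk)

end Membership

/-! ### Hecke eigenvalues and normalization -/

section Eigenvalue

lemma heckeT_one {k n : ℕ} (hn : 0 < n) : heckeT k n 1 = sigma (-(k : ℤ) - 1) n • 1 := by
  funext τ
  rw [(heckeT_apply' hn 1 τ)]
  have hn' : (n : ℂ) ≠ 0 := by exact_mod_cast hn.ne'
  simp only [Pi.one_apply, mul_one, Finset.sum_const, Finset.card_range, Pi.smul_apply,
    smul_eq_mul, nsmul_eq_mul, sigma, Finset.mul_sum]
  rw [Nat.sum_divisorsAntidiagonal (fun a d ↦ 1 / (n : ℂ) * (d * (a : ℂ) ^ (-(k : ℤ))))]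
  refine Finset.sum_congr rfl fun d hd ↦ ?_
  have hd' : (d : ℂ) ≠ 0 := by exact_mod_cast (Nat.pos_of_mem_divisors hd).ne'
  rw [Nat.cast_div (Nat.dvd_of_mem_divisors hd) hd', zpow_sub_one₀ hd']
  field_simp

lemma mul_div_sq_pos {m n d : ℕ} (hm : 0 < m) (hn : 0 < n) (hd : d ∈ (n.gcd m).divisors) :
    0 < n * m / d ^ 2 := by
  have hdg := Nat.dvd_of_mem_divisors hd
  have hd2 : d ^ 2 ∣ n * m := by
    rw [sq]
    exact mul_dvd_mul (hdg.trans (Nat.gcd_dvd_left _ _)) (hdg.trans (Nat.gcd_dvd_right _ _))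
  exact Nat.div_pos (Nat.le_of_dvd (by positivity) hd2) (pow_pos (Nat.pos_of_mem_divisors hd) 2)

/-- The Hecke relations applied to the constant function `1`, whose eigenvalues are these divisor
sums. The point of evaluation is immaterial. -/
lemma sigma_mul_sigma (k : ℕ) {m n : ℕ} (hm : 0 < m) (hn : 0 < n) :
    sigma (-(k : ℤ) - 1) n * sigma (-(k : ℤ) - 1) m =
      ∑ d ∈ (n.gcd m).divisors, (d : ℂ) ^ (-(k : ℤ) - 1) *
        sigma (-(k : ℤ) - 1) (n * m / d ^ 2) := by
  have h := congrFun (heckeT_heckeT (k := k) hm hn (f := 1) (fun _ ↦ rfl)) I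
  rw [heckeT_one hm, map_smul, heckeT_one hn, Finset.sum_apply] at h
  simp only [Pi.smul_apply, Pi.one_apply, smul_eq_mul, mul_one] at h
  rw [mul_comm, h]
  refine Finset.sum_congr rfl fun d hd ↦ ?_
  rw [heckeT_one (mul_div_sq_pos hm hn hd)]
  simp

/-- For `l = 0` one has `gcd(n, 0) = n`, and the sum of `d^(-2k-1)` is already the eigenvalue; for
`l > 0` this is `sigma_mul_sigma`. -/
lemma diffCoeff_hecke {k n : ℕ} (hn : 0 < n) (l : ℕ) :
    ∑ d ∈ (n.gcd l).divisors, (d : ℂ) ^ (-((2 * k : ℕ) : ℤ) - 1) * diffCoeff k (n * l / d ^ 2) =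
      sigma (-(2 * k : ℤ) - 1) n * diffCoeff k l := by
  rcases Nat.eq_zero_or_pos l with rfl | hl
  · simp [diffCoeff, sigma, Finset.sum_mul]
  · have h := sigma_mul_sigma (2 * k) hl hn
    rw [show -(2 * k : ℤ) - 1 = -((2 * k : ℕ) : ℤ) - 1 by push_cast; rfl, diffCoeff,
      if_neg hl.ne', mul_left_comm,
      show -(2 * k : ℤ) - 1 = -((2 * k : ℕ) : ℤ) - 1 by push_cast; rfl, h, Finset.mul_sum]
    refine Finset.sum_congr rfl fun d hd ↦ ?_
    rw [diffCoeff, if_neg (mul_div_sq_pos hl hn hd).ne', mul_left_comm]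
    push_cast
    rfl

lemma heckeT_diffEisenstein {k n : ℕ} (hk : 0 < k) (hn : 0 < n) :
    heckeT (2 * k) n (diffEisenstein (-(2 * k : ℤ))) =
      sigma (-(2 * k : ℤ) - 1) n • diffEisenstein (-(2 * k : ℤ)) := by
  funext τ
  refine (hasQExpansion_heckeT hn (hasQExpansion_diffEisenstein hk) τ).unique ?_
  rw [Pi.smul_apply, smul_eq_mul]
  refine ((hasQExpansion_diffEisenstein hk τ).mul_left _).congr_fun fun l ↦ ?_
  beta_reduce
  rw [← mul_assoc, diffCoeff_hecke hn]

lemma riemannZeta_two_mul_add_one_ne_zero {k : ℕ} (hk : 0 < k) :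
    riemannZeta (2 * k + 1) ≠ 0 := by
  refine riemannZeta_ne_zero_of_one_lt_re ?_
  have : (0 : ℝ) < k := by exact_mod_cast hk
  simpa using this

lemma constC_ne_zero (k : ℕ) : constC k ≠ 0 := by
  have h1 : ((2 * k).factorial : ℂ) ≠ 0 := by exact_mod_cast Nat.factorial_ne_zero _
  have h2 : (Real.pi : ℂ) ≠ 0 := by exact_mod_cast Real.pi_ne_zero
  rw [constC]
  refine mul_ne_zero two_ne_zero (div_ne_zero (mul_ne_zero ?_ h1) ?_)
  · exact pow_ne_zero _ (by simp)
  · exact pow_ne_zero _ (by simp [h2])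

lemma hasQExpansion_normEisenstein {k : ℕ} (hk : 0 < k) :
    HasQExpansion (normEisenstein k) (normCoeff k) := by
  intro τ
  have := (hasQExpansion_diffEisenstein hk τ).mul_left (2 / (constC k * riemannZeta (2 * k + 1)))
  refine this.congr_fun fun l ↦ ?_
  have h1 := constC_ne_zero k
  have h2 := riemannZeta_two_mul_add_one_ne_zero hk
  rw [← mul_assoc]
  congr 1
  rcases eq_or_ne l 0 with rfl | hl
  · simp only [normCoeff, diffCoeff, if_true]
    field_simp
  · simp only [normCoeff, diffCoeff, if_neg hl]
    field_simp

lemma sigma_one (m : ℤ) : sigma m 1 = 1 := by simp [sigma]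

lemma normCoeff_one_ne_zero {k : ℕ} (hk : 0 < k) : normCoeff k 1 ≠ 0 := by
  have h2 := riemannZeta_two_mul_add_one_ne_zero hk
  simp [normCoeff, sigma_one, h2]

lemma normCoeff_div_normCoeff_one {k n : ℕ} (hk : 0 < k) (hn : 0 < n) :
    normCoeff k n / normCoeff k 1 = sigma (-(2 * k : ℤ) - 1) n := by
  have h2 := riemannZeta_two_mul_add_one_ne_zero hk
  simp only [normCoeff, hn.ne', one_ne_zero, if_false, sigma_one]
  field_simp

end Eigenvalue

/-! ### The `L`-function as a Dirichlet convolution -/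

section LSeries

lemma LSeriesHasSum_zpow_neg (N : ℕ) {s : ℂ} (hs : 1 < s.re) :
    LSeriesHasSum (fun n ↦ (n : ℂ) ^ (-(N : ℤ))) s (riemannZeta (s + N)) := by
  have h : 1 < (s + N).re := by
    have : (0 : ℝ) ≤ N := N.cast_nonneg
    simp only [Complex.add_re, Complex.natCast_re]
    linarith
  have := LSeriesHasSum_one h
  rw [LSeriesHasSum] at this ⊢
  refine this.congr_fun fun n ↦ ?_
  rcases eq_or_ne n 0 with rfl | hn
  · simp
  · have hn' : (n : ℂ) ≠ 0 := by exact_mod_cast hn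
    rw [LSeries.term_of_ne_zero hn, LSeries.term_of_ne_zero hn, Complex.cpow_add _ _ hn',
      Complex.cpow_natCast, zpow_neg, zpow_natCast, Pi.one_apply, one_div, mul_inv, div_eq_mul_inv,
      mul_comm]

lemma LSeriesHasSum_sigma_neg (N : ℕ) {s : ℂ} (hs : 1 < s.re) :
    LSeriesHasSum (sigma (-(N : ℤ))) s (riemannZeta s * riemannZeta (s + N)) := by
  have := (LSeriesHasSum_one hs).convolution (LSeriesHasSum_zpow_neg N hs)
  rw [LSeries.convolution_def] at this
  convert this using 2 with n
  simp only [Pi.one_apply, one_mul]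
  rw [sigma, Nat.sum_divisorsAntidiagonal' (fun _ d ↦ (d : ℂ) ^ (-(N : ℤ)))]

lemma LSeriesHasSum_normCoeff {k : ℕ} (hk : 0 < k) {s : ℂ} (hs : 1 < s.re) :
    LSeriesHasSum (fun n ↦ normCoeff k n / normCoeff k 1) s
      (riemannZeta s * riemannZeta (s + 2 * k + 1)) := by
  have := LSeriesHasSum_sigma_neg (2 * k + 1) hs
  rw [show s + ((2 * k + 1 : ℕ) : ℂ) = s + 2 * k + 1 by push_cast; ring] at this
  -- The two sequences differ at index `0`, which an `L`-series disregards.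
  refine (LSeriesHasSum_congr s _ fun {n} hn ↦ ?_).mp this
  rw [normCoeff_div_normCoeff_one hk (Nat.pos_of_ne_zero hn)]
  congr 1
  push_cast
  ring

end LSeries

end HeckeIntegral

end

theorem lemma5p15 :
    -- Hecke operators in weight `-k`
    (∀ (k : ℕ), 0 < k → ∀ (X : Submodule ℂ (UpperHalfPlane → ℂ)),
      HeckeIntegral.IsHeckeStable (-(k : ℤ)) X →
      -- coset formula: independence modulo `X` of representatives and of the class of `f`
      (∀ n : ℕ, 0 < n → ∀ R R' : Finset (Matrix (Fin 2) (Fin 2) ℤ),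
        HeckeIntegral.IsRepSystem n R → HeckeIntegral.IsRepSystem n R' →
        ∀ f ∈ HeckeIntegral.autIntegrals (-(k : ℤ)) X ⊔ X,
        ∀ g ∈ HeckeIntegral.autIntegrals (-(k : ℤ)) X ⊔ X,
          f - g ∈ X → HeckeIntegral.heckeSum k n R f - HeckeIntegral.heckeSum k n R' g ∈ X) ∧
      (∀ n : ℕ, 0 < n → ∀ R : Finset (Matrix (Fin 2) (Fin 2) ℤ), HeckeIntegral.IsRepSystem n R →
        ∀ f ∈ HeckeIntegral.autIntegrals (-(k : ℤ)) X, ∀ γ : Matrix.SpecialLinearGroup (Fin 2) ℤ,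
          HeckeIntegral.slash (-(k : ℤ)) γ (HeckeIntegral.heckeSum k n R f) -
            HeckeIntegral.heckeSum k n R f ∈ X) ∧
      -- `T(n)` is an endomorphism, and preserves the cusp forms
      (∀ n : ℕ, 0 < n → ∀ f ∈ HeckeIntegral.autIntegrals (-(k : ℤ)) X,
        HeckeIntegral.heckeT k n f ∈ HeckeIntegral.autIntegrals (-(k : ℤ)) X) ∧
      (∀ n : ℕ, 0 < n → ∀ f ∈ HeckeIntegral.cuspIntegrals (-(k : ℤ)) X,
        HeckeIntegral.heckeT k n f ∈ HeckeIntegral.cuspIntegrals (-(k : ℤ)) X) ∧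
      -- explicit formulas, with the triangular representatives
      (∀ n : ℕ, 0 < n → HeckeIntegral.IsRepSystem n (HeckeIntegral.triangular n) ∧
        ∀ f ∈ HeckeIntegral.autIntegrals (-(k : ℤ)) X, ∀ τ : UpperHalfPlane,
          HeckeIntegral.heckeT k n f τ =
            (n : ℂ) ^ (-(k : ℤ) - 1) * ∑ x ∈ n.divisorsAntidiagonal, ∑ b ∈ Finset.range x.2,
              (x.2 : ℂ) ^ k *
                f (UpperHalfPlane.ofComplex (((x.1 : ℂ) * τ + (b : ℂ)) / (x.2 : ℂ))) ∧
          HeckeIntegral.heckeT k n f τ =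
            1 / (n : ℂ) * ∑ x ∈ n.divisorsAntidiagonal, ∑ b ∈ Finset.range x.2,
              (x.1 : ℂ) ^ (-(k : ℤ)) *
                f (UpperHalfPlane.ofComplex (((x.1 : ℂ) * τ + (b : ℂ)) / (x.2 : ℂ)))) ∧
      -- action on Fourier coefficients
      (∀ n : ℕ, 0 < n → ∀ f ∈ HeckeIntegral.autIntegrals (-(k : ℤ)) X, ∀ lam : ℕ → ℂ,
        HeckeIntegral.HasQExpansion f lam →
        HeckeIntegral.HasQExpansion (HeckeIntegral.heckeT k n f) (fun l ↦
          ∑ d ∈ (Nat.gcd n l).divisors, (d : ℂ) ^ (-(k : ℤ) - 1) * lam (n * l / d ^ 2))) ∧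
      -- multiplicativity
      (∀ m n : ℕ, 0 < m → 0 < n → ∀ f ∈ HeckeIntegral.autIntegrals (-(k : ℤ)) X,
        HeckeIntegral.heckeT k n (HeckeIntegral.heckeT k m f) =
          ∑ d ∈ (Nat.gcd n m).divisors,
            (d : ℂ) ^ (-(k : ℤ) - 1) • HeckeIntegral.heckeT k (n * m / d ^ 2) f ∧
        HeckeIntegral.heckeT k n (HeckeIntegral.heckeT k m f) =
          HeckeIntegral.heckeT k m (HeckeIntegral.heckeT k n f) ∧
        (Nat.Coprime n m →
          HeckeIntegral.heckeT k n (HeckeIntegral.heckeT k m f) =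
            HeckeIntegral.heckeT k (n * m) f))) ∧
    -- `G(s, τ)` continues uniquely to an entire function of `s`
    (∀ τ : UpperHalfPlane, ∃! Φ : ℂ → ℂ, HeckeIntegral.IsEisensteinContinuation τ Φ) ∧
    -- the differential Eisenstein series
    (∀ k : ℕ, 0 < k →
      HeckeIntegral.IsHeckeStable (-(2 * k : ℤ)) HeckeIntegral.ratFunctions ∧
      HeckeIntegral.diffEisenstein (-(2 * k : ℤ)) ∈
        HeckeIntegral.autIntegrals (-(2 * k : ℤ)) HeckeIntegral.ratFunctions ∧
      (∀ n : ℕ, 0 < n →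
        HeckeIntegral.heckeT (2 * k) n (HeckeIntegral.diffEisenstein (-(2 * k : ℤ))) =
          HeckeIntegral.sigma (-(2 * k : ℤ) - 1) n •
            HeckeIntegral.diffEisenstein (-(2 * k : ℤ))) ∧
      HeckeIntegral.HasQExpansion (HeckeIntegral.normEisenstein k)
        (HeckeIntegral.normCoeff k) ∧
      -- its `L`-function, formed with the coefficients scaled so that the first one is `1`
      HeckeIntegral.normCoeff k 1 ≠ 0 ∧
      (∀ n : ℕ, 0 < n → HeckeIntegral.normCoeff k n / HeckeIntegral.normCoeff k 1 =
        HeckeIntegral.sigma (-(2 * k : ℤ) - 1) n) ∧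
      (∀ s : ℂ, 1 < s.re →
        LSeriesHasSum (fun n ↦ HeckeIntegral.normCoeff k n / HeckeIntegral.normCoeff k 1) s
          (riemannZeta s * riemannZeta (s + 2 * k + 1)))) := by
  refine ⟨fun k _ X hX ↦ ⟨fun n hn R R' hR hR' f hf g _ hfg ↦ ?_, fun n hn R hR f hf γ ↦ ?_,
    fun n hn f hf ↦ ?_, fun n hn f hf ↦ ?_, fun n hn ↦ ⟨?_, fun f _ τ ↦ ⟨?_, ?_⟩⟩,
    fun n hn f _ lam hlam ↦ ?_, fun m n hm hn f hf ↦ ?_⟩, ?_, fun k hk ↦ ⟨?_, ?_, ?_, ?_, ?_, ?_, ?_⟩⟩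
  · exact HeckeIntegral.heckeSum_sub_heckeSum_mem hn hX hR hR'
      (HeckeIntegral.IsInvariantMod.of_mem_sup hX hf) hfg
  · exact HeckeIntegral.IsInvariantMod.heckeSum hn hX hR hf.2.2.1 γ
  · exact HeckeIntegral.heckeT_mem_autIntegrals hn hX hf
  · exact HeckeIntegral.heckeT_mem_cuspIntegrals hn hX hf
  · exact HeckeIntegral.isRepSystem_triangular hn
  · exact HeckeIntegral.heckeT_apply hn f τ
  · exact HeckeIntegral.heckeT_apply' hn f τ
  · exact HeckeIntegral.hasQExpansion_heckeT hn hlam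
  · have h := HeckeIntegral.heckeT_heckeT (k := k) hm hn hf.2.1
    refine ⟨h, ?_, fun hnm ↦ ?_⟩
    · rw [h, HeckeIntegral.heckeT_heckeT (k := k) hn hm hf.2.1, Nat.gcd_comm, mul_comm n m]
    · rw [h, Nat.Coprime.gcd_eq_one hnm]
      simp
  · exact HeckeIntegral.existsUnique_eisensteinContinuation
  · exact HeckeIntegral.isHeckeStable_ratFunctions _
  · exact HeckeIntegral.diffEisenstein_mem_autIntegrals hk
  · exact fun n hn ↦ HeckeIntegral.heckeT_diffEisenstein hk hn
  · exact HeckeIntegral.hasQExpansion_normEisenstein hk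
  · exact HeckeIntegral.normCoeff_one_ne_zero hk
  · exact fun n hn ↦ HeckeIntegral.normCoeff_div_normCoeff_one hk hn
  · exact fun s hs ↦ HeckeIntegral.LSeriesHasSum_normCoeff hk hs
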